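/- Let $g\colon(\mathbb C,0)\to(\mathbb C,0)$ be a holomorphic parabolic germ of codimension $k\ge 1$, i.e. $g(z)-z$ vanishes at $0$ to the exact order $k+1$. **Notation.** $T_C(W)=W+C$ and $\Sigma(W)=\overline W$. A germ is *prenormalized* (with formal invariant $b\in\mathbb C$) if it has the form $z+z^{k+1}+\bigl(\tfrac{k+1}2-b\bigr)z^{2k+1}+o(z^{2k+1})$; every $g$ as above is analytically conjugate to such a germ, and $b$ is determined by $g$. For a prenormalized germ $g_0$, let $S_j$ ($-k\le j\le k$, $S_{-k}=S_k$) be the petal around the direction $e^{i\pi j/k}$ (a small sector of opening between $\pi/k$ and $2\pi/k$), and let $\varphi_j$ be a Fatou coordinate on $S_j$, i.e. an injective holomorphic map with $\varphi_j\circ g_0=T_1\circ\varphi_j$, where $\varphi_{-k}=\varphi_k$. For $j\in\{-k,\dots,-1,1,\dots,k\}$ the transition function is $\Psi_j=\varphi_j\circ\varphi_{j-\operatorname{sgn} j}^{-1}$ ($j$ odd) or $\Psi_j=\varphi_{j-\operatorname{sgn}j}\circ\varphi_j^{-1}$ ($j$ even), extended by $\Psi_j\circ T_1=T_1\circ\Psi_j$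 to a half-plane: an upper one if ($j>0$ is odd or $j<0$ is even), a lower one otherwise. Functions $\Psi_j$ are identified if they agree on some such half-plane, and identities between them are understood in this sense. The $\Psi_j$ are *normalized* if the constant term $\lim(\Psi_j(W)-W)$, as $\operatorname{Im}W\to\pm\infty$ in that half-plane, is $-i\pi b/k$ in the upper case and $i\pi b/k$ in the lower case. Give the index $j$ the position $j$ if $j>0$ and $2k+1+j$ if $j<0$. For $\ell\in\mathbb Z$ let $s_\ell$ be the permutation of the indices induced by the reflection across the axis $e^{i\pi\ell/k}\mathbb R$: it sends position $p$ to $2\ell+1-p$ modulo $2k$. In particular $s_0(j)=-j$. A *representative* of the Écalle–Voronin modulus $(k,b,[\Psi_{-k},\dots,\Psi_{-1},\Psi_1,\dots,\Psi_k])$ of $g$ is a tuple obtained from normalized transition functions of a prenormalized germ analytically conjugate to $g$ by a common conjugation $\Psi_j\mapsto T_C\circ\Psi_j\circ T_{-C}$ ($C\in\mathbb C$) and a shift of the positions by an even integer modulo $2k$. **Theorem.** (A) The following are equivalent: 1. $g$ preserves a germ of (regular) real analytic curve at the origin; 2. $g$ is analytically conjugate to a germ with real coefficients; 3. for each representative $(\Psi_j)$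 of the modulus there are $\ell\in\mathbb Z$ and $y\in\mathbb R$ such that $\Sigma\circ T_{iy}\circ\Psi_j=\Psi_{s_\ell(j)}\circ\Sigma\circ T_{iy}$ for all $j$; 4. there is a representative $(\Psi_j)$ of the modulus such that either $\Psi_j\circ\Sigma=\Sigma\circ\Psi_{-j}$ for all $j$, or $k$ is even and $\Psi_j\circ\Sigma=\Sigma\circ\Psi_{s_1(j)}$ for all $j$. (B) Suppose moreover that $g$ is prenormalized, and let $\ell\in\mathbb Z$. Then the following are equivalent: 1. $g$ preserves a germ of regular real analytic curve tangent at $0$ to $e^{i\pi\ell/k}\mathbb R$; 2. $g$ is conjugate to a germ with real coefficients by a germ of biholomorphism $h$ fixing $0$ with $h'(0)e^{i\pi\ell/k}\in\mathbb R$; 3. for each tuple $(\Psi_j)$ of normalized transition functions of $g$ there is $y\in\mathbb R$ with $\Sigma\circ T_{iy}\circ\Psi_j=\Psi_{s_\ell(j)}\circ\Sigma\circ T_{iy}$ for all $j$; 4. there is a tuple $(\Psi_j)$ of normalized transition functions of $g$ with $\Psi_j\circ\Sigma=\Sigma\circ\Psi_{s_\ell(j)}$ for all $j$. For $\ell=0$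 the conditions 3 and 4 of (B) are $\Sigma\circ T_{iy}\circ\Psi_j=\Psi_{-j}\circ\Sigma\circ T_{iy}$ and $\Psi_j\circ\Sigma=\Sigma\circ\Psi_{-j}$. -/

import Mathlib

open Filter Topology Asymptotics

namespace ParabolicGerm

/-! Germs at the origin are represented by functions `ℂ → ℂ`; only their values near `0` matter. -/

/-- A holomorphic parabolic germ of codimension `k`: it fixes `0` with multiplier `1`, it is not
the identity, and `g z - z` vanishes at `0` to the exact order `k + 1`. -/
structure IsParabolic (g : ℂ → ℂ) (k : ℕ) : Prop where
  analyticAt : AnalyticAt ℂ g 0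
  map_zero : g 0 = 0
  multiplier : deriv g 0 = 1
  codim_pos : 1 ≤ k
  order : analyticOrderAt (fun z => g z - z) 0 = ((k + 1 : ℕ) : ℕ∞)

/-- `h` is a germ of biholomorphism fixing `0` with `h ∘ g = g₀ ∘ h` near `0`. -/
structure IsConjugacy (h g g₀ : ℂ → ℂ) : Prop where
  analyticAt : AnalyticAt ℂ h 0
  map_zero : h 0 = 0
  deriv_ne_zero : deriv h 0 ≠ 0
  conj_eq : h ∘ g =ᶠ[𝓝 0] g₀ ∘ h

/-- A holomorphic germ whose Taylor coefficients at `0` are all real. -/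
def HasRealCoefficients (r : ℂ → ℂ) : Prop :=
  AnalyticAt ℂ r 0 ∧ ∀ n : ℕ, (iteratedDeriv n r 0).im = 0

/-- The germ at `0` of the regular real analytic curve parametrized by `γ` is preserved by `g`.
The filter `map γ (𝓝 0)` is generated by the sets `γ '' I` with `I` a neighbourhood of `0` in `ℝ`,
so the last field says that the images of `γ` and of `g ∘ γ` agree as germs of sets. -/
structure IsInvariantCurve (g : ℂ → ℂ) (γ : ℝ → ℂ) : Prop where
  analyticAt : AnalyticAt ℝ γ 0
  map_zero : γ 0 = 0
  deriv_ne_zero : deriv γ 0 ≠ 0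
  invariant : map (g ∘ γ) (𝓝 0) = map γ (𝓝 0)

/-- Prenormalized germs of codimension `k` with formal invariant `b`. -/
def IsPrenormalized (g : ℂ → ℂ) (k : ℕ) (b : ℂ) : Prop :=
  AnalyticAt ℂ g 0 ∧
    (fun z : ℂ => g z - (z + z ^ (k + 1) + (((k : ℂ) + 1) / 2 - b) * z ^ (2 * k + 1)))
      =o[𝓝 0] fun z : ℂ => z ^ (2 * k + 1)

/-- The open sector of vertex `0`, bisecting direction `θ`, half-opening `α` and radius `r`. -/
def sector (θ α r : ℝ) : Set ℂ :=
  {z | 0 < ‖z‖ ∧ ‖z‖ < r ∧ |Complex.arg (z * Complex.exp (-(θ * Complex.I)))| < α}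

/-- `φ` is a Fatou coordinate, written in the variable `z`, of `g` on the sector around the
direction `j π / k`: a biholomorphism onto its image that conjugates `g` to `W ↦ W + 1`. -/
structure IsFatouCoordinate (g : ℂ → ℂ) (k : ℕ) (j : ℤ) (α r : ℝ) (φ : ℂ → ℂ) : Prop where
  holomorphic : DifferentiableOn ℂ φ (sector (j * Real.pi / k) α r)
  injOn : Set.InjOn φ (sector (j * Real.pi / k) α r)
  abel : ∀ z ∈ sector (j * Real.pi / k) α r, g z ∈ sector (j * Real.pi / k) α r →
    φ (g z) = φ z + 1

/-- The indices `-k, …, -1, 1, …, k` of the transition functions. -/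
def IsIndex (k : ℕ) (j : ℤ) : Prop :=
  j ≠ 0 ∧ -(k : ℤ) ≤ j ∧ j ≤ k

/-- The end of the complex plane at which the `j`-th transition function is defined:
`Im W → +∞` for `j > 0` odd and for `j < 0` even, and `Im W → -∞` otherwise. -/
noncomputable def farEnd (j : ℤ) : Filter ℂ :=
  open Classical in
  if (0 < j ↔ Odd j) then comap Complex.im atTop else comap Complex.im atBot

/-- The normalized constant term of the `j`-th transition function. -/
noncomputable def constantTerm (k : ℕ) (b : ℂ) (j : ℤ) : ℂ :=
  open Classical in
  if (0 < j ↔ Odd j) then -(Complex.I * Real.pi * b / k) else Complex.I * Real.pi * b / k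

/-- `Ψ` is a tuple of normalized transition functions of the prenormalized germ `g`.
There are Fatou coordinates `φ j` on the petals `-k ≤ j ≤ k` (the petals `-k` and `k` are the same
one), on sectors of opening in `(π / k, 2π / k)`. For each index `j`, the function `Ψ j` is
holomorphic on a half-plane, commutes there with `W ↦ W + 1`, has the prescribed constant term,
and is `φ j ∘ (φ (j - sgn j))⁻¹` (`j` odd) or `φ (j - sgn j) ∘ (φ j)⁻¹` (`j` even) on the
intersection of the two petals, a sector around the direction halfway between them. -/
def IsTransition (g : ℂ → ℂ) (k : ℕ) (b : ℂ) (Ψ : ℤ → ℂ → ℂ) : Prop :=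
  ∃ (α r : ℝ) (φ : ℤ → ℂ → ℂ),
    Real.pi / (2 * k) < α ∧ α < Real.pi / k ∧ 0 < r ∧
    (∀ j : ℤ, -(k : ℤ) ≤ j → j ≤ k → IsFatouCoordinate g k j α r (φ j)) ∧
    φ (-(k : ℤ)) = φ k ∧
    ∀ j : ℤ, IsIndex k j →
      (∀ᶠ W in farEnd j, DifferentiableAt ℂ (Ψ j) W) ∧
      (∀ᶠ W in farEnd j, Ψ j (W + 1) = Ψ j W + 1) ∧
      Tendsto (fun W => Ψ j W - W) (farEnd j) (𝓝 (constantTerm k b j)) ∧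
      ∃ ρ : ℝ, 0 < ρ ∧
        ∀ z ∈ sector ((2 * j - j.sign) * Real.pi / (2 * k)) (α - Real.pi / (2 * k)) ρ,
          (Odd j → Ψ j (φ (j - j.sign) z) = φ j z) ∧
          (Even j → Ψ j (φ j z) = φ (j - j.sign) z)

/-- Complex conjugation on the Fatou coordinates. -/
noncomputable def Sig : ℂ → ℂ := fun W => (starRingEnd ℂ) W

/-- The translation by `C`. -/
def T (C : ℂ) : ℂ → ℂ := fun W => W + C

/-- The position in `1, …, 2k`, counted anticlockwise, of the index `j`; thus `-j` has position
`2k - j + 1` for `1 ≤ j ≤ k`. -/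
def position (k : ℕ) (j : ℤ) : ℤ :=
  if 0 < j then j else j + 2 * k + 1

/-- The index whose position is `p` modulo `2k`. -/
def ofPosition (k : ℕ) (p : ℤ) : ℤ :=
  if (p - 1) % (2 * k) + 1 ≤ k then (p - 1) % (2 * k) + 1 else (p - 1) % (2 * k) - 2 * k

/-- The permutation of the indices induced by the rotation of angle `2 m π / k`. -/
def rotateIndex (k : ℕ) (m j : ℤ) : ℤ :=
  ofPosition k (position k j + 2 * m)

/-- The permutation `s_ℓ` of the indices induced by the reflection across the axis
`exp(i π ℓ / k) ℝ`: the sector in position `p` has bisector `(2p - 1) π / (2k)`, so it goes to the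
position `2ℓ + 1 - p`. -/
def reflectIndex (k : ℕ) (l j : ℤ) : ℤ :=
  ofPosition k (2 * l + 1 - position k j)

/-- The reflection across the real axis is `j ↦ -j`. -/
theorem reflectIndex_zero {k : ℕ} {j : ℤ} (hj : IsIndex k j) : reflectIndex k 0 j = -j := by
  obtain ⟨h0, h1, h2⟩ := hj
  unfold reflectIndex ofPosition position
  by_cases h : 0 < j
  · have e : (2 * 0 + 1 - (if 0 < j then j else j + 2 * k + 1) - 1) % (2 * (k : ℤ))
        = 2 * k - j := by
      rw [if_pos h, show (2 * 0 + 1 - j - 1 : ℤ) = (2 * k - j) + (2 * k) * (-1) by ring,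
        Int.add_mul_emod_self_left, Int.emod_eq_of_lt (by omega) (by omega)]
    rw [e]
    split_ifs <;> omega
  · have e : (2 * 0 + 1 - (if 0 < j then j else j + 2 * k + 1) - 1) % (2 * (k : ℤ))
        = -j - 1 := by
      rw [if_neg h, show (2 * 0 + 1 - (j + 2 * k + 1) - 1 : ℤ) = (-j - 1) + (2 * k) * (-1) by ring,
        Int.add_mul_emod_self_left, Int.emod_eq_of_lt (by omega) (by omega)]
    rw [e]
    split_ifs <;> omega

/-- The equivalence of tuples of transition functions: a common translation of all the Fatou
coordinates together with a rotation of the indices. -/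
def Equivalent (k : ℕ) (Ψ Ψ' : ℤ → ℂ → ℂ) : Prop :=
  ∃ (C : ℂ) (m : ℤ), ∀ j : ℤ, IsIndex k j →
    Ψ j =ᶠ[farEnd j] T C ∘ Ψ' (rotateIndex k m j) ∘ T (-C)

/-- `Ψ` is a representative of the class `[Ψ]` in the Écalle–Voronin modulus `(k, b, [Ψ])` of `g`:
it is equivalent to a tuple of normalized transition functions of `g` written in a
prenormalizing coordinate. -/
def IsModulusRepresentative (g : ℂ → ℂ) (k : ℕ) (b : ℂ) (Ψ : ℤ → ℂ → ℂ) : Prop :=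
  ∃ (h g₀ : ℂ → ℂ) (Ψ₀ : ℤ → ℂ → ℂ), IsConjugacy h g g₀ ∧ IsPrenormalized g₀ k b ∧
    IsTransition g₀ k b Ψ₀ ∧ Equivalent k Ψ Ψ₀

/-- `Σ ∘ T_{iy} ∘ Ψ_j = Ψ_{s_ℓ(j)} ∘ Σ ∘ T_{iy}` for all indices `j`. -/
def IsTwistedSymmetric (k : ℕ) (l : ℤ) (y : ℝ) (Ψ : ℤ → ℂ → ℂ) : Prop :=
  ∀ j : ℤ, IsIndex k j →
    Sig ∘ T (Complex.I * y) ∘ Ψ j =ᶠ[farEnd j] Ψ (reflectIndex k l j) ∘ Sig ∘ T (Complex.I * y)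

/-- `Ψ_j ∘ Σ = Σ ∘ Ψ_{s_ℓ(j)}` for all indices `j`. -/
def IsSymmetric (k : ℕ) (l : ℤ) (Ψ : ℤ → ℂ → ℂ) : Prop :=
  ∀ j : ℤ, IsIndex k j →
    Ψ j ∘ Sig =ᶠ[farEnd (reflectIndex k l j)] Sig ∘ Ψ (reflectIndex k l j)

end ParabolicGerm

open ParabolicGerm

/-! A regular real analytic curve through 0 is the image of the real axis under a holomorphic germ,
whose inverse straightens it; a germ preserving the real axis has real coefficients. So conditions 1
and 2 are two forms of one statement. A conjugacy `h` to a real germ also amounts to an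
antiholomorphic involution σ commuting with g: take σ = h⁻¹ ∘ Σ ∘ h, and conversely average σ with
the identity to linearize it (`exists_isConjugacy_of_involution`). Writing σ = Σ ∘ κ, the datum is a
conjugacy κ from g to its mirror image Σ ∘ g ∘ Σ for which σ is involutive.

The modulus detects such κ. In the coordinate -1/(k z^k) a prenormalized germ is close to a unit
translation on every petal. Fatou coordinates with expansion -1/(k z^k) + b log z + D + o(1) are
obtained by summing along orbits the defect of an approximate solution of Abel's equation
(`exists_fatou`). They are unique up to a constant: two of them differ by an injective map commuting
with W ↦ W + 1 on a sector, which extends to an injective entire function, hence is a translation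
(`exists_eq_add_of_injOn`, `eq_add_of_injective_entire`). The normalized constant terms force the
same constant on all petals (`IsTransition.exists_family`), so a tuple of normalized transition
functions carries only one translation parameter.

Consequently a conjugacy permutes the standard coordinates up to one common translation
(`IsConjugacy.exists_eq_add`). Conversely, if two germs have the same transition functions, the maps
s₁⁻¹ ∘ s₀ on the petals agree on overlaps and extend across 0 to a conjugacy
(`exists_isConjugacy_of_isGluing`).

The mirror image of g has the coordinates Σ ∘ s_{-j} ∘ Σ. If σ exists, it acts on Fatou coordinates
by W ↦ Σ(W + C), and σ² = id forces C = iy: this is the twisted symmetry of condition 3. A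
translation by iy/2 removes y. Conversely a symmetric tuple yields κ, and σ² is the identity because
it acts trivially on Fatou coordinates. When no axis is prescribed, rotations change ℓ by even
integers, and ℓ and ℓ + k give the same line, so ℓ reduces to 0, or to 1 when k is even
(`exists_parity`). -/

namespace ParabolicGerm

/-! ### Sectors at infinity and maps asymptotic to the identity. -/

/-- The neighbourhoods of `∞` in the sector `|arg X| < β`. -/
noncomputable def infSector (β : ℝ) : Filter ℂ := Bornology.cobounded ℂ ⊓ 𝓟 {X | |X.arg| < β}

theorem eventually_infSector {β : ℝ} {P : ℂ → Prop} :
    (∀ᶠ X in infSector β, P X) ↔ ∃ R : ℝ, 1 ≤ R ∧ ∀ X : ℂ, R ≤ ‖X‖ → |X.arg| < β → P X := by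
  unfold infSector
  rw [eventually_inf_principal, Filter.hasBasis_cobounded_norm.eventually_iff]
  constructor
  · rintro ⟨R, -, h⟩
    exact ⟨max R 1, le_max_right _ _, fun X hX hX' => h ((le_max_left _ _).trans hX) hX'⟩
  · rintro ⟨R, -, h⟩
    exact ⟨R, trivial, fun X hX hX' => h X hX hX'⟩

theorem infSector_mono {β β' : ℝ} (h : β' ≤ β) : infSector β' ≤ infSector β :=
  inf_le_inf_left _ (principal_mono.2 fun _ hX => lt_of_lt_of_le hX h)

theorem infSector_ne_zero {β : ℝ} : ∀ᶠ X in infSector β, X ≠ 0 :=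
  eventually_infSector.2 ⟨1, le_rfl, fun X hX _ h => by simp [h] at hX; linarith⟩

theorem eventually_infSector_arg {β : ℝ} : ∀ᶠ X in infSector β, |X.arg| < β :=
  eventually_infSector.2 ⟨1, le_rfl, fun _ _ h => h⟩

theorem tendsto_norm_infSector {β : ℝ} : Tendsto (fun X : ℂ => ‖X‖) (infSector β) atTop :=
  (tendsto_norm_cobounded_atTop).mono_left inf_le_left

theorem tendsto_inv_infSector {β : ℝ} : Tendsto (fun X : ℂ => X⁻¹) (infSector β) (𝓝 0) :=
  (tendsto_inv₀_cobounded).mono_left inf_le_left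

theorem infSector_neBot {β : ℝ} (hβ : 0 < β) : (infSector β).NeBot := by
  rw [neBot_iff]
  intro h
  have := eventually_infSector.1 (show ∀ᶠ X in infSector β, False by rw [h]; simp)
  obtain ⟨R, hR, h⟩ := this
  refine h (R : ℂ) (by simp [abs_of_pos (by linarith : (0:ℝ) < R)]) ?_
  rw [Complex.arg_ofReal_of_nonneg (by linarith)]; simpa

/-- Numbers close to `1` have small argument. -/
theorem exists_arg_one_add_lt {δ : ℝ} (hδ : 0 < δ) :
    ∃ ε : ℝ, 0 < ε ∧ ε ≤ 1 / 2 ∧ ∀ t : ℂ, ‖t‖ ≤ ε → |(1 + t).arg| < δ := by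
  have h : ContinuousAt (fun t : ℂ => |(1 + t).arg|) 0 := by
    have : ContinuousAt Complex.arg (1 + 0) :=
      Complex.continuousAt_arg (by simp)
    exact (ContinuousAt.comp (f := fun t : ℂ => 1 + t) this (by fun_prop)).abs
  have h2 : ∀ᶠ t in 𝓝 (0 : ℂ), |(1 + t).arg| < δ :=
    h.eventually_lt continuousAt_const (by simpa)
  obtain ⟨ε, hε, h3⟩ := Metric.eventually_nhds_iff.1 h2
  refine ⟨min (ε / 2) (1 / 2), by positivity, min_le_right _ _, fun t ht => h3 ?_⟩
  rw [dist_zero_right]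
  have := ht.trans (min_le_left _ _)
  linarith

theorem arg_mul_of_abs_lt {x y : ℂ} (hx : x ≠ 0) (hy : y ≠ 0)
    (h : |x.arg| + |y.arg| < Real.pi) : (x * y).arg = x.arg + y.arg := by
  rw [Complex.arg_mul_eq_add_arg_iff hx hy]
  have h1 := abs_le.1 (le_refl |x.arg|)
  have h2 := abs_le.1 (le_refl |y.arg|)
  constructor <;> linarith [h1.1, h1.2, h2.1, h2.2]

theorem log_mul_of_abs_lt {x y : ℂ} (hx : x ≠ 0) (hy : y ≠ 0)
    (h : |x.arg| + |y.arg| < Real.pi) :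
    Complex.log (x * y) = Complex.log x + Complex.log y := by
  rw [Complex.log_mul_eq_add_log_iff hx hy]
  have h1 := abs_le.1 (le_refl |x.arg|)
  have h2 := abs_le.1 (le_refl |y.arg|)
  constructor <;> linarith [h1.1, h1.2, h2.1, h2.2]

/-- A point of a sector has a ball of comparable radius in any larger sector. -/
theorem exists_ball_in_sector {β β' : ℝ} (h : β' < β) (hβ : β ≤ Real.pi) :
    ∃ ε : ℝ, 0 < ε ∧ ε ≤ 1 / 2 ∧ ∀ X Y : ℂ, X ≠ 0 → |X.arg| < β' → ‖Y - X‖ ≤ ε * ‖X‖ →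
      |Y.arg| < β ∧ ‖X‖ / 2 ≤ ‖Y‖ ∧ ‖Y‖ ≤ 2 * ‖X‖ := by
  obtain ⟨ε, h0, h1, h2⟩ := exists_arg_one_add_lt (sub_pos.2 h)
  refine ⟨ε, h0, h1, fun X Y hX hXa hY => ?_⟩
  have hX0 : 0 < ‖X‖ := norm_pos_iff.2 hX
  have ht : ‖(Y - X) / X‖ ≤ ε := by
    rw [norm_div, div_le_iff₀ hX0]; exact hY
  have hYe : Y = X * (1 + (Y - X) / X) := by field_simp; ring
  have h3 := h2 _ ht
  have n1 : ‖X‖ / 2 ≤ ‖Y‖ := by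
    have := norm_sub_norm_le X Y
    rw [norm_sub_rev] at this
    nlinarith
  have n2 : ‖Y‖ ≤ 2 * ‖X‖ := by
    have := norm_sub_norm_le Y X
    nlinarith
  refine ⟨?_, n1, n2⟩
  have hY0 : Y ≠ 0 := norm_pos_iff.1 (by linarith)
  have h4 : 1 + (Y - X) / X ≠ 0 := by
    intro h5; rw [h5, mul_zero] at hYe; exact hY0 hYe
  rw [hYe, arg_mul_of_abs_lt hX h4 (by linarith)]
  calc _ ≤ |X.arg| + |(1 + (Y - X) / X).arg| := abs_add_le _ _
    _ < β := by linarith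

theorem eventually_norm_sub_le {β : ℝ} {F : ℂ → ℂ}
    (ht : Tendsto (fun X => F X / X) (infSector β) (𝓝 1)) {η : ℝ} (hη : 0 < η) :
    ∀ᶠ X in infSector β, ‖F X - X‖ ≤ η * ‖X‖ := by
  filter_upwards [infSector_ne_zero, Metric.tendsto_nhds.1 ht η hη] with X hX h
  rw [dist_eq_norm] at h
  have : F X - X = (F X / X - 1) * X := by field_simp
  rw [this, norm_mul]
  gcongr

/-- A map asymptotic to the identity maps a sector into any larger one. -/
theorem tendsto_infSector {β β' : ℝ} (h : β' < β) (hβ : β ≤ Real.pi) {F : ℂ → ℂ}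
    (ht : Tendsto (fun X => F X / X) (infSector β') (𝓝 1)) :
    Tendsto F (infSector β') (infSector β) := by
  obtain ⟨ε, h0, -, h2⟩ := exists_ball_in_sector h hβ
  have h3 := eventually_norm_sub_le ht h0
  refine tendsto_inf.2 ⟨?_, tendsto_principal.2 ?_⟩
  · rw [← tendsto_norm_atTop_iff_cobounded]
    refine tendsto_atTop_mono' _ ?_ ((tendsto_norm_infSector (β := β')).atTop_div_const
      (show (0:ℝ) < 2 by norm_num))
    filter_upwards [h3, infSector_ne_zero, eventually_infSector_arg] with X h3 h4 h5
    exact (h2 X _ h4 h5 h3).2.1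
  · filter_upwards [h3, infSector_ne_zero, eventually_infSector_arg] with X h3 h4 h5
    exact (h2 X _ h4 h5 h3).1

/-- `F - id` has small derivative. -/
theorem eventually_deriv_sub_one_le {β β' : ℝ} (h : β' < β) (hβ : β ≤ Real.pi) {F : ℂ → ℂ}
    (hd : ∀ᶠ X in infSector β, DifferentiableAt ℂ F X)
    (ht : Tendsto (fun X => F X / X) (infSector β) (𝓝 1)) :
    ∀ᶠ X in infSector β', DifferentiableAt ℂ F X ∧ ‖deriv (fun Y => F Y - Y) X‖ ≤ 1 / 4 := by
  obtain ⟨ε, h0, h1, h2⟩ := exists_ball_in_sector h hβ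
  -- On the ball of radius ε‖X‖ points have norm at most 2‖X‖, so ε/8 bounds `F Y - Y` by (ε/4)‖X‖;
  -- Cauchy's estimate divides by the radius and leaves 1/4.
  obtain ⟨R, hR, h3⟩ := eventually_infSector.1 (hd.and (eventually_norm_sub_le ht
    (show 0 < ε / 8 by positivity)))
  refine eventually_infSector.2 ⟨2 * R, by linarith, fun X hX hXa => ?_⟩
  have hX0 : X ≠ 0 := norm_pos_iff.1 (by linarith)
  have hXp := norm_pos_iff.2 hX0
  have key : ∀ Y, ‖Y - X‖ ≤ ε * ‖X‖ → DifferentiableAt ℂ F Y ∧ ‖F Y - Y‖ ≤ ε / 4 * ‖X‖ := by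
    intro Y hY
    obtain ⟨a, b, c⟩ := h2 X Y hX0 hXa hY
    obtain ⟨d, e⟩ := h3 Y (by linarith) a
    refine ⟨d, e.trans ?_⟩
    nlinarith
  refine ⟨(key X (by simp; positivity)).1, ?_⟩
  have := Complex.norm_deriv_le_of_forall_mem_sphere_norm_le (f := fun Y => F Y - Y) (c := X)
    (R := ε * ‖X‖) (C := ε / 4 * ‖X‖) (by positivity) ?_ ?_
  · refine this.trans (le_of_eq ?_)
    field_simp
  · refine DifferentiableOn.diffContOnCl_ball (U := Metric.closedBall X (ε * ‖X‖)) ?_ le_rfl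
    intro Y hY
    have := (key Y (by rwa [Metric.mem_closedBall, dist_eq_norm] at hY)).1
    exact (this.sub differentiableAt_id).differentiableWithinAt
  · intro Y hY
    exact (key Y (by rw [mem_sphere_iff_norm] at hY; exact hY.le)).2

/-- A holomorphic map asymptotic to the identity is injective on smaller sectors. -/
theorem exists_injOn {β β' : ℝ} (h : β' < β) (hβ : β ≤ Real.pi) {F : ℂ → ℂ}
    (hd : ∀ᶠ X in infSector β, DifferentiableAt ℂ F X)
    (ht : Tendsto (fun X => F X / X) (infSector β) (𝓝 1)) :
    ∃ R : ℝ, 1 ≤ R ∧ Set.InjOn F {X | R ≤ ‖X‖ ∧ |X.arg| < β'} := by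
  obtain ⟨β₁, hb1, hb2⟩ := exists_between h
  obtain ⟨ε, h0, h1, h2⟩ := exists_ball_in_sector hb1 (hb2.le.trans hβ)
  obtain ⟨R, hR, h3⟩ := eventually_infSector.1 ((eventually_deriv_sub_one_le hb2 hβ hd ht).and
    (eventually_norm_sub_le (ht.mono_left (infSector_mono hb2.le)) (show 0 < ε / 2 by positivity)))
  -- A sector need not be convex, so the mean value inequality is applied on a ball. Equal values
  -- make X₂ - X₁ the difference of two small quantities `F X - X`, which puts X₂ in the ball about
  -- the larger point X₁; there F - id is 1/4-Lipschitz, whence ‖X₂ - X₁‖ ≤ ‖X₂ - X₁‖/4.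
  have key : ∀ X₁ X₂ : ℂ, 2 * R ≤ ‖X₁‖ → 2 * R ≤ ‖X₂‖ → |X₁.arg| < β' → |X₂.arg| < β' →
      ‖X₂‖ ≤ ‖X₁‖ → F X₁ = F X₂ → X₁ = X₂ := by
    intro X₁ X₂ r1 r2 a1 a2 hle hF
    have p1 : X₁ ≠ 0 := norm_pos_iff.1 (by linarith)
    have e1 := (h3 X₁ (by linarith) (by linarith)).2
    have e2 := (h3 X₂ (by linarith) (by linarith)).2
    have hball : ∀ Y ∈ Metric.closedBall X₁ (ε * ‖X₁‖), DifferentiableAt ℂ F Y ∧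
        ‖deriv (fun Y => F Y - Y) Y‖ ≤ 1 / 4 := by
      intro Y hY
      rw [Metric.mem_closedBall, dist_eq_norm] at hY
      obtain ⟨a, b, c⟩ := h2 X₁ Y p1 a1 hY
      exact (h3 Y (by linarith) a).1
    have m2 : ‖X₂ - X₁‖ ≤ ε * ‖X₁‖ := by
      have : X₂ - X₁ = (F X₁ - X₁) - (F X₂ - X₂) := by rw [hF]; ring
      rw [this]
      refine (norm_sub_le _ _).trans ?_
      nlinarith
    have := (convex_closedBall X₁ (ε * ‖X₁‖)).norm_image_sub_le_of_norm_deriv_le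
      (f := fun Y => F Y - Y) (x := X₁) (y := X₂) (C := 1 / 4)
      (fun Y hY => (hball Y hY).1.sub differentiableAt_id) (fun Y hY => (hball Y hY).2)
      (Metric.mem_closedBall_self (by positivity))
      (by rwa [Metric.mem_closedBall, dist_eq_norm])
    have h5 : F X₂ - X₂ - (F X₁ - X₁) = -(X₂ - X₁) := by rw [hF]; ring
    simp only [h5, norm_neg] at this
    have : ‖X₂ - X₁‖ = 0 := by linarith [norm_nonneg (X₂ - X₁)]
    exact (sub_eq_zero.1 (norm_eq_zero.1 this)).symm
  refine ⟨2 * R, by linarith, fun X₁ ⟨r1, a1⟩ X₂ ⟨r2, a2⟩ hF => ?_⟩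
  rcases le_total ‖X₂‖ ‖X₁‖ with hle | hle
  · exact key _ _ r1 r2 a1 a2 hle hF
  · exact (key _ _ r2 r1 a2 a1 hle hF.symm).symm

/-- A holomorphic map asymptotic to the identity has an inverse asymptotic to the identity. -/
theorem exists_inverse {β β' : ℝ} (h : β' < β) (hβ : β ≤ Real.pi) {F : ℂ → ℂ}
    (hd : ∀ᶠ X in infSector β, DifferentiableAt ℂ F X)
    (ht : Tendsto (fun X => F X / X) (infSector β) (𝓝 1)) :
    ∃ G : ℂ → ℂ, (∀ᶠ W in infSector β', DifferentiableAt ℂ G W ∧ F (G W) = W) ∧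
      Tendsto (fun W => G W / W) (infSector β') (𝓝 1) ∧ ∀ᶠ X in infSector β', G (F X) = X := by
  obtain ⟨β₁, hb1, hb2⟩ := exists_between h
  obtain ⟨β₀, hb0, hb1⟩ := exists_between hb1
  obtain ⟨R₀, hR0, hinj⟩ := exists_injOn hb2 hβ hd ht
  obtain ⟨ε, h0, h1, h2⟩ := exists_ball_in_sector hb1 (hb2.le.trans hβ)
  -- preimages in balls of arbitrarily small relative radius
  have surj : ∀ ε', 0 < ε' → ε' ≤ ε → ∀ᶠ W in infSector β₀, ∃ X, ‖X - W‖ ≤ ε' * ‖W‖ ∧ F X = W := by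
    intro ε' p0 p1
    obtain ⟨R, hR, h3⟩ := eventually_infSector.1 (hd.and
      (eventually_norm_sub_le ht (show 0 < ε' / 16 by positivity)))
    refine eventually_infSector.2 ⟨2 * max R R₀, by linarith [le_max_left R R₀], fun W hW hWa => ?_⟩
    have hRm := le_max_left R R₀
    have hRm' := le_max_right R R₀
    have hW0 : W ≠ 0 := norm_pos_iff.1 (by linarith)
    have hWp := norm_pos_iff.2 hW0
    have hin : ∀ X, ‖X - W‖ ≤ ε' * ‖W‖ → DifferentiableAt ℂ F X ∧ ‖F X - X‖ ≤ ε' / 8 * ‖W‖ ∧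
        X ∈ {X : ℂ | R₀ ≤ ‖X‖ ∧ |X.arg| < β₁} := by
      intro X hX
      obtain ⟨a, b, c⟩ := h2 W X hW0 hWa (hX.trans (by gcongr))
      obtain ⟨d, e⟩ := h3 X (by linarith) (by linarith)
      refine ⟨d, e.trans ?_, by linarith, a⟩
      nlinarith
    have hWin := hin W (by simp; positivity)
    -- Quantitative open mapping theorem: on the sphere of radius ε'‖W‖ the values stay at distance
    -- at least (ε'/2)‖W‖ from `F W`, so the image contains the ball of half that radius about `F
    -- W`. It contains W since `F W` is within (ε'/8)‖W‖ of W.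
    have := DiffContOnCl.ball_subset_image_closedBall (f := F) (z₀ := W) (r := ε' * ‖W‖)
      (ε := ε' / 2 * ‖W‖) ?_ (by positivity) ?_ ?_
    · obtain ⟨X, hX, hX'⟩ := this (show W ∈ Metric.ball (F W) _ by
        rw [Metric.mem_ball, dist_eq_norm, norm_sub_rev]
        nlinarith [hWin.2.1])
      rw [Metric.mem_closedBall, dist_eq_norm] at hX
      exact ⟨X, hX, hX'⟩
    · refine DifferentiableOn.diffContOnCl_ball (U := Metric.closedBall W (ε' * ‖W‖)) ?_ le_rfl
      intro Y hY
      exact (hin Y (by rwa [Metric.mem_closedBall, dist_eq_norm] at hY)).1.differentiableWithinAt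
    · intro Y hY
      rw [mem_sphere_iff_norm] at hY
      have e1 := (hin Y hY.le).2.1
      have e2 := hWin.2.1
      have : Y - W = (F Y - F W) - (F Y - Y) + (F W - W) := by ring
      have e3 : ‖Y - W‖ ≤ ‖F Y - F W‖ + ‖F Y - Y‖ + ‖F W - W‖ := by
        rw [this]; exact (norm_add_le _ _).trans (add_le_add_left (norm_sub_le _ _) _)
      nlinarith
    · have hn : ∀ᶠ z in 𝓝[≠] W, F z ≠ F W := by
        have : ∀ᶠ z in 𝓝[≠] W, ‖z - W‖ ≤ ε' * ‖W‖ := by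
          refine eventually_nhdsWithin_of_eventually_nhds ?_
          filter_upwards [Metric.closedBall_mem_nhds W (show 0 < ε' * ‖W‖ by positivity)] with z hz
          rwa [Metric.mem_closedBall, dist_eq_norm] at hz
        filter_upwards [this, self_mem_nhdsWithin] with z hz hne heq
        exact hne (hinj (hin z hz).2.2 hWin.2.2 heq)
      exact hn.frequently.filter_mono nhdsWithin_le_nhds
  have surj' := surj ε h0 le_rfl
  classical
  let G : ℂ → ℂ := fun W => if hW : ∃ X, ‖X - W‖ ≤ ε * ‖W‖ ∧ F X = W then hW.choose else 0
  have hG : ∀ᶠ W in infSector β₀, ‖G W - W‖ ≤ ε * ‖W‖ ∧ F (G W) = W := by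
    filter_upwards [surj'] with W hW
    simp only [G, dif_pos hW]
    exact hW.choose_spec
  have hGmem : ∀ᶠ W in infSector β₀, R₀ ≤ ‖G W‖ ∧ |(G W).arg| < β₁ := by
    filter_upwards [hG, infSector_ne_zero, eventually_infSector_arg,
      tendsto_norm_infSector.eventually_ge_atTop (2 * R₀)] with W hW h3 h4 h5
    obtain ⟨a, b, c⟩ := h2 W _ h3 h4 hW.1
    exact ⟨by linarith, a⟩
  -- A smaller relative radius in `surj` gives a closer preimage, and injectivity identifies it with
  -- the chosen `G W`.
  have hGlim : Tendsto (fun W => G W / W) (infSector β₀) (𝓝 1) := by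
    rw [Metric.tendsto_nhds]
    intro δ hδ
    filter_upwards [surj (min ε (δ / 2)) (by positivity) (min_le_left _ _), hG, hGmem,
      infSector_ne_zero, eventually_infSector_arg,
      tendsto_norm_infSector.eventually_ge_atTop (2 * R₀)] with W ⟨X, hX, hX'⟩ hW hW' h3 h4 h5
    have hWp := norm_pos_iff.2 h3
    obtain ⟨a, b, c⟩ := h2 W X h3 h4 (hX.trans (by gcongr; exact min_le_left _ _))
    have : X = G W := hinj ⟨by linarith, a⟩ hW' (hX'.trans hW.2.symm)
    rw [← this, dist_eq_norm, show X / W - 1 = (X - W) / W by field_simp, norm_div,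
      div_lt_iff₀ hWp]
    refine lt_of_le_of_lt hX ?_
    have := min_le_right ε (δ / 2)
    nlinarith
  refine ⟨G, ?_, hGlim.mono_left (infSector_mono hb0.le), ?_⟩
  · have hopen : ∀ᶠ W in infSector β', ∀ᶠ V in 𝓝 W, F (G V) = V ∧ R₀ ≤ ‖G V‖ ∧ |(G V).arg| < β₁ := by
      obtain ⟨ε₁, q0, q1, q2⟩ := exists_ball_in_sector hb0 (hb1.le.trans (hb2.le.trans hβ))
      obtain ⟨R, hR, h3⟩ := eventually_infSector.1 (hG.and hGmem)
      refine eventually_infSector.2 ⟨2 * R, by linarith, fun W hW hWa => ?_⟩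
      have hW0 : W ≠ 0 := norm_pos_iff.1 (by linarith)
      have hWp := norm_pos_iff.2 hW0
      filter_upwards [Metric.closedBall_mem_nhds W (show 0 < ε₁ * ‖W‖ by positivity)] with V hV
      rw [Metric.mem_closedBall, dist_eq_norm] at hV
      obtain ⟨a, b, c⟩ := q2 W V hW0 hWa hV
      have := h3 V (by linarith) a
      exact ⟨this.1.2, this.2⟩
    have hder := eventually_deriv_sub_one_le hb2 hβ hd ht
    have hGt : Tendsto G (infSector β') (infSector β₁) :=
      tendsto_infSector (hb0.trans hb1) (hb2.le.trans hβ) (hGlim.mono_left (infSector_mono hb0.le))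
    have hder' := (eventually_infSector.1 hder)
    have hdo : ∀ᶠ X in infSector β₀, ∀ᶠ V in 𝓝 X, DifferentiableAt ℂ F V ∧ R₀ ≤ ‖V‖ ∧ |V.arg| < β₁ := by
      obtain ⟨R, hR, h3⟩ := eventually_infSector.1 hd
      refine eventually_infSector.2 ⟨2 * max R R₀, by linarith [le_max_left R R₀], fun W hW hWa => ?_⟩
      have hRm := le_max_left R R₀
      have hRm' := le_max_right R R₀
      have hW0 : W ≠ 0 := norm_pos_iff.1 (by linarith)
      have hWp := norm_pos_iff.2 hW0
      filter_upwards [Metric.closedBall_mem_nhds W (show 0 < ε * ‖W‖ by positivity)] with V hV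
      rw [Metric.mem_closedBall, dist_eq_norm] at hV
      obtain ⟨a, b, c⟩ := h2 W V hW0 hWa hV
      exact ⟨h3 V (by linarith) (by linarith), by linarith, a⟩
    have hGt' : Tendsto G (infSector β') (infSector β₀) :=
      tendsto_infSector hb0 (hb1.le.trans (hb2.le.trans hβ)) (hGlim.mono_left (infSector_mono hb0.le))
    filter_upwards [hopen, hGt.eventually hder, hGt'.eventually hdo] with W hW hGd hGo
    refine ⟨?_, hW.self_of_nhds.1⟩
    have hdn : ∀ᶠ V in 𝓝 (G W), DifferentiableAt ℂ F V := hGo.mono fun V hV => hV.1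
    have hstrict : HasStrictDerivAt F (deriv F (G W)) (G W) := by
      have : AnalyticAt ℂ F (G W) := Complex.analyticAt_iff_eventually_differentiableAt.2 hdn
      exact this.hasStrictDerivAt
    have hne : deriv F (G W) ≠ 0 := by
      intro h0
      have h4 := hGd.2
      rw [deriv_fun_sub hGd.1 differentiableAt_fun_id, h0] at h4
      simp at h4
      norm_num at h4
    have hloc := hstrict.to_localInverse hne
    have e1 := hstrict.eventually_right_inverse hne
    have hc : ContinuousAt (hstrict.localInverse F _ _ hne) (F (G W)) := hloc.hasDerivAt.continuousAt
    have hval : hstrict.localInverse F _ _ hne (F (G W)) = G W := by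
      exact (hstrict.eventually_left_inverse hne).self_of_nhds
    have e2 : ∀ᶠ V in 𝓝 (F (G W)), R₀ ≤ ‖hstrict.localInverse F _ _ hne V‖ ∧
        |(hstrict.localInverse F _ _ hne V).arg| < β₁ := by
      have : Tendsto (hstrict.localInverse F _ _ hne) (𝓝 (F (G W))) (𝓝 (G W)) := by
        have := hc.tendsto; rwa [hval] at this
      exact this.eventually (hGo.mono fun V hV => hV.2)
    have hFG := hW.self_of_nhds.1
    rw [hFG] at e1 e2 hloc
    -- `G` is only a choice of preimages; near W it takes values where F is injective, and so does
    -- the holomorphic local inverse, hence they coincide.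
    have : G =ᶠ[𝓝 W] hstrict.localInverse F _ _ hne := by
      filter_upwards [hW, e1, e2] with V h1 h2 h3
      exact hinj h1.2 h3 (h1.1.trans h2.symm)
    exact this.symm.differentiableAt_iff.1 hloc.hasDerivAt.differentiableAt
  · have hFt : Tendsto F (infSector β') (infSector β₀) :=
      tendsto_infSector hb0 (hb1.le.trans (hb2.le.trans hβ)) (ht.mono_left (infSector_mono (by linarith)))
    filter_upwards [hFt.eventually (hG.and hGmem), eventually_infSector_arg,
      tendsto_norm_infSector.eventually_ge_atTop R₀] with X hX h3 h4
    exact hinj hX.2 ⟨h4, by linarith⟩ hX.1.2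

/-! ### Rigidity of unit translations and uniqueness of Fatou coordinates. -/

/-- An injective entire function commuting with `W ↦ W + 1` is a translation. -/
theorem eq_add_of_injective_entire {E : ℂ → ℂ} (hE : Differentiable ℂ E)
    (hinj : Function.Injective E) (h1 : ∀ W, E (W + 1) = E W + 1) (W : ℂ) : E W = W + E 0 := by
  set E₁ : ℂ → ℂ := fun W => E W - E 0 with hE1
  have hd1 : Differentiable ℂ E₁ := hE.sub_const _
  have hinj1 : Function.Injective E₁ := fun x y h => hinj (by simpa [hE1] using h)
  have hn : ∀ n : ℕ, E₁ n = n := by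
    intro n
    induction n with
    | zero => simp [hE1]
    | succ n ih =>
      have := h1 n
      simp only [hE1] at ih ⊢
      push_cast
      linear_combination this + ih
  -- The unit disc is mapped onto a neighbourhood of `E₁ 0 = 0`; by injectivity no point outside the
  -- disc can be sent there.
  obtain ⟨ρ, hρ, hball⟩ : ∃ ρ > 0, ∀ W, 1 ≤ ‖W‖ → ρ ≤ ‖E₁ W‖ := by
    have han : AnalyticAt ℂ E₁ 0 := hd1.analyticAt 0
    rcases han.eventually_constant_or_nhds_le_map_nhds with hc | hc
    · exfalso
      have hp : ∃ᶠ z in 𝓝[≠] (0:ℂ), E₁ z = E₁ 0 := (hc.filter_mono nhdsWithin_le_nhds).frequently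
      obtain ⟨z, hz1, hz2⟩ := (hp.and_eventually self_mem_nhdsWithin).exists
      exact hz2 (hinj1 hz1)
    · have : E₁ '' Metric.ball 0 1 ∈ 𝓝 (E₁ 0) := hc (image_mem_map (Metric.ball_mem_nhds _ one_pos))
      obtain ⟨ρ, hρ, hsub⟩ := Metric.mem_nhds_iff.1 this
      refine ⟨ρ, hρ, fun W hW => ?_⟩
      by_contra hlt
      have h0 : E₁ 0 = 0 := by simp [hE1]
      obtain ⟨V, hV, hVW⟩ := hsub (show E₁ W ∈ Metric.ball (E₁ 0) ρ by
        rw [h0, mem_ball_zero_iff]; exact not_le.1 hlt)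
      rw [hinj1 hVW, mem_ball_zero_iff] at hV
      linarith
  -- Read at infinity, `E₁` is bounded near w = 0 and so extends holomorphically; it fixes every
  -- 1/n, and these accumulate at 0, so it is the identity.
  set q : ℂ → ℂ := fun w => (E₁ w⁻¹)⁻¹ with hq
  set Q := Function.update q 0 (limUnder (𝓝[≠] 0) q) with hQ
  have hQd : DifferentiableOn ℂ Q (Metric.ball 0 1) := by
    refine Complex.differentiableOn_update_limUnder_of_bddAbove (Metric.ball_mem_nhds _ one_pos) ?_ ?_
    · intro w ⟨hw, hw0⟩
      have hw0 : w ≠ 0 := hw0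
      refine DifferentiableAt.differentiableWithinAt ?_
      refine DifferentiableAt.inv (DifferentiableAt.comp (f := fun w : ℂ => w⁻¹) w (hd1 _)
        (differentiableAt_inv hw0)) ?_
      rw [mem_ball_zero_iff] at hw
      have := hball w⁻¹ (by rw [norm_inv]; exact (one_le_inv₀ (norm_pos_iff.2 hw0)).2 hw.le)
      exact norm_pos_iff.1 (by linarith)
    · refine ⟨ρ⁻¹, ?_⟩
      rintro _ ⟨w, ⟨hw, hw0⟩, rfl⟩
      have hw0 : w ≠ 0 := hw0
      rw [mem_ball_zero_iff] at hw
      have := hball w⁻¹ (by rw [norm_inv]; exact (one_le_inv₀ (norm_pos_iff.2 hw0)).2 hw.le)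
      simp only [Function.comp, hq, norm_inv]
      exact inv_anti₀ hρ this
  have hQa : AnalyticAt ℂ Q 0 := hQd.analyticAt (Metric.ball_mem_nhds _ one_pos)
  have htend : Tendsto (fun n : ℕ => ((n : ℂ))⁻¹) atTop (𝓝[≠] 0) := by
    refine tendsto_nhdsWithin_iff.2 ⟨tendsto_inv₀_cobounded.comp
      (tendsto_norm_atTop_iff_cobounded.1 (by simpa using tendsto_natCast_atTop_atTop)), ?_⟩
    filter_upwards [eventually_gt_atTop 0] with n hn
    simp; omega
  have hfreq : ∃ᶠ z in 𝓝[≠] (0:ℂ), Q z = id z := by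
    refine htend.frequently (Eventually.frequently ?_)
    filter_upwards [eventually_gt_atTop 0] with n hn0
    have : ((n : ℂ))⁻¹ ≠ 0 := by simp; omega
    simp [hQ, Function.update_of_ne this, hq, hn]
  have hev := (hQa.frequently_eq_iff_eventually_eq analyticAt_id).1 hfreq
  have hev2 : ∀ᶠ W in Bornology.cobounded ℂ, E₁ W = W := by
    have h1 : ∀ᶠ W in Bornology.cobounded ℂ, Q W⁻¹ = W⁻¹ :=
      (tendsto_inv₀_cobounded (α := ℂ)).eventually hev
    have h2 : ∀ᶠ W : ℂ in Bornology.cobounded ℂ, 1 ≤ ‖W‖ := by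
      exact tendsto_norm_cobounded_atTop.eventually_ge_atTop 1
    filter_upwards [h1, h2] with W hW hW1
    have : W ≠ 0 := norm_pos_iff.1 (by linarith)
    rw [hQ, Function.update_of_ne (inv_ne_zero this), hq] at hW
    simpa using hW
  have hfin : E₁ = id := by
    obtain ⟨R, -, hR⟩ := Filter.hasBasis_cobounded_norm.eventually_iff.1 hev2
    have hm : ∀ᶠ z in 𝓝 ((|R| + 1 : ℝ) : ℂ), E₁ z = id z := by
      have hcont : ContinuousAt (fun z : ℂ => ‖z‖) ((|R| + 1 : ℝ) : ℂ) := by fun_prop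
      have : R < ‖((|R| + 1 : ℝ) : ℂ)‖ := by
        rw [Complex.norm_real, Real.norm_eq_abs, abs_of_pos (by positivity)]
        linarith [le_abs_self R]
      filter_upwards [hcont.eventually (lt_mem_nhds this)] with z hz
      exact hR hz.le
    exact AnalyticOnNhd.eq_of_eventuallyEq (fun z _ => hd1.analyticAt z)
      (fun z _ => analyticAt_id) hm
  have := congrFun hfin W
  simp only [hE1, id] at this
  linear_combination this

/-- Since Re X = ‖X‖ cos(arg X) and the cosine decreases on [0, π]. This description of a sector by
Re X and ‖X‖ is easy to follow along the translates X + n. -/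
theorem abs_arg_lt_iff {X : ℂ} (hX : X ≠ 0) {β : ℝ} (h0 : 0 ≤ β) (h1 : β ≤ Real.pi) :
    |X.arg| < β ↔ Real.cos β * ‖X‖ < X.re := by
  have hp := norm_pos_iff.2 hX
  rw [← Complex.norm_mul_cos_arg, mul_comm, mul_lt_mul_iff_right₀ hp, ← Real.cos_abs X.arg]
  exact (Real.strictAntiOn_cos.lt_iff_gt ⟨h0, h1⟩ ⟨abs_nonneg _, Complex.abs_arg_le_pi _⟩).symm

/-- A holomorphic injective map defined near infinity in a sector and commuting with
`W ↦ W + 1` is a translation. -/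
theorem exists_eq_add_of_injOn {β : ℝ} (h0 : 0 < β) (hβ : β < Real.pi) {E₀ : ℂ → ℂ}
    (hd : ∀ᶠ W in infSector β, DifferentiableAt ℂ E₀ W)
    (h1 : ∀ᶠ W in infSector β, E₀ (W + 1) = E₀ W + 1)
    (hinj : ∃ R : ℝ, Set.InjOn E₀ {W | R ≤ ‖W‖ ∧ |W.arg| < β}) :
    ∃ C : ℂ, ∀ᶠ W in infSector β, E₀ W = W + C := by
  obtain ⟨R₀, hinj⟩ := hinj
  obtain ⟨R₁, hR₁, h2⟩ := eventually_infSector.1 (hd.and h1)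
  set R := max R₁ R₀ with hRdef
  have hR : 1 ≤ R := hR₁.trans (le_max_left _ _)
  set κ := Real.cos β with hκ
  have hκ1 : κ < 1 := by
    rw [hκ, ← Real.cos_zero]
    exact Real.cos_lt_cos_of_nonneg_of_le_pi le_rfl hβ.le h0
  have hκ2 : -1 < κ := by
    rw [hκ, ← Real.cos_pi]
    exact Real.cos_lt_cos_of_nonneg_of_le_pi h0.le le_rfl hβ
  let S : Set ℂ := {W | R ≤ ‖W‖ ∧ κ * ‖W‖ < W.re}
  have hS : ∀ W ∈ S, R ≤ ‖W‖ ∧ |W.arg| < β := fun W hW =>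
    ⟨hW.1, (abs_arg_lt_iff (norm_pos_iff.1 (by linarith [hW.1])) h0.le hβ.le).2 hW.2⟩
  have hSd : ∀ W ∈ S, DifferentiableAt ℂ E₀ W ∧ E₀ (W + 1) = E₀ W + 1 := fun W hW =>
    h2 W ((le_max_left _ _).trans (hS W hW).1) (hS W hW).2
  -- translates of bounded sets
  have hN : ∀ M : ℕ, ∃ N : ℕ, ∀ W : ℂ, ‖W‖ ≤ M → ∀ n : ℕ, N ≤ n → W + n ∈ S := by
    intro M
    obtain ⟨N, hN⟩ := exists_nat_gt (max (R + M) (2 * M / (1 - κ)))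
    refine ⟨N, fun W hW n hn => ?_⟩
    have hn' : (N : ℝ) ≤ n := by exact_mod_cast hn
    have a1 : R + M < n := (le_max_left _ _).trans_lt (hN.trans_le hn')
    have a2 : 2 * M / (1 - κ) < n := (le_max_right _ _).trans_lt (hN.trans_le hn')
    rw [div_lt_iff₀ (by linarith)] at a2
    have b1 : ‖W + n‖ ≤ ‖W‖ + n := by
      have := norm_add_le W n; simpa using this
    have b2 : (n : ℝ) - ‖W‖ ≤ ‖W + n‖ := by
      have := norm_sub_norm_le (n : ℂ) (-W)
      rw [sub_neg_eq_add, add_comm, norm_neg] at this; simpa using this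
    have b3 := abs_le.1 (Complex.abs_re_le_norm W)
    refine ⟨by linarith, ?_⟩
    simp only [Complex.add_re, Complex.natCast_re]
    rcases le_total 0 κ with hk | hk
    · nlinarith
    · nlinarith [norm_nonneg (W + n)]
  choose N hN using hN
  have hchain : ∀ W : ℂ, ∀ m n : ℕ, m ≤ n → (∀ i, m ≤ i → W + i ∈ S) →
      E₀ (W + n) - n = E₀ (W + m) - m := by
    intro W m n hmn
    induction n, hmn using Nat.le_induction with
    | base => intro _; rfl
    | succ n hmn ih =>
      intro hi
      rw [← ih hi]
      have := (hSd _ (hi n hmn)).2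
      push_cast
      rw [← add_assoc, this]; ring
  -- Every point enters the sector after finitely many unit translations, so E₀(W + n) - n extends
  -- E₀ to the whole plane; by `hchain` its value does not depend on n once W + n has entered for
  -- good.
  let E : ℂ → ℂ := fun W => E₀ (W + N (⌈‖W‖⌉₊)) - N (⌈‖W‖⌉₊)
  have hE : ∀ M : ℕ, ∀ W : ℂ, ‖W‖ ≤ M → ∀ n, N M ≤ n → E W = E₀ (W + n) - n := by
    intro M W hW n hn
    have c1 : ‖W‖ ≤ (⌈‖W‖⌉₊ : ℝ) := Nat.le_ceil _
    have e1 := hchain W n (max n (N ⌈‖W‖⌉₊)) (le_max_left _ _)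
      (fun i hi => hN M W hW i (hn.trans hi))
    have e2 := hchain W (N ⌈‖W‖⌉₊) (max n (N ⌈‖W‖⌉₊)) (le_max_right _ _)
      (fun i hi => hN _ W c1 i hi)
    exact e2.symm.trans e1
  have hEd : Differentiable ℂ E := by
    intro W
    obtain ⟨M, hM⟩ := exists_nat_gt ‖W‖
    have : E =ᶠ[𝓝 W] fun V => E₀ (V + N M) - N M := by
      have hc : ContinuousAt (fun V : ℂ => ‖V‖) W := by fun_prop
      filter_upwards [hc.eventually (gt_mem_nhds hM)] with V hV
      exact hE M V hV.le _ le_rfl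
    refine this.differentiableAt_iff.2 ?_
    have hm := (hSd _ (hN M W hM.le _ le_rfl)).1
    exact (DifferentiableAt.comp W hm (by fun_prop)).sub_const _
  have hEi : Function.Injective E := by
    intro W V hWV
    obtain ⟨M, hM⟩ := exists_nat_gt (max ‖W‖ ‖V‖)
    have e1 := hE M W ((le_max_left _ _).trans hM.le) _ le_rfl
    have e2 := hE M V ((le_max_right _ _).trans hM.le) _ le_rfl
    have m1 := hS _ (hN M W ((le_max_left _ _).trans hM.le) _ le_rfl)
    have m2 := hS _ (hN M V ((le_max_right _ _).trans hM.le) _ le_rfl)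
    have : E₀ (W + N M) = E₀ (V + N M) := by
      have := e1.symm.trans (hWV.trans e2)
      linear_combination this
    have := hinj ⟨(le_max_right _ _).trans m1.1, m1.2⟩ ⟨(le_max_right _ _).trans m2.1, m2.2⟩ this
    linear_combination this
  have hE1 : ∀ W, E (W + 1) = E W + 1 := by
    intro W
    obtain ⟨M, hM⟩ := exists_nat_gt (max ‖W‖ ‖W + 1‖)
    have e1 := hE M W ((le_max_left _ _).trans hM.le) (N M + 1) (Nat.le_succ _)
    have e2 := hE M (W + 1) ((le_max_right _ _).trans hM.le) _ le_rfl
    rw [e1, e2]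
    push_cast
    rw [show W + 1 + (N M : ℂ) = W + (N M + 1) by ring]; ring
  have hfin := eq_add_of_injective_entire hEd hEi hE1
  refine ⟨E 0, ?_⟩
  -- To get E = E₀ near infinity the whole chain W, W + 1, … must stay in S. For Re W > κ‖W‖ one has
  -- ‖W + n‖² ≥ ((1 + κ)/2)(‖W‖ + n)², so the chain does not come closer to 0 than c‖W‖.
  obtain ⟨c, hc0, hc⟩ : ∃ c : ℝ, 0 < c ∧ ∀ W : ℂ, κ * ‖W‖ < W.re → ∀ n : ℕ, c * ‖W‖ ≤ ‖W + n‖ := by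
    refine ⟨(1 + κ) / 2, by linarith, fun W hW n => ?_⟩
    have h3 : ‖W + n‖ ^ 2 = ‖W‖ ^ 2 + 2 * n * W.re + n ^ 2 := by
      rw [← Complex.normSq_eq_norm_sq, ← Complex.normSq_eq_norm_sq, Complex.normSq_apply,
        Complex.normSq_apply]
      simp; ring
    have h4 : ((1 + κ) / 2 * ‖W‖) ^ 2 ≤ ‖W + n‖ ^ 2 := by
      rw [h3]
      have hn : (0:ℝ) ≤ n := Nat.cast_nonneg n
      have hW0 := norm_nonneg W
      have q1 : (1 + κ) / 2 * (‖W‖ ^ 2 + n ^ 2 + 2 * (‖W‖ * n)) ≤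
          ‖W‖ ^ 2 + 2 * n * W.re + n ^ 2 := by
        nlinarith [sq_nonneg (‖W‖ - n), mul_nonneg hn hW0,
          mul_nonneg hn (sub_nonneg.2 hW.le)]
      have q2 : ((1 + κ) / 2) ^ 2 ≤ (1 + κ) / 2 := by nlinarith
      nlinarith [sq_nonneg ‖W‖, mul_nonneg hW0 hn, sq_nonneg (n:ℝ)]
    exact le_of_sq_le_sq h4 (norm_nonneg _)
  refine eventually_infSector.2 ⟨max 1 (R / c), le_max_left _ _, fun W hW hWa => ?_⟩
  have hW1 : 1 ≤ ‖W‖ := (le_max_left _ _).trans hW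
  have hWre := (abs_arg_lt_iff (norm_pos_iff.1 (by linarith)) h0.le hβ.le).1 hWa
  have hWS : ∀ i : ℕ, 0 ≤ i → W + i ∈ S := by
    intro i _
    refine ⟨?_, ?_⟩
    · refine le_trans ?_ (hc W hWre i)
      have := (le_max_right _ _).trans hW
      rw [div_le_iff₀ hc0] at this; linarith
    · have hi : (0:ℝ) ≤ i := Nat.cast_nonneg i
      have b1 : ‖W + i‖ ≤ ‖W‖ + i := by
        have := norm_add_le W i; simpa using this
      have b2 : ‖W‖ - i ≤ ‖W + i‖ := by
        have := norm_sub_norm_le W (-(i:ℂ))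
        rw [sub_neg_eq_add, norm_neg] at this; simpa using this
      simp only [Complex.add_re, Complex.natCast_re]
      rcases le_total 0 κ with hk | hk
      · nlinarith
      · nlinarith
  have e1 := hchain W 0 (N ⌈‖W‖⌉₊) (Nat.zero_le _) hWS
  rw [← hfin W]
  simp only [Nat.cast_zero, add_zero, sub_zero] at e1
  exact e1.symm

/-- Fatou coordinates are unique up to an additive constant. -/
theorem exists_eq_add_of_abel {β β' : ℝ} (h0 : 0 < β) (h : β' < β) (hβ : β ≤ Real.pi)
    {H Φ φ : ℂ → ℂ} (hH : Tendsto (fun X => H X / X) (infSector β) (𝓝 1))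
    (hΦd : ∀ᶠ X in infSector β, DifferentiableAt ℂ Φ X)
    (hΦt : Tendsto (fun X => Φ X / X) (infSector β) (𝓝 1))
    (hΦ : ∀ᶠ X in infSector β, Φ (H X) = Φ X + 1)
    (hφd : ∀ᶠ X in infSector β, DifferentiableAt ℂ φ X)
    (hφi : ∃ R : ℝ, Set.InjOn φ {X | R ≤ ‖X‖ ∧ |X.arg| < β})
    (hφ : ∀ᶠ X in infSector β, φ (H X) = φ X + 1) :
    ∃ C : ℂ, ∀ᶠ X in infSector β', φ X = Φ X + C := by
  obtain ⟨β₁, hb0, hb1⟩ := exists_between (max_lt h h0)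
  have hb0' : 0 < β₁ := (le_max_right _ _).trans_lt hb0
  have hb0 : β' < β₁ := (le_max_left _ _).trans_lt hb0
  obtain ⟨β₂, hb2, hb3⟩ := exists_between hb1
  obtain ⟨G, hG, hGt, hGl⟩ := exists_inverse hb3 hβ hΦd hΦt
  obtain ⟨R, hφi⟩ := hφi
  have hGm : Tendsto G (infSector β₁) (infSector β) :=
    tendsto_infSector hb1 hβ (hGt.mono_left (infSector_mono hb2.le))
  have hGm2 : Tendsto G (infSector β₁) (infSector β₂) :=
    tendsto_infSector hb2 (hb3.le.trans hβ) (hGt.mono_left (infSector_mono hb2.le))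
  have hG1 := hG.filter_mono (infSector_mono hb2.le)
  have hHm : Tendsto H (infSector β₁) (infSector β₂) :=
    tendsto_infSector hb2 (hb3.le.trans hβ) (hH.mono_left (infSector_mono (hb2.le.trans hb3.le)))
  have hHm2 : Tendsto (fun W => H (G W)) (infSector β₁) (infSector β₂) := by
    obtain ⟨β₃, hb4, hb5⟩ := exists_between hb2
    refine (tendsto_infSector hb5 (hb3.le.trans hβ)
      (hH.mono_left (infSector_mono (by linarith)))).comp
      (tendsto_infSector hb4 (by linarith) (hGt.mono_left (infSector_mono hb2.le)))
  -- With G the inverse of Φ, the change of coordinates φ ∘ G is injective and commutes with W ↦ W +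
  -- 1.
  obtain ⟨C, hC⟩ := exists_eq_add_of_injOn hb0' (by linarith) (E₀ := φ ∘ G) (by
      filter_upwards [hG1, hGm.eventually hφd] with W h1 h2
      exact h2.comp W h1.1) (by
      filter_upwards [hG1, hGm.eventually hφ, hGm.eventually hΦ, hHm2.eventually hGl]
        with W h1 h2 h3 h4
      simp only [Function.comp]
      rw [← h2, ← h4, h3, h1.2]) (by
      have h5 : ∀ᶠ X in infSector β, R ≤ ‖X‖ ∧ |X.arg| < β :=
        (tendsto_norm_infSector.eventually_ge_atTop R).and eventually_infSector_arg
      obtain ⟨R', -, h6⟩ := eventually_infSector.1 (hG1.and (hGm.eventually h5))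
      refine ⟨R', fun W hW V hV hWV => ?_⟩
      have hW' := h6 W hW.1 hW.2
      have hV' := h6 V hV.1 hV.2
      rw [← hW'.1.2, ← hV'.1.2, hφi hW'.2 hV'.2 hWV])
  refine ⟨C, ?_⟩
  have hΦm : Tendsto Φ (infSector β') (infSector β₁) :=
    tendsto_infSector hb0 (by linarith) (hΦt.mono_left (infSector_mono (by linarith)))
  filter_upwards [hΦm.eventually hC, hGl.filter_mono (infSector_mono (hb0.le.trans hb2.le))]
    with X h1 h2
  simp only [Function.comp, h2] at h1
  exact h1

/-! ### Existence of Fatou coordinates at infinity. -/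

/-- Orbits of a map close to `X ↦ X + 1` in a sector. -/
theorem orbit_estimate {κ R c ε : ℝ} {H : ℂ → ℂ} (hκ0 : κ ≤ 0)
    (hε0 : 0 ≤ ε) (hε : -κ * (1 + ε) ≤ 1 - ε) (hc : (c + ε) ^ 2 ≤ (1 + κ) / 2) (hc0 : 0 < c)
    (hH : ∀ X : ℂ, R < ‖X‖ → κ * ‖X‖ < X.re → ‖H X - X - 1‖ ≤ ε)
    {X : ℂ} (hX : R < c * ‖X‖) (hXa : κ * ‖X‖ < X.re) (n : ℕ) :
    R < ‖H^[n] X‖ ∧ κ * ‖H^[n] X‖ < (H^[n] X).re ∧ c * (‖X‖ + n) ≤ ‖H^[n] X‖ := by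
  -- All that is wanted of the n-th iterate follows from its distance at most εn to X + n, so the
  -- induction only has to propagate that distance.
  have main : ∀ n : ℕ, ∀ Y : ℂ, ‖Y - X - n‖ ≤ ε * n →
      R < ‖Y‖ ∧ κ * ‖Y‖ < Y.re ∧ c * (‖X‖ + n) ≤ ‖Y‖ := by
    intro n Y hY
    have hn : (0:ℝ) ≤ n := Nat.cast_nonneg n
    have hX0 := norm_nonneg X
    have h3 : ‖X + n‖ ^ 2 = ‖X‖ ^ 2 + 2 * n * X.re + n ^ 2 := by
      rw [← Complex.normSq_eq_norm_sq, ← Complex.normSq_eq_norm_sq, Complex.normSq_apply,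
        Complex.normSq_apply]
      simp; ring
    have h4 : ((c + ε) * (‖X‖ + n)) ^ 2 ≤ ‖X + n‖ ^ 2 := by
      rw [h3, mul_pow]
      have q1 : (1 + κ) / 2 * (‖X‖ + n) ^ 2 ≤ ‖X‖ ^ 2 + 2 * n * X.re + n ^ 2 := by
        nlinarith [sq_nonneg (‖X‖ - n), mul_nonneg hn hX0,
          mul_nonneg hn (sub_nonneg.2 hXa.le)]
      exact (mul_le_mul_of_nonneg_right hc (sq_nonneg _)).trans q1
    have h5 := le_of_sq_le_sq h4 (norm_nonneg _)
    have h6 : ‖X + n‖ ≤ ‖Y‖ + ε * n := by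
      have : X + n = Y - (Y - X - n) := by ring
      rw [this]; exact (norm_sub_le _ _).trans (by gcongr)
    have h7 : c * (‖X‖ + n) ≤ ‖Y‖ := by nlinarith [mul_nonneg hε0 hX0]
    have h8 : ‖X‖ - n - ε * n ≤ ‖Y‖ := by
      have h9 : ‖X‖ ≤ ‖Y‖ + ‖Y - X - n‖ + n := by
        have e : X = Y - (Y - X - n) - n := by ring
        have := norm_sub_le (Y - (Y - X - n)) (n : ℂ)
        rw [← e] at this
        have := norm_sub_le Y (Y - X - n)
        simp at *
        linarith
      linarith
    have h10 : X.re + n - ε * n ≤ Y.re := by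
      have := (abs_le.1 ((Complex.abs_re_le_norm (Y - X - n)).trans hY)).1
      simp at this
      linarith
    refine ⟨?_, ?_, h7⟩
    · nlinarith
    · nlinarith
  have ind : ∀ n : ℕ, ‖H^[n] X - X - n‖ ≤ ε * n := by
    intro n
    induction n with
    | zero => simp
    | succ n ih =>
      obtain ⟨a, b, -⟩ := main n _ ih
      have h1 := hH _ a b
      rw [Function.iterate_succ_apply']
      have : H (H^[n] X) - X - ((n + 1 : ℕ) : ℂ) =
          (H (H^[n] X) - H^[n] X - 1) + (H^[n] X - X - n) := by push_cast; ring
      rw [this]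
      refine (norm_add_le _ _).trans ?_
      push_cast
      linarith
  exact main n _ (ind n)

theorem tendsto_norm_rpow_infSector {β s : ℝ} (hs : 0 < s) :
    Tendsto (fun X : ℂ => ‖X‖ ^ (-s)) (infSector β) (𝓝 0) :=
  (tendsto_rpow_neg_atTop hs).comp tendsto_norm_infSector

/-- Along the map, a log X increases by a/X up to O(X⁻²), which cancels the term a/X of the
increment. So X - a log X solves Abel's equation up to a defect of order 1 + δ > 1, summable along
orbits; δ ≤ 1 absorbs the X⁻² terms. -/
theorem log_increment_isBigO {β δ : ℝ} (hβ : β < Real.pi) (hδ : 0 < δ) (hδ1 : δ ≤ 1) {H : ℂ → ℂ}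
    {a : ℂ} (hH : (fun X => H X - X - 1 - a / X) =O[infSector β] fun X => ‖X‖ ^ (-(1 + δ))) :
    (fun X => (H X - a * Complex.log (H X)) - (X - a * Complex.log X) - 1)
      =O[infSector β] fun X => ‖X‖ ^ (-(1 + δ)) := by
  have hX1 : ∀ᶠ X in infSector β, 1 ≤ ‖X‖ := tendsto_norm_infSector.eventually_ge_atTop 1
  have c1 : (fun X : ℂ => ‖X‖ ^ (-(1 + δ))) =O[infSector β] fun X => ‖X‖ ^ (-1 : ℝ) := by
    refine IsBigO.of_bound 1 ?_
    filter_upwards [hX1] with X hX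
    rw [one_mul, Real.norm_of_nonneg (by positivity), Real.norm_of_nonneg (by positivity)]
    exact Real.rpow_le_rpow_of_exponent_le hX (by linarith)
  have c2 : (fun X : ℂ => ‖X‖ ^ (-2 : ℝ)) =O[infSector β] fun X => ‖X‖ ^ (-(1 + δ)) := by
    refine IsBigO.of_bound 1 ?_
    filter_upwards [hX1] with X hX
    rw [one_mul, Real.norm_of_nonneg (by positivity), Real.norm_of_nonneg (by positivity)]
    exact Real.rpow_le_rpow_of_exponent_le hX (by linarith)
  have c3 : (fun X : ℂ => X⁻¹) =O[infSector β] fun X : ℂ => ‖X‖ ^ (-1 : ℝ) := by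
    refine IsBigO.of_bound 1 (Eventually.of_forall fun X => ?_)
    rw [norm_inv, Real.rpow_neg_one, norm_inv, norm_norm, one_mul]
  have c4 : (fun X : ℂ => (1 : ℂ)) =O[infSector β] fun X : ℂ => (1 : ℝ) := isBigO_const_const (1 : ℂ) (one_ne_zero (α := ℝ)) _
  have c5 : (fun X : ℂ => ‖X‖ ^ (-1 : ℝ)) =O[infSector β] fun X : ℂ => (1:ℝ) := by
    refine IsBigO.of_bound 1 ?_
    filter_upwards [hX1] with X hX
    rw [one_mul, Real.norm_of_nonneg (by positivity), norm_one]
    exact Real.rpow_le_one_of_one_le_of_nonpos hX (by norm_num)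
  have hmul : ∀ X : ℂ, X ≠ 0 → ‖X‖ ^ (-1 : ℝ) * ‖X‖ ^ (-1 : ℝ) = ‖X‖ ^ (-2 : ℝ) := by
    intro X hX
    rw [← Real.rpow_add (norm_pos_iff.2 hX)]; norm_num
  set η : ℂ → ℂ := fun X => H X - X - 1 - a / X with hη
  set t : ℂ → ℂ := fun X => (H X - X) * X⁻¹ with ht
  have d1 : (fun X => H X - X - 1) =O[infSector β] fun X : ℂ => ‖X‖ ^ (-1 : ℝ) := by
    have : (fun X => H X - X - 1) = fun X => η X + a * X⁻¹ := by
      ext X; simp only [hη, div_eq_mul_inv]; ring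
    rw [this]
    exact (hH.trans c1).add (c3.const_mul_left a)
  have d2 : (fun X => t X - X⁻¹) =O[infSector β] fun X : ℂ => ‖X‖ ^ (-2 : ℝ) := by
    have : (fun X => t X - X⁻¹) = fun X => (H X - X - 1) * X⁻¹ := by ext X; simp only [ht]; ring
    rw [this]
    refine (d1.mul c3).congr' EventuallyEq.rfl ?_
    filter_upwards [infSector_ne_zero] with X hX using hmul X hX
  have d3 : t =O[infSector β] fun X : ℂ => ‖X‖ ^ (-1 : ℝ) := by
    refine (((d1.trans c5).add c4).mul c3).congr (fun X => ?_) (fun X => one_mul _)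
    simp only [ht]; ring
  have d4 : Tendsto t (infSector β) (𝓝 0) :=
    d3.trans_tendsto (tendsto_norm_rpow_infSector one_pos)
  have d5 : (fun X => Complex.log (1 + t X) - t X) =O[infSector β] fun X : ℂ => ‖X‖ ^ (-2 : ℝ) := by
    refine IsBigO.trans (g := fun X => t X * t X) ?_ ((d3.mul d3).congr' EventuallyEq.rfl ?_)
    · refine IsBigO.of_bound 1 ?_
      filter_upwards [(tendsto_norm_zero.comp d4).eventually (gt_mem_nhds (show (0:ℝ) < 1 / 2 by norm_num))]
        with X hX
      simp only [Function.comp] at hX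
      refine (Complex.norm_log_one_add_sub_self_le (z := t X) (by linarith)).trans ?_
      have : (1 - ‖t X‖)⁻¹ ≤ 2 := by
        rw [inv_le_comm₀ (by linarith) two_pos]; linarith
      rw [one_mul, norm_mul (t X) (t X)]
      nlinarith [sq_nonneg ‖t X‖]
    · filter_upwards [infSector_ne_zero] with X hX using hmul X hX
  obtain ⟨ε, e0, e1, e2⟩ := exists_arg_one_add_lt (sub_pos.2 hβ)
  have d6 : ∀ᶠ X in infSector β, Complex.log (H X) = Complex.log X + Complex.log (1 + t X) := by
    filter_upwards [infSector_ne_zero, eventually_infSector_arg,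
      (tendsto_norm_zero.comp d4).eventually (gt_mem_nhds e0)] with X h1 h2 h3
    simp only [Function.comp] at h3
    have : H X = X * (1 + t X) := by simp only [ht]; field_simp; ring
    rw [this, log_mul_of_abs_lt h1]
    · intro h0
      have : t X = -1 := by linear_combination h0
      rw [this] at h3; simp at h3; linarith
    · have := e2 _ h3.le
      linarith
  have d7 : (fun X => η X - a * ((Complex.log (1 + t X) - t X) + (t X - X⁻¹))) =O[infSector β]
      fun X => ‖X‖ ^ (-(1 + δ)) :=
    hH.sub (((d5.add d2).const_mul_left a).trans c2)
  refine d7.congr' ?_ EventuallyEq.rfl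
  filter_upwards [d6] with X h
  rw [h]
  simp only [hη, div_eq_mul_inv]; ring

/-- Existence of Fatou coordinates with a controlled asymptotic expansion. -/
theorem exists_fatou {H : ℂ → ℂ} {a : ℂ} {δ : ℝ} (hδ : 0 < δ) (hδ1 : δ ≤ 1)
    (hd : ∀ β < Real.pi, ∀ᶠ X in infSector β, DifferentiableAt ℂ H X)
    (hH : ∀ β < Real.pi,
      (fun X => H X - X - 1 - a / X) =O[infSector β] fun X => ‖X‖ ^ (-(1 + δ))) :
    ∃ Φ : ℂ → ℂ, ∀ β < Real.pi,
      (∀ᶠ X in infSector β, DifferentiableAt ℂ Φ X ∧ Φ (H X) = Φ X + 1) ∧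
      Tendsto (fun X => Φ X - (X - a * Complex.log X)) (infSector β) (𝓝 0) := by
  set U : ℂ → ℂ := fun X => X - a * Complex.log X with hU
  set e : ℂ → ℂ := fun X => U (H X) - U X - 1 with he
  -- `e` is the defect of `U` in Abel's equation; its sum along the forward orbit telescopes and
  -- corrects it exactly.
  refine ⟨fun X => U X + ∑' n : ℕ, e (H^[n] X), ?_⟩
  -- Smaller sectors are contained in these, and β ≥ π/2 gives the sign κ ≤ 0 that `orbit_estimate`
  -- needs.
  have main : ∀ β, Real.pi / 2 ≤ β → β < Real.pi →
      (∀ᶠ X in infSector β, DifferentiableAt ℂ (fun X => U X + ∑' n : ℕ, e (H^[n] X)) X ∧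
        U (H X) + ∑' n : ℕ, e (H^[n] (H X)) = U X + ∑' n : ℕ, e (H^[n] X) + 1) ∧
      Tendsto (fun X => U X + ∑' n : ℕ, e (H^[n] X) - U X) (infSector β) (𝓝 0) := by
    intro β hβ0 hβ
    have hpi := Real.pi_pos
    set κ := Real.cos β with hκdef
    have hκ0 : κ ≤ 0 := Real.cos_nonpos_of_pi_div_two_le_of_le hβ0 (by linarith)
    have hκ : -1 < κ := by
      rw [hκdef, ← Real.cos_pi]
      exact Real.cos_lt_cos_of_nonneg_of_le_pi (by linarith) le_rfl hβ
    have hmem : ∀ X : ℂ, X ≠ 0 → (|X.arg| < β ↔ κ * ‖X‖ < X.re) := fun X hX =>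
      abs_arg_lt_iff hX (by linarith) hβ.le
    obtain ⟨ε, c, hε, hε1, hc0, hc1⟩ : ∃ ε c : ℝ, 0 < ε ∧ -κ * (1 + ε) ≤ 1 - ε ∧ 0 < c ∧
        (c + ε) ^ 2 ≤ (1 + κ) / 2 := by
      refine ⟨(1 + κ) / 4, (1 + κ) / 4, by linarith, by nlinarith, by linarith, by nlinarith⟩
    have hee : e =O[infSector β] fun X => ‖X‖ ^ (-(1 + δ)) :=
      log_increment_isBigO hβ hδ hδ1 (hH β hβ)
    obtain ⟨K, hK0, hK⟩ := hee.exists_pos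
    have hH1 : ∀ᶠ X in infSector β, ‖H X - X - 1‖ ≤ ε := by
      have t1 : Tendsto (fun X => H X - X - 1) (infSector β) (𝓝 0) := by
        have h1 := (hH β hβ).trans_tendsto (tendsto_norm_rpow_infSector (by linarith))
        have h2 := (tendsto_inv_infSector (β := β)).const_mul a
        have := h1.add h2
        rw [mul_zero, add_zero] at this
        refine this.congr fun X => ?_
        rw [div_eq_mul_inv]; ring
      filter_upwards [(tendsto_norm_zero.comp t1).eventually (gt_mem_nhds hε)] with X hX
      exact hX.le
    have hHm : Tendsto (fun X => H X / X) (infSector β) (𝓝 1) := by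
      have h1 := (hH β hβ).trans_tendsto (tendsto_norm_rpow_infSector (by linarith))
      have h2 := (tendsto_inv_infSector (β := β))
      have h3 := ((h1.add_const 1).add (h2.const_mul a)).mul h2
      have := h3.add_const 1
      simp only [zero_add, mul_zero, add_zero] at this
      refine this.congr' ?_
      filter_upwards [infSector_ne_zero] with X hX
      rw [div_eq_mul_inv, div_eq_mul_inv]
      field_simp; ring
    have hed : ∀ᶠ X in infSector β, DifferentiableAt ℂ e X := by
      obtain ⟨β₁, hb1, hb2⟩ := exists_between hβ
      have hUd : ∀ b < Real.pi, ∀ᶠ X in infSector b, DifferentiableAt ℂ U X := by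
        intro b hb
        filter_upwards [infSector_ne_zero, eventually_infSector_arg] with X h1 h2
        have : X ∈ Complex.slitPlane := by
          rw [Complex.mem_slitPlane_iff_arg]
          exact ⟨fun h => by rw [h, abs_of_pos hpi] at h2; linarith, h1⟩
        simp only [hU]
        exact differentiableAt_id.sub ((Complex.differentiableAt_log this).const_mul a)
      filter_upwards [hUd β hβ, hd β hβ,
        (tendsto_infSector hb1 hb2.le hHm).eventually (hUd β₁ hb2)] with X h1 h2 h3
      exact ((DifferentiableAt.comp X h3 h2).sub h1).sub_const 1
    obtain ⟨R, hR1, hR⟩ := eventually_infSector.1 ((hK.bound.and hH1).and (hed.and (hd β hβ)))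
    have hR' : ∀ X : ℂ, R < ‖X‖ → κ * ‖X‖ < X.re → ‖e X‖ ≤ K * ‖X‖ ^ (-(1 + δ)) ∧
        ‖H X - X - 1‖ ≤ ε ∧ DifferentiableAt ℂ e X ∧ DifferentiableAt ℂ H X := by
      intro X h1 h2
      have hX0 : X ≠ 0 := norm_pos_iff.1 (by linarith)
      obtain ⟨⟨a1, a2⟩, a3, a4⟩ := hR X h1.le ((hmem X hX0).2 h2)
      rw [Real.norm_of_nonneg (by positivity)] at a1
      exact ⟨a1, a2, a3, a4⟩
    let Ω : Set ℂ := {X | max 1 (R / c) < ‖X‖ ∧ κ * ‖X‖ < X.re}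
    have hΩo : IsOpen Ω := by
      refine (isOpen_lt continuous_const continuous_norm).inter
        (isOpen_lt (by fun_prop) Complex.continuous_re)
    have horb : ∀ X ∈ Ω, ∀ n : ℕ, R < ‖H^[n] X‖ ∧ κ * ‖H^[n] X‖ < (H^[n] X).re ∧
        c * (‖X‖ + n) ≤ ‖H^[n] X‖ := by
      intro X ⟨h1, h2⟩ n
      refine orbit_estimate hκ0 hε.le hε1 hc1 hc0 (fun Y a b => (hR' Y a b).2.1) ?_ h2 n
      have := (le_max_right _ _).trans_lt h1
      rw [div_lt_iff₀ hc0] at this; linarith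
    -- Of the exponent 1 + δ, a part δ/2 is kept as a power of ‖X‖ to make the sum tend to 0 at
    -- infinity; the remaining 1 + δ/2 still gives convergence in n.
    let u : ℕ → ℝ := fun n => K * c ^ (-(1 + δ)) * ((n : ℝ) + 1) ^ (-(1 + δ / 2))
    have hu : Summable u := by
      refine Summable.mul_left _ ?_
      have := (Real.summable_one_div_nat_add_rpow 1 (1 + δ / 2)).2 (by linarith)
      refine this.congr fun n => ?_
      rw [abs_of_pos (by positivity), Real.rpow_neg (by positivity), one_div]
    have hterm : ∀ X ∈ Ω, ∀ n : ℕ, ‖e (H^[n] X)‖ ≤ ‖X‖ ^ (-(δ / 2)) * u n := by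
      intro X hX n
      obtain ⟨h1, h2, h3⟩ := horb X hX n
      have hX1 : 1 ≤ ‖X‖ := ((le_max_left _ _).trans_lt hX.1).le
      have hn : (0:ℝ) ≤ n := Nat.cast_nonneg n
      have hpos : 0 < ‖X‖ + n := by linarith
      calc ‖e (H^[n] X)‖ ≤ K * ‖H^[n] X‖ ^ (-(1 + δ)) := (hR' _ h1 h2).1
        _ ≤ K * (c * (‖X‖ + n)) ^ (-(1 + δ)) := by
            gcongr ?_ * ?_
            exact Real.rpow_le_rpow_of_nonpos (by positivity) h3 (by linarith)
        _ = K * c ^ (-(1 + δ)) * ((‖X‖ + n) ^ (-(δ / 2)) * (‖X‖ + n) ^ (-(1 + δ / 2))) := by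
            rw [Real.mul_rpow hc0.le hpos.le, ← Real.rpow_add hpos, mul_assoc]
            ring_nf
        _ ≤ K * c ^ (-(1 + δ)) * (‖X‖ ^ (-(δ / 2)) * ((n : ℝ) + 1) ^ (-(1 + δ / 2))) := by
            gcongr ?_ * (?_ * ?_)
            · exact Real.rpow_le_rpow_of_nonpos (by linarith) (by linarith) (by linarith)
            · exact Real.rpow_le_rpow_of_nonpos (by positivity) (by linarith) (by linarith)
        _ = _ := by simp only [u]; ring
    have hterm1 : ∀ X ∈ Ω, ∀ n : ℕ, ‖e (H^[n] X)‖ ≤ u n := by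
      intro X hX n
      refine (hterm X hX n).trans (mul_le_of_le_one_left ?_ ?_)
      · simp only [u]; positivity
      · exact Real.rpow_le_one_of_one_le_of_nonpos ((le_max_left _ _).trans_lt hX.1).le (by linarith)
    have hsumm : ∀ X ∈ Ω, Summable fun n : ℕ => e (H^[n] X) := fun X hX =>
      Summable.of_norm_bounded hu (hterm1 X hX)
    have hiter : ∀ n : ℕ, ∀ X ∈ Ω, DifferentiableAt ℂ (H^[n]) X := by
      intro n
      induction n with
      | zero => intro X _; simp
      | succ n ih =>
        intro X hX
        obtain ⟨h1, h2, -⟩ := horb X hX n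
        rw [Function.iterate_succ']
        exact DifferentiableAt.comp X (hR' _ h1 h2).2.2.2 (ih X hX)
    have hdiff : DifferentiableOn ℂ (fun X => ∑' n : ℕ, e (H^[n] X)) Ω := by
      refine Complex.differentiableOn_tsum_of_summable_norm hu ?_ hΩo fun n X hX => hterm1 X hX n
      intro n X hX
      obtain ⟨h1, h2, -⟩ := horb X hX n
      exact (DifferentiableAt.comp X (hR' _ h1 h2).2.2.1 (hiter n X hX)).differentiableWithinAt
    have hΩev : ∀ᶠ X in infSector β, X ∈ Ω := by
      filter_upwards [tendsto_norm_infSector.eventually_gt_atTop (max 1 (R / c)),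
        eventually_infSector_arg, infSector_ne_zero] with X h1 h2 h3
      exact ⟨h1, (hmem X h3).1 h2⟩
    refine ⟨?_, ?_⟩
    · filter_upwards [hΩev, infSector_ne_zero, eventually_infSector_arg] with X hX h1 h2
      refine ⟨?_, ?_⟩
      · have : X ∈ Complex.slitPlane := by
          rw [Complex.mem_slitPlane_iff_arg]
          exact ⟨fun h => by rw [h, abs_of_pos hpi] at h2; linarith, h1⟩
        exact (differentiableAt_id.sub ((Complex.differentiableAt_log this).const_mul a)).add
          ((hdiff X hX).differentiableAt (hΩo.mem_nhds hX))
      · rw [(hsumm X hX).tsum_eq_zero_add]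
        simp only [Function.iterate_zero, id, Function.iterate_succ, Function.comp]
        simp only [he]; ring
    · have hz : Tendsto (fun X : ℂ => ‖X‖ ^ (-(δ / 2)) * ∑' n, u n) (infSector β) (𝓝 0) := by
        have := (tendsto_norm_rpow_infSector (β := β) (show 0 < δ / 2 by linarith)).mul_const (∑' n, u n)
        rwa [zero_mul] at this
      refine squeeze_zero_norm' ?_ hz
      filter_upwards [hΩev] with X hX
      rw [add_sub_cancel_left, ← tsum_mul_left]
      exact tsum_of_norm_bounded (hu.mul_left _).hasSum (hterm X hX)
  intro β hβ
  have hpi := Real.pi_pos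
  obtain ⟨h1, h2⟩ := main (max β (Real.pi / 2)) (le_max_right _ _) (max_lt hβ (by linarith))
  exact ⟨h1.filter_mono (infSector_mono (le_max_left _ _)), h2.mono_left (infSector_mono (le_max_left _ _))⟩

/-! ### Sectors at the origin and the coordinate 1/(k w^k). -/

section

/-- The germ at `0` of the sector of direction `θ` and half-opening `α`. -/
noncomputable def germSector (θ α : ℝ) : Filter ℂ := 𝓝[sector θ α 1] 0

/-- The argument relative to the direction `θ`. -/
noncomputable def relArg (θ : ℝ) (z : ℂ) : ℝ := (z * Complex.exp (-(θ * Complex.I))).arg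

theorem eventually_germSector {θ α : ℝ} {P : ℂ → Prop} :
    (∀ᶠ z in germSector θ α, P z) ↔ ∃ ρ : ℝ, 0 < ρ ∧ ∀ z ∈ sector θ α ρ, P z := by
  unfold germSector
  rw [Metric.nhdsWithin_basis_ball.eventually_iff]
  constructor
  · rintro ⟨ρ, hρ, h⟩
    refine ⟨min ρ 1, by positivity, fun z hz => h ⟨?_, hz.1, hz.2.1.trans_le (min_le_right _ _), hz.2.2⟩⟩
    rw [mem_ball_zero_iff]; exact hz.2.1.trans_le (min_le_left _ _)
  · rintro ⟨ρ, hρ, h⟩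
    refine ⟨ρ, hρ, fun z hz => h z ⟨hz.2.1, ?_, hz.2.2.2⟩⟩
    simpa using hz.1

theorem germSector_mono {θ α α' : ℝ} (h : α' ≤ α) : germSector θ α' ≤ germSector θ α :=
  nhdsWithin_mono _ fun _ hz => ⟨hz.1, hz.2.1, hz.2.2.trans_le h⟩

theorem germSector_le {θ α : ℝ} : germSector θ α ≤ 𝓝[≠] 0 :=
  nhdsWithin_mono _ fun _ hz => norm_pos_iff.1 hz.1

theorem germSector_le_nhds {θ α : ℝ} : germSector θ α ≤ 𝓝 0 := nhdsWithin_le_nhds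

theorem germSector_ne_zero {θ α : ℝ} : ∀ᶠ z in germSector θ α, z ≠ 0 :=
  germSector_le self_mem_nhdsWithin

theorem germSector_relArg {θ α : ℝ} : ∀ᶠ z in germSector θ α, |relArg θ z| < α :=
  eventually_germSector.2 ⟨1, one_pos, fun _ hz => hz.2.2⟩

theorem norm_exp_neg_mul_I (θ : ℝ) : ‖Complex.exp (-(θ * Complex.I))‖ = 1 := by
  rw [← neg_mul, ← Complex.ofReal_neg, Complex.norm_exp_ofReal_mul_I]

theorem exp_mul_exp_neg (θ : ℝ) :
    Complex.exp (θ * Complex.I) * Complex.exp (-(θ * Complex.I)) = 1 := by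
  rw [← Complex.exp_add]; simp

theorem tendsto_germSector_iff {ι : Type*} {l : Filter ι} {f : ι → ℂ} {θ α : ℝ} :
    Tendsto f l (germSector θ α) ↔
      Tendsto f l (𝓝 0) ∧ ∀ᶠ x in l, f x ≠ 0 ∧ |relArg θ (f x)| < α := by
  unfold germSector
  rw [tendsto_nhdsWithin_iff]
  refine and_congr_right fun h => ?_
  have h1 : ∀ᶠ x in l, ‖f x‖ < 1 := by
    filter_upwards [h.eventually (Metric.ball_mem_nhds 0 one_pos)] with x hx
    simpa using hx
  constructor
  · intro h2
    filter_upwards [h2] with x hx using ⟨norm_pos_iff.1 hx.1, hx.2.2⟩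
  · intro h2
    filter_upwards [h1, h2] with x hx hx2 using ⟨norm_pos_iff.2 hx2.1, hx, hx2.2⟩

/-- A germ with a multiplier of modulus one maps germs of sectors to slightly larger ones. -/
theorem tendsto_germSector {θ ψ α α' : ℝ} (h : α' < α) (hα : α ≤ Real.pi) {f : ℂ → ℂ}
    (hf : Tendsto (fun z => f z / z) (germSector θ α') (𝓝 (Complex.exp (ψ * Complex.I)))) :
    Tendsto f (germSector θ α') (germSector (θ + ψ) α) := by
  rw [tendsto_germSector_iff]
  have h0 : Tendsto (fun z => f z / z * z) (germSector θ α') (𝓝 0) := by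
    have := hf.mul (tendsto_id.mono_left (germSector_le_nhds (θ := θ) (α := α')))
    rwa [mul_zero] at this
  have h1 : Tendsto (fun z => f z / z * Complex.exp (-(ψ * Complex.I))) (germSector θ α') (𝓝 1) := by
    have := hf.mul_const (Complex.exp (-(ψ * Complex.I)))
    rwa [exp_mul_exp_neg] at this
  have h2 : Tendsto (fun z => |(f z / z * Complex.exp (-(ψ * Complex.I))).arg|)
      (germSector θ α') (𝓝 0) := by
    have h3 : ContinuousAt (fun z : ℂ => |z.arg|) 1 := (Complex.continuousAt_arg (by simp)).abs
    have h4 : Tendsto (fun z : ℂ => |z.arg|) (𝓝 1) (𝓝 0) := by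
      have := h3.tendsto
      rwa [Complex.arg_one, abs_zero] at this
    exact h4.comp h1
  refine ⟨h0.congr' ?_, ?_⟩
  · filter_upwards [germSector_ne_zero] with z hz
    field_simp
  · filter_upwards [germSector_ne_zero, germSector_relArg, h1.eventually_ne one_ne_zero,
      h2.eventually (gt_mem_nhds (sub_pos.2 h))] with z hz h4 h5 h6
    have h7 : f z ≠ 0 := by
      intro h8; rw [h8] at h5; simp at h5
    refine ⟨h7, ?_⟩
    have e : f z * Complex.exp (-(((θ + ψ : ℝ) : ℂ) * Complex.I)) =
        (z * Complex.exp (-(θ * Complex.I))) * (f z / z * Complex.exp (-(ψ * Complex.I))) := by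
      rw [show -(((θ + ψ : ℝ) : ℂ) * Complex.I) = -(θ * Complex.I) + -(ψ * Complex.I) by
        push_cast; ring, Complex.exp_add]
      field_simp
    unfold relArg at h4 ⊢
    rw [e, arg_mul_of_abs_lt (mul_ne_zero hz (Complex.exp_ne_zero _)) h5 (by linarith)]
    exact (abs_add_le _ _).trans_lt (by linarith)

theorem tendsto_germSector_of_tangent {θ α α' : ℝ} (h : α' < α) (hα : α ≤ Real.pi) {f : ℂ → ℂ}
    (hf : Tendsto (fun z => f z / z) (germSector θ α') (𝓝 1)) :
    Tendsto f (germSector θ α') (germSector θ α) := by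
  have := tendsto_germSector (ψ := 0) h hα (by simpa using hf)
  rwa [add_zero] at this

/-- The coordinate `1 / (k w ^ k)`, with `w` the variable rotated by `-θ`. -/
noncomputable def chart (k : ℕ) (θ : ℝ) (z : ℂ) : ℂ :=
  ((k : ℂ) * (z * Complex.exp (-(θ * Complex.I))) ^ k)⁻¹

/-- The inverse of `chart` on a sector. -/
noncomputable def unchart (k : ℕ) (θ : ℝ) (X : ℂ) : ℂ :=
  Complex.exp (θ * Complex.I) * Complex.exp (-(Complex.log (k * X)) / k)

variable {k : ℕ}

theorem natCast_ne_zero_of_pos (hk : 1 ≤ k) : (k : ℂ) ≠ 0 := by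
  simp; omega

theorem chart_unchart (hk : 1 ≤ k) (θ : ℝ) {X : ℂ} (hX : X ≠ 0) : chart k θ (unchart k θ X) = X := by
  have hk0 := natCast_ne_zero_of_pos hk
  unfold chart unchart
  rw [mul_right_comm, exp_mul_exp_neg, one_mul, ← Complex.exp_nat_mul, mul_div_cancel₀ _ hk0,
    Complex.exp_neg, Complex.exp_log (mul_ne_zero hk0 hX)]
  field_simp

/-- k times the chart is w^(-k) with w = z exp(-iθ); a half-opening at most π/k is exactly what
keeps -k log w on the principal branch. -/
theorem log_natCast_mul_chart (hk : 1 ≤ k) {θ α : ℝ} (hα : α ≤ Real.pi / k) {z : ℂ} (hz : z ≠ 0)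
    (hza : |relArg θ z| < α) :
    Complex.log (k * chart k θ z) = -(k * Complex.log (z * Complex.exp (-(θ * Complex.I)))) := by
  have hk0 := natCast_ne_zero_of_pos hk
  have hkr : (0:ℝ) < k := by exact_mod_cast hk
  set w := z * Complex.exp (-(θ * Complex.I)) with hw
  have hw0 : w ≠ 0 := mul_ne_zero hz (Complex.exp_ne_zero _)
  have e : k * chart k θ z = Complex.exp (-(k * Complex.log w)) := by
    unfold chart
    rw [← hw, Complex.exp_neg, Complex.exp_nat_mul, Complex.exp_log hw0]
    field_simp
  have h1 : |w.arg| < Real.pi / k := hza.trans_le hα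
  rw [lt_div_iff₀ hkr] at h1
  have h2 := abs_le.1 (le_refl |w.arg|)
  rw [e, Complex.log_exp]
  · simp only [Complex.neg_im, Complex.mul_im, Complex.natCast_re, Complex.log_im,
      Complex.natCast_im, zero_mul, add_zero]
    nlinarith
  · simp only [Complex.neg_im, Complex.mul_im, Complex.natCast_re, Complex.log_im,
      Complex.natCast_im, zero_mul, add_zero]
    nlinarith

theorem unchart_chart (hk : 1 ≤ k) {θ α : ℝ} (hα : α ≤ Real.pi / k) {z : ℂ} (hz : z ≠ 0)
    (hza : |relArg θ z| < α) : unchart k θ (chart k θ z) = z := by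
  have hk0 := natCast_ne_zero_of_pos hk
  unfold unchart
  rw [log_natCast_mul_chart hk hα hz hza, neg_neg, mul_div_cancel_left₀ _ hk0,
    Complex.exp_log (mul_ne_zero hz (Complex.exp_ne_zero _)), mul_left_comm, exp_mul_exp_neg, mul_one]

theorem arg_natCast_mul (hk : 1 ≤ k) (X : ℂ) : ((k : ℂ) * X).arg = X.arg := by
  have hkr : (0:ℝ) < k := by exact_mod_cast hk
  have := Complex.arg_real_mul X hkr
  simpa using this

theorem tendsto_chart (hk : 1 ≤ k) {θ α : ℝ} (hα : α ≤ Real.pi / k) :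
    Tendsto (chart k θ) (germSector θ α) (infSector (k * α)) := by
  have hk0 := natCast_ne_zero_of_pos hk
  have hkr : (0:ℝ) < k := by exact_mod_cast hk
  refine tendsto_inf.2 ⟨?_, tendsto_principal.2 ?_⟩
  · unfold chart
    refine (tendsto_inv₀_nhdsNE_zero (α := ℂ)).comp ?_
    refine tendsto_nhdsWithin_iff.2 ⟨?_, ?_⟩
    · have : ContinuousAt (fun z : ℂ => (k : ℂ) * (z * Complex.exp (-(θ * Complex.I))) ^ k) 0 := by
        fun_prop
      have h := this.tendsto.mono_left (germSector_le_nhds (θ := θ) (α := α))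
      have h0 : k ≠ 0 := by omega
      simpa [h0] using h
    · filter_upwards [germSector_ne_zero] with z hz
      exact mul_ne_zero hk0 (pow_ne_zero _ (mul_ne_zero hz (Complex.exp_ne_zero _)))
  · filter_upwards [germSector_ne_zero, germSector_relArg] with z hz hza
    have := congrArg Complex.im (log_natCast_mul_chart hk hα hz hza)
    rw [Complex.log_im, arg_natCast_mul hk] at this
    change |(chart k θ z).arg| < _
    rw [this]
    simp only [Complex.neg_im, Complex.mul_im, Complex.natCast_re, Complex.log_im,
      Complex.natCast_im, zero_mul, add_zero, abs_neg, abs_mul, Nat.abs_cast]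
    exact mul_lt_mul_of_pos_left hza hkr

theorem log_unchart (hk : 1 ≤ k) (θ : ℝ) {X : ℂ} (hXa : |X.arg| < Real.pi) :
    Complex.log (unchart k θ X * Complex.exp (-(θ * Complex.I))) = -(Complex.log (k * X)) / k := by
  have hkr : (1:ℝ) ≤ k := by exact_mod_cast hk
  unfold unchart
  rw [mul_right_comm, exp_mul_exp_neg, one_mul]
  have him : (-(Complex.log (k * X)) / k).im = -X.arg / k := by
    rw [Complex.div_natCast_im, Complex.neg_im, Complex.log_im, arg_natCast_mul hk]
  have hb : |-X.arg / k| < Real.pi := by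
    rw [abs_div, abs_neg, Nat.abs_cast]
    exact (div_le_self (abs_nonneg _) hkr).trans_lt hXa
  rw [abs_lt] at hb
  rw [Complex.log_exp (by rw [him]; exact hb.1) (by rw [him]; exact hb.2.le)]

theorem norm_unchart (hk : 1 ≤ k) (θ : ℝ) {X : ℂ} (hX : X ≠ 0) :
    ‖unchart k θ X‖ = (k * ‖X‖) ^ (-(1 / k) : ℝ) := by
  have hk0 := natCast_ne_zero_of_pos hk
  unfold unchart
  have hkr : (0:ℝ) < k := by exact_mod_cast hk
  rw [norm_mul, Complex.norm_exp_ofReal_mul_I, one_mul, Complex.norm_exp, Complex.div_natCast_re,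
    Complex.neg_re, Complex.log_re, norm_mul, Complex.norm_natCast,
    Real.rpow_def_of_pos (mul_pos hkr (norm_pos_iff.2 hX))]
  congr 1; ring

theorem tendsto_unchart (hk : 1 ≤ k) (θ : ℝ) {β : ℝ} (hβ : β ≤ Real.pi) :
    Tendsto (unchart k θ) (infSector β) (germSector θ (β / k)) := by
  have hkr : (0:ℝ) < k := by exact_mod_cast hk
  refine tendsto_germSector_iff.2 ⟨?_, ?_⟩
  · rw [tendsto_zero_iff_norm_tendsto_zero]
    have h1 : Tendsto (fun X : ℂ => (k * ‖X‖) ^ (-(1 / k) : ℝ)) (infSector β) (𝓝 0) :=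
      (tendsto_rpow_neg_atTop (by positivity)).comp (tendsto_norm_infSector.const_mul_atTop hkr)
    refine h1.congr' ?_
    filter_upwards [infSector_ne_zero] with X hX
    rw [norm_unchart hk θ hX]
  · filter_upwards [infSector_ne_zero, eventually_infSector_arg] with X hX hXa
    refine ⟨mul_ne_zero (Complex.exp_ne_zero _) (Complex.exp_ne_zero _), ?_⟩
    have := congrArg Complex.im (log_unchart hk θ (hXa.trans_le hβ))
    rw [Complex.log_im, Complex.div_natCast_im, Complex.neg_im, Complex.log_im,
      arg_natCast_mul hk] at this
    unfold relArg
    rw [this, abs_div, abs_neg, Nat.abs_cast]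
    exact div_lt_div_of_pos_right hXa hkr

theorem eventually_unchart_chart (hk : 1 ≤ k) {θ α : ℝ} (hα : α ≤ Real.pi / k) :
    ∀ᶠ z in germSector θ α, unchart k θ (chart k θ z) = z := by
  filter_upwards [germSector_ne_zero, germSector_relArg] with z hz hza
  exact unchart_chart hk hα hz hza

/-- Transfer of properties from the sector at infinity to the sector at the origin. -/
theorem eventually_germSector_of_infSector (hk : 1 ≤ k) {θ α : ℝ} (hα : α ≤ Real.pi / k)
    {P : ℂ → Prop} (h : ∀ᶠ X in infSector (k * α), P (unchart k θ X)) :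
    ∀ᶠ z in germSector θ α, P z := by
  filter_upwards [(tendsto_chart hk hα).eventually h, eventually_unchart_chart hk hα] with z h1 h2
  rwa [h2] at h1

theorem tendsto_germSector_of_infSector (hk : 1 ≤ k) {θ α : ℝ} (hα : α ≤ Real.pi / k)
    {l : Filter ℂ} {u : ℂ → ℂ} (h : Tendsto (fun X => u (unchart k θ X)) (infSector (k * α)) l) :
    Tendsto u (germSector θ α) l := fun _ hs => eventually_germSector_of_infSector hk hα (h hs)

theorem differentiableAt_unchart (hk : 1 ≤ k) (θ : ℝ) {X : ℂ} (hX : X ≠ 0)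
    (hXa : |X.arg| < Real.pi) : DifferentiableAt ℂ (unchart k θ) X := by
  have : (k : ℂ) * X ∈ Complex.slitPlane := by
    rw [Complex.mem_slitPlane_iff_arg, arg_natCast_mul hk]
    refine ⟨fun h => ?_, mul_ne_zero (natCast_ne_zero_of_pos hk) hX⟩
    rw [h, abs_of_pos Real.pi_pos] at hXa; exact lt_irrefl _ hXa
  unfold unchart
  have h1 : DifferentiableAt ℂ (fun X : ℂ => Complex.log (k * X)) X :=
    DifferentiableAt.clog (by fun_prop) this
  fun_prop

theorem differentiableAt_chart (hk : 1 ≤ k) (θ : ℝ) {z : ℂ} (hz : z ≠ 0) :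
    DifferentiableAt ℂ (chart k θ) z := by
  unfold chart
  have : (k : ℂ) * (z * Complex.exp (-(θ * Complex.I))) ^ k ≠ 0 :=
    mul_ne_zero (natCast_ne_zero_of_pos hk) (pow_ne_zero _ (mul_ne_zero hz (Complex.exp_ne_zero _)))
  exact DifferentiableAt.inv (by fun_prop) this

/-- A map asymptotic to the identity at infinity is tangent to the identity in the variable at
the origin. -/
theorem tendsto_unchart_div (hk : 1 ≤ k) {θ θ' : ℝ} {β : ℝ} (hβ : β < Real.pi) {K : ℂ → ℂ}
    (hK : Tendsto (fun X => K X / X) (infSector β) (𝓝 1)) :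
    Tendsto (fun X => unchart k θ' (K X) / unchart k θ X) (infSector β)
      (𝓝 (Complex.exp (((θ' - θ : ℝ) : ℂ) * Complex.I))) := by
  have hk0 := natCast_ne_zero_of_pos hk
  have h1 : Tendsto (fun X => Complex.log (K X / X)) (infSector β) (𝓝 0) := by
    have : ContinuousAt Complex.log 1 := continuousAt_clog (by simp)
    have h := this.tendsto
    rw [Complex.log_one] at h
    exact h.comp hK
  have harg : Tendsto (fun X => |(K X / X).arg|) (infSector β) (𝓝 0) := by
    have := (Complex.continuous_im.tendsto 0).comp h1
    simp only [Complex.zero_im] at this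
    have := this.abs
    rw [abs_zero] at this
    simpa [Function.comp_def, Complex.log_im] using this
  have h2 : Tendsto (fun X => Complex.exp (((θ' - θ : ℝ) : ℂ) * Complex.I) *
      Complex.exp (-(Complex.log (K X / X)) / k)) (infSector β)
      (𝓝 (Complex.exp (((θ' - θ : ℝ) : ℂ) * Complex.I))) := by
    have h3 : Tendsto (fun X => Complex.exp (-(Complex.log (K X / X)) / k)) (infSector β)
        (𝓝 (Complex.exp (-0 / k))) :=
      (Complex.continuous_exp.tendsto _).comp ((h1.neg).div_const _)
    have := h3.const_mul (Complex.exp (((θ' - θ : ℝ) : ℂ) * Complex.I))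
    simpa using this
  refine h2.congr' ?_
  filter_upwards [infSector_ne_zero, eventually_infSector_arg, hK.eventually_ne one_ne_zero,
    harg.eventually (gt_mem_nhds (sub_pos.2 hβ))] with X hX hXa hne ha
  have e : (k : ℂ) * K X = (k * X) * (K X / X) := by field_simp
  have hl : Complex.log (k * K X) = Complex.log (k * X) + Complex.log (K X / X) := by
    rw [e, log_mul_of_abs_lt (mul_ne_zero hk0 hX) hne]
    rw [arg_natCast_mul hk]; linarith
  unfold unchart
  rw [hl, eq_div_iff (mul_ne_zero (Complex.exp_ne_zero _) (Complex.exp_ne_zero _)),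
    ← Complex.exp_add, ← Complex.exp_add, ← Complex.exp_add, ← Complex.exp_add]
  congr 1
  push_cast
  field_simp
  ring

end

/-! ### Expansions of prenormalized germs. -/

/-- Inverse function theorem for holomorphic germs fixing the origin. -/
theorem exists_inverse_germ {h : ℂ → ℂ} (ha : AnalyticAt ℂ h 0) (h0 : h 0 = 0)
    (h1 : deriv h 0 ≠ 0) : ∃ f : ℂ → ℂ, AnalyticAt ℂ f 0 ∧ f 0 = 0 ∧ deriv f 0 = (deriv h 0)⁻¹ ∧
      (∀ᶠ z in 𝓝 0, h (f z) = z) ∧ ∀ᶠ z in 𝓝 0, f (h z) = z := by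
  have hs := ha.hasStrictDerivAt
  have e1 := hs.eventually_right_inverse h1
  have e2 := hs.eventually_left_inverse h1
  have e3 := hs.to_localInverse h1
  have e4 := ha.analyticAt_localInverse h1
  have e5 := e2.self_of_nhds
  rw [h0] at e1 e3 e4 e5
  exact ⟨_, e4, e5, e3.hasDerivAt.deriv, e1, e2⟩

theorem exists_eq_pow_mul_of_isBigO {R : ℂ → ℂ} (hR : AnalyticAt ℂ R 0) (n : ℕ)
    (h : R =O[𝓝 0] fun z => z ^ n) :
    ∃ q : ℂ → ℂ, AnalyticAt ℂ q 0 ∧ ∀ᶠ z in 𝓝 0, R z = z ^ n * q z := by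
  induction n with
  | zero => exact ⟨R, hR, by simp⟩
  | succ n ih =>
    obtain ⟨q, hq, hqe⟩ := ih (h.trans (IsBigO.of_bound 1 (by
      filter_upwards [Metric.closedBall_mem_nhds (0:ℂ) one_pos] with z hz
      rw [mem_closedBall_zero_iff] at hz
      rw [norm_pow, norm_pow, one_mul, pow_succ]
      exact mul_le_of_le_one_right (by positivity) hz)))
    have hq0 : q 0 = 0 := by
      have h1 : q =O[𝓝[≠] 0] fun z => z := by
        have h2 : (fun z => (z ^ n)⁻¹ * R z) =O[𝓝[≠] 0] fun z : ℂ => (z ^ n)⁻¹ * z ^ (n + 1) :=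
          (isBigO_refl _ _).mul (h.mono nhdsWithin_le_nhds)
        refine h2.congr' ?_ ?_
        · filter_upwards [self_mem_nhdsWithin, hqe.filter_mono nhdsWithin_le_nhds] with z hz hz2
          have : z ≠ 0 := hz
          rw [hz2]; field_simp
        · filter_upwards [self_mem_nhdsWithin] with z hz
          have : z ≠ 0 := hz
          rw [pow_succ]; field_simp
      have h3 : Tendsto q (𝓝[≠] 0) (𝓝 0) :=
        h1.trans_tendsto (tendsto_id.mono_left nhdsWithin_le_nhds)
      exact tendsto_nhds_unique (hq.continuousAt.tendsto.mono_left nhdsWithin_le_nhds) h3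
    have : ((1 : ℕ) : ℕ∞) ≤ analyticOrderAt q 0 := by
      rw [Nat.cast_one, Order.one_le_iff_ne_zero]
      exact hq.analyticOrderAt_ne_zero.2 hq0
    obtain ⟨p, hp, hpe⟩ := (natCast_le_analyticOrderAt hq).1 this
    refine ⟨p, hp, ?_⟩
    filter_upwards [hqe, hpe] with z h1 h2
    rw [h1, h2]; simp; ring

/-- An analytic germ vanishes to an integral order, so o(z^n) already means divisibility by z^(n+1).
-/
theorem exists_eq_pow_succ_mul_of_isLittleO {R : ℂ → ℂ} (hR : AnalyticAt ℂ R 0) (n : ℕ)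
    (h : R =o[𝓝 0] fun z => z ^ n) :
    ∃ q : ℂ → ℂ, AnalyticAt ℂ q 0 ∧ ∀ᶠ z in 𝓝 0, R z = z ^ (n + 1) * q z := by
  obtain ⟨q, hq, hqe⟩ := exists_eq_pow_mul_of_isBigO hR n h.isBigO
  have h1 : Tendsto q (𝓝[≠] 0) (𝓝 0) := by
    have h2 := (h.mono (nhdsWithin_le_nhds (s := {0}ᶜ))).tendsto_div_nhds_zero
    refine h2.congr' ?_
    filter_upwards [self_mem_nhdsWithin, hqe.filter_mono nhdsWithin_le_nhds] with z hz hz2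
    have : z ≠ 0 := hz
    rw [hz2]; field_simp
  have hq0 : q 0 = 0 := tendsto_nhds_unique (hq.continuousAt.tendsto.mono_left nhdsWithin_le_nhds) h1
  obtain ⟨p, hp, hpe⟩ := exists_eq_pow_mul_of_isBigO hq 1 (by
    have := hq.differentiableAt.isBigO_sub
    simpa [hq0] using this)
  refine ⟨p, hp, ?_⟩
  filter_upwards [hqe, hpe] with z h1 h2
  rw [h1, h2]; ring

/-- The gain of a full power over o(z^(2k+1)) is what produces the exponent 1 + 1/k > 1 of the error
in the coordinate at infinity. -/
theorem IsPrenormalized.expansion {g : ℂ → ℂ} {k : ℕ} {b : ℂ} (hg : IsPrenormalized g k b) :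
    ∃ q : ℂ → ℂ, AnalyticAt ℂ q 0 ∧ ∀ᶠ z in 𝓝 0, g z = z + z ^ (k + 1) +
      (((k : ℂ) + 1) / 2 - b) * z ^ (2 * k + 1) + z ^ (2 * k + 2) * q z := by
  obtain ⟨q, hq, hqe⟩ := exists_eq_pow_succ_mul_of_isLittleO
    (hg.1.fun_sub (by fun_prop)) _ hg.2
  refine ⟨q, hq, ?_⟩
  filter_upwards [hqe] with z hz
  linear_combination hz

theorem IsPrenormalized.map_zero {g : ℂ → ℂ} {k : ℕ} {b : ℂ} (hg : IsPrenormalized g k b) :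
    g 0 = 0 := by
  obtain ⟨q, -, h⟩ := hg.expansion
  have := h.self_of_nhds
  simpa using this

theorem IsPrenormalized.tendsto_div {g : ℂ → ℂ} {k : ℕ} {b : ℂ} (hg : IsPrenormalized g k b)
    (hk : 1 ≤ k) : Tendsto (fun z => g z / z) (𝓝[≠] 0) (𝓝 1) := by
  obtain ⟨q, hq, h⟩ := hg.expansion
  have hqc := hq.continuousAt
  have h1 : ContinuousAt (fun z => 1 + z ^ k + (((k : ℂ) + 1) / 2 - b) * z ^ (2 * k) +
      z ^ (2 * k + 1) * q z) 0 := by fun_prop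
  have h2 := h1.tendsto.mono_left (nhdsWithin_le_nhds (s := {0}ᶜ))
  have hk0 : k ≠ 0 := by omega
  simp only [ne_eq, hk0, not_false_eq_true, zero_pow, add_zero, mul_zero, mul_eq_zero,
    OfNat.ofNat_ne_zero, or_self, Nat.add_eq_zero_iff, and_self, one_ne_zero,
    zero_mul] at h2
  refine h2.congr' ?_
  filter_upwards [self_mem_nhdsWithin, h.filter_mono nhdsWithin_le_nhds] with z hz hz2
  have : z ≠ 0 := hz
  rw [hz2]; field_simp; ring

theorem hasDerivAt_of_tendsto_div {g : ℂ → ℂ} {c : ℂ} (h0 : g 0 = 0)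
    (h : Tendsto (fun z => g z / z) (𝓝[≠] 0) (𝓝 c)) : HasDerivAt g c 0 := by
  rw [hasDerivAt_iff_tendsto_slope]
  refine h.congr fun z => ?_
  simp [slope_def_field, h0]

theorem tendsto_div_of_deriv {g : ℂ → ℂ} (h : DifferentiableAt ℂ g 0) (h0 : g 0 = 0) :
    Tendsto (fun z => g z / z) (𝓝[≠] 0) (𝓝 (deriv g 0)) := by
  refine (hasDerivAt_iff_tendsto_slope.1 h.hasDerivAt).congr fun z => ?_
  simp [slope_def_field, h0]

/-- The second factor is the Taylor polynomial of degree 2 of (1 + u)^(-k); the identity replaces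
the power series of a negative power by polynomial algebra. -/
theorem exists_cubic_remainder (k : ℕ) : ∃ Q : ℂ → ℂ, Continuous Q ∧ ∀ u : ℂ,
    (1 + u) ^ k * (1 - k * u + k * (k + 1) / 2 * u ^ 2) = 1 + u ^ 3 * Q u := by
  induction k with
  | zero => exact ⟨0, continuous_const, by simp⟩
  | succ k ih =>
    obtain ⟨Q, hQ, h⟩ := ih
    refine ⟨fun u => Q u + (1 + u) ^ k * ((k + 1) * (k + 2) / 2), by fun_prop, fun u => ?_⟩
    push_cast
    linear_combination h u

/-- Here g(z) = z(1 + u) with u = z^k v, and I stands for (1 + u)^(-k). The quadratic term of that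
power contributes -((k + 1)/2) z^k, which the coefficient (k + 1)/2 of the prenormal form cancels:
only -b z^k is left at that order. This is why b is normalized as it is. -/
theorem inv_pow_sub_inv_pow {k n : ℕ} (hk : k = n + 1) (hk0 : (k : ℂ) ≠ 0) {z u v p q b Q I : ℂ}
    (hz : z ≠ 0) (hp : p = ((k : ℂ) + 1) / 2 - b + z * q) (hv : v = 1 + z ^ k * p)
    (hu : u = z ^ k * v) (hI : (1 + u) ^ k * I = 1)
    (hQ : (1 + u) ^ k * (1 - k * u + k * (k + 1) / 2 * u ^ 2) = 1 + u ^ 3 * Q) :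
    ((k : ℂ) * z ^ k)⁻¹ - ((k : ℂ) * (z * (1 + u)) ^ k)⁻¹ - 1 + b * z ^ k =
      z ^ (k + 1) * (q - ((k : ℂ) + 1) / 2 * z ^ n * (p * (v + 1)) + z ^ n * v ^ 3 * Q * I / k) := by
  have e2 : I = (1 - k * u + k * (k + 1) / 2 * u ^ 2) - u ^ 3 * Q * I := by
    linear_combination (1 - k * u + k * (k + 1) / 2 * u ^ 2) * hI - I * hQ
  have hI' : ((1 + u) ^ k)⁻¹ = I := inv_eq_of_mul_eq_one_right hI
  have e3 : ((k : ℂ) * (z * (1 + u)) ^ k)⁻¹ = ((k : ℂ) * z ^ k)⁻¹ * I := by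
    rw [mul_pow, mul_inv, mul_inv, mul_inv, hI']; ring
  have hzk := pow_ne_zero k hz
  have hZ : ((k : ℂ) * z ^ k)⁻¹ * (k * z ^ k) = 1 := inv_mul_cancel₀ (mul_ne_zero hk0 hzk)
  have hkk : (k : ℂ)⁻¹ * k = 1 := inv_mul_cancel₀ hk0
  have e4 : ((k : ℂ) * z ^ k)⁻¹ - ((k : ℂ) * z ^ k)⁻¹ * I =
      v - (k + 1) / 2 * (z ^ k * v ^ 2) + (z ^ k) ^ 2 * v ^ 3 * Q * I / k := by
    have : ((k : ℂ) * z ^ k)⁻¹ - ((k : ℂ) * z ^ k)⁻¹ * I = ((k : ℂ) * z ^ k)⁻¹ * (k * u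
        - k * (k + 1) / 2 * u ^ 2 + u ^ 3 * Q * I) := by
      linear_combination (-((k : ℂ) * z ^ k)⁻¹) * e2
    rw [this, hu]
    generalize z ^ k = ζ at *
    field_simp
  have e5 : (z ^ k) ^ 2 = z ^ (k + 1) * z ^ n := by
    rw [← pow_mul, ← pow_add]; congr 1; omega
  have e7 : v ^ 2 = 1 + z ^ k * (p * (v + 1)) := by rw [hv]; ring
  have e9 : v = 1 + z ^ k * (((k : ℂ) + 1) / 2 - b) + z ^ (k + 1) * q := by
    rw [hv, hp]; ring
  rw [e3, e4, e7, e5]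
  linear_combination e9 - (k + 1) / 2 * (p * (v + 1)) * e5

/-- The expansion of a prenormalized germ in the coordinate `-1 / (k z ^ k)`. -/
theorem IsPrenormalized.inv_pow_increment {g : ℂ → ℂ} {k : ℕ} {b : ℂ}
    (hg : IsPrenormalized g k b) (hk : 1 ≤ k) :
    (fun z => ((k : ℂ) * z ^ k)⁻¹ - ((k : ℂ) * g z ^ k)⁻¹ - 1 + b * z ^ k)
      =O[𝓝[≠] 0] fun z : ℂ => z ^ (k + 1) := by
  obtain ⟨q, hq, h⟩ := hg.expansion
  obtain ⟨Q, hQ, hQe⟩ := exists_cubic_remainder k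
  obtain ⟨n, hkn⟩ : ∃ n, k = n + 1 := ⟨k - 1, by omega⟩
  have hk0 : (k : ℂ) ≠ 0 := natCast_ne_zero_of_pos hk
  let p : ℂ → ℂ := fun z => ((k : ℂ) + 1) / 2 - b + z * q z
  let v : ℂ → ℂ := fun z => 1 + z ^ k * p z
  let u : ℂ → ℂ := fun z => z ^ k * v z
  have hqc := hq.continuousAt
  have hp : ContinuousAt p 0 := by fun_prop
  have hv : ContinuousAt v 0 := by fun_prop
  have hu : ContinuousAt u 0 := by fun_prop
  have hkn' : k ≠ 0 := by omega
  have hu0 : u 0 = 0 := by simp [u, hkn']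
  have hQu : ContinuousAt (fun z => Q (u z)) 0 := hQ.continuousAt.comp hu
  have hI : ContinuousAt (fun z => ((1 + u z) ^ k)⁻¹) 0 :=
    ContinuousAt.inv₀ (by fun_prop) (by simp [hu0])
  let B : ℂ → ℂ := fun z => q z - ((k : ℂ) + 1) / 2 * z ^ n * (p z * (v z + 1)) +
    z ^ n * v z ^ 3 * Q (u z) * ((1 + u z) ^ k)⁻¹ / k
  have hB : ContinuousAt B 0 := by fun_prop
  have hBO : B =O[𝓝[≠] 0] fun _ => (1 : ℂ) := (hB.tendsto.isBigO_one ℂ).mono nhdsWithin_le_nhds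
  have h1u : ∀ᶠ z in 𝓝[≠] (0:ℂ), 1 + u z ≠ 0 := by
    have : ContinuousAt (fun z => 1 + u z) 0 := by fun_prop
    exact (this.eventually_ne (by simp [hu0])).filter_mono nhdsWithin_le_nhds
  refine ((isBigO_refl (fun z : ℂ => z ^ (k + 1)) _).mul hBO).congr' ?_ (by simp)
  filter_upwards [self_mem_nhdsWithin, h.filter_mono nhdsWithin_le_nhds, h1u] with z hz hz2 hz3
  have e1 : g z = z * (1 + u z) := by
    rw [hz2]; simp only [u, v, p]; ring
  rw [e1]
  exact (inv_pow_sub_inv_pow hkn hk0 hz rfl rfl rfl (mul_inv_cancel₀ (pow_ne_zero k hz3))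
    (hQe (u z))).symm

/-- The bisector of the `j`-th petal. -/
noncomputable abbrev direction (k : ℕ) (j : ℤ) : ℝ := j * Real.pi / k

/-- The sign of the `j`-th petal: `1` for attracting ones and `-1` for repelling ones. -/
noncomputable def petalSign (j : ℤ) : ℂ := -(-1) ^ j

theorem petalSign_mul_self (j : ℤ) : petalSign j * petalSign j = 1 := by
  unfold petalSign
  rcases Int.even_or_odd j with h | h
  · rw [h.neg_one_zpow]; norm_num
  · rw [h.neg_one_zpow]; norm_num

theorem petalSign_of_even {j : ℤ} (h : Even j) : petalSign j = -1 := by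
  rw [petalSign, h.neg_one_zpow]

theorem petalSign_of_odd {j : ℤ} (h : Odd j) : petalSign j = 1 := by
  rw [petalSign, h.neg_one_zpow, neg_neg]

theorem exp_direction_pow {k : ℕ} (hk : 1 ≤ k) (j : ℤ) :
    Complex.exp (-((direction k j : ℝ) * Complex.I)) ^ k = (-1) ^ j := by
  have hk0 := natCast_ne_zero_of_pos hk
  rw [← Complex.exp_nat_mul]
  have : (k : ℂ) * -((direction k j : ℝ) * Complex.I) = -((j : ℂ) * (Real.pi * Complex.I)) := by
    push_cast; field_simp
  rw [this, Complex.exp_neg, Complex.exp_int_mul, Complex.exp_pi_mul_I]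
  rcases Int.even_or_odd j with h | h
  · rw [h.neg_one_zpow]; norm_num
  · rw [h.neg_one_zpow]; norm_num

/-- Rotating by the bisector multiplies z^k by (-1)^j, so the charts of all petals are the single
function -1/(k z^k) up to sign. -/
theorem petalSign_mul_chart {k : ℕ} (hk : 1 ≤ k) (j : ℤ) (z : ℂ) :
    petalSign j * chart k (direction k j) z = -((k : ℂ) * z ^ k)⁻¹ := by
  unfold chart
  rw [mul_pow, exp_direction_pow hk, petalSign]
  rcases Int.even_or_odd j with h | h
  · rw [h.neg_one_zpow]; simp
  · rw [h.neg_one_zpow]; simp; 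

theorem chart_eq {k : ℕ} (hk : 1 ≤ k) (j : ℤ) (z : ℂ) :
    chart k (direction k j) z = -(petalSign j * ((k : ℂ) * z ^ k)⁻¹) := by
  rw [← mul_neg, ← petalSign_mul_chart hk, ← mul_assoc, petalSign_mul_self, one_mul]

theorem isBigO_pow_of_tendsto_div {f : ℂ → ℂ} (hf : Tendsto (fun z => f z / z) (𝓝[≠] 0) (𝓝 1)) :
    f =O[𝓝[≠] 0] fun z => z := by
  have := ((hf.isBigO_one ℂ).mul (isBigO_refl (fun z : ℂ => z) (𝓝[≠] 0)))
  refine this.congr' ?_ (by simp)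
  filter_upwards [self_mem_nhdsWithin] with z hz
  have : z ≠ 0 := hz
  field_simp

theorem eventually_ne_zero_of_tendsto_div {f : ℂ → ℂ} {c : ℂ} (hc : c ≠ 0)
    (hf : Tendsto (fun z => f z / z) (𝓝[≠] 0) (𝓝 c)) : ∀ᶠ z in 𝓝[≠] 0, f z ≠ 0 := by
  filter_upwards [hf.eventually_ne hc] with z hz h
  rw [h] at hz; simp at hz

theorem tendsto_nhdsNE_of_tendsto_div {f : ℂ → ℂ} {c : ℂ} (hc : c ≠ 0)
    (hf : Tendsto (fun z => f z / z) (𝓝[≠] 0) (𝓝 c)) : Tendsto f (𝓝[≠] 0) (𝓝[≠] 0) := by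
  refine tendsto_nhdsWithin_iff.2 ⟨?_, eventually_ne_zero_of_tendsto_div hc hf⟩
  have := hf.mul (tendsto_id.mono_left (nhdsWithin_le_nhds (a := (0:ℂ)) (s := {0}ᶜ)))
  rw [mul_zero] at this
  refine this.congr' ?_
  filter_upwards [self_mem_nhdsWithin] with z hz
  have : z ≠ 0 := hz
  simp only [id]
  field_simp

/-- On the `j`-th petal the germ, or its inverse, is a perturbation of `X ↦ X + 1`. -/
theorem IsPrenormalized.exists_attracting {g : ℂ → ℂ} {k : ℕ} {b : ℂ}
    (hg : IsPrenormalized g k b) (hk : 1 ≤ k) (j : ℤ) : ∃ f : ℂ → ℂ, AnalyticAt ℂ f 0 ∧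
      Tendsto (fun z => f z / z) (𝓝[≠] 0) (𝓝 1) ∧
      (fun z => chart k (direction k j) (f z) - chart k (direction k j) z - 1 -
        (petalSign j * b / k) / chart k (direction k j) z) =O[𝓝[≠] 0] (fun z : ℂ => z ^ (k + 1)) ∧
      (∀ (s : ℂ → ℂ) (α₁ α₂ : ℝ), α₁ < α₂ → α₂ ≤ Real.pi →
        (∀ᶠ z in germSector (direction k j) α₂, s (g z) = s z + 1) →
        ∀ᶠ z in germSector (direction k j) α₁, petalSign j * s (f z) = petalSign j * s z + 1) ∧
      (∀ (s : ℂ → ℂ) (α₁ α₂ : ℝ), α₁ < α₂ → α₂ ≤ Real.pi →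
        (∀ᶠ z in germSector (direction k j) α₂, petalSign j * s (f z) = petalSign j * s z + 1) →
        ∀ᶠ z in germSector (direction k j) α₁, s (g z) = s z + 1) := by
  have hk0 := natCast_ne_zero_of_pos hk
  have hE := hg.inv_pow_increment hk
  have hgt := hg.tendsto_div hk
  rcases Int.even_or_odd j with h | h
  -- On a repelling petal the chart reverses the sign of -1/(k z^k), and it is the inverse germ that
  -- moves it by about +1.
  · have hder := hasDerivAt_of_tendsto_div hg.map_zero hgt
    obtain ⟨f, hf, hf0, hf1, hf2, hf3⟩ := exists_inverse_germ hg.1 hg.map_zero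
      (by rw [hder.deriv]; exact one_ne_zero)
    rw [hder.deriv, inv_one] at hf1
    have hft := tendsto_div_of_deriv hf.differentiableAt hf0
    rw [hf1] at hft
    refine ⟨f, hf, hft, ?_, ?_, ?_⟩
    · have hfn := tendsto_nhdsNE_of_tendsto_div one_ne_zero hft
      have h1 := (hE.comp_tendsto hfn).trans ((isBigO_pow_of_tendsto_div hft).pow (k + 1))
      have h2 : (fun z => f z - z) =O[𝓝[≠] 0] fun z : ℂ => z ^ 2 := by
        have ho : (fun z => f z - z) =o[𝓝 0] fun z : ℂ => z ^ 1 := by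
          have := hf.differentiableAt.hasDerivAt.isLittleO
          simpa [hf0, hf1] using this
        obtain ⟨q, hq, hqe⟩ := exists_eq_pow_succ_mul_of_isLittleO (hf.fun_sub analyticAt_id) 1 ho
        have := ((isBigO_refl (fun z : ℂ => z ^ 2) (𝓝 0)).mul (hq.continuousAt.tendsto.isBigO_one ℂ))
        refine (this.congr' (hqe.mono fun z hz => hz.symm) (by simp)).mono nhdsWithin_le_nhds
      -- Substituting `f z` for z in the expansion of g produces b (f z)^k in place of b z^k; the
      -- difference has the order of the remainder.
      have h3 : (fun z => f z ^ k - z ^ k) =O[𝓝[≠] 0] fun z : ℂ => z ^ (k + 1) := by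
        have e : ∀ z, f z ^ k - z ^ k = (f z - z) * ∑ i ∈ Finset.range k, f z ^ i * z ^ (k - 1 - i) :=
          fun z => by rw [mul_comm]; exact (Commute.all (f z) z).geom_sum₂_mul k |>.symm
        simp_rw [e]
        have h4 : (fun z => ∑ i ∈ Finset.range k, f z ^ i * z ^ (k - 1 - i)) =O[𝓝[≠] 0]
            fun z : ℂ => z ^ (k - 1) := by
          refine IsBigO.fun_sum fun i hi => ?_
          have := ((isBigO_pow_of_tendsto_div hft).pow i).mul
            (isBigO_refl (fun z : ℂ => z ^ (k - 1 - i)) _)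
          refine this.congr_right fun z => ?_
          rw [← pow_add]; congr 1
          have := Finset.mem_range.1 hi
          omega
        refine (h2.mul h4).congr_right fun z => ?_
        rw [← pow_add]; congr 1; omega
      refine (h1.add (h3.const_mul_left (-b))).congr' ?_ EventuallyEq.rfl
      filter_upwards [hf2.filter_mono nhdsWithin_le_nhds, self_mem_nhdsWithin] with z hz hz0
      have hz0 : z ≠ 0 := hz0
      simp only [Function.comp, hz, chart_eq hk, petalSign_of_even h]
      field_simp
      ring
    · intro s α₁ α₂ h12 h2 hs
      rw [petalSign_of_even h]
      filter_upwards [(tendsto_germSector_of_tangent h12 h2 (hft.mono_left germSector_le)).eventually hs,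
        hf2.filter_mono germSector_le_nhds] with z h3 h4
      rw [h4] at h3; rw [h3]; ring
    · intro s α₁ α₂ h12 h2 hs
      rw [petalSign_of_even h] at hs
      filter_upwards [(tendsto_germSector_of_tangent h12 h2 (hgt.mono_left germSector_le)).eventually hs,
        hf3.filter_mono germSector_le_nhds] with z h3 h4
      rw [h4] at h3; linear_combination h3
  · refine ⟨g, hg.1, hgt, ?_, ?_, ?_⟩
    · refine hE.congr' ?_ EventuallyEq.rfl
      filter_upwards [self_mem_nhdsWithin] with z hz0
      have hz0 : z ≠ 0 := hz0
      simp only [chart_eq hk, petalSign_of_odd h]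
      field_simp
      ring
    · intro s α₁ α₂ h12 h2 hs
      rw [petalSign_of_odd h]
      simp only [one_mul]
      exact hs.filter_mono (germSector_mono h12.le)
    · intro s α₁ α₂ h12 h2 hs
      rw [petalSign_of_odd h] at hs
      simp only [one_mul] at hs
      exact hs.filter_mono (germSector_mono h12.le)

/-! ### Standard Fatou coordinates on the petals. -/

section

/-- `s` is, near `0` and on all closed subsectors of the full `j`-th petal, a Fatou coordinate
with the expansion `-1 / (k z ^ k) + b log z + D + o(1)`. -/
structure IsStandardCoordinate (g : ℂ → ℂ) (k : ℕ) (b D : ℂ) (j : ℤ) (s : ℂ → ℂ) : Prop where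
  differentiable : ∀ α < Real.pi / k, ∀ᶠ z in germSector (direction k j) α, DifferentiableAt ℂ s z
  abel : ∀ α < Real.pi / k, ∀ᶠ z in germSector (direction k j) α, s (g z) = s z + 1
  expansion : ∀ α < Real.pi / k, Tendsto (fun z => s z + ((k : ℂ) * z ^ k)⁻¹ -
    b * Complex.log (z * Complex.exp (-((direction k j : ℝ) * Complex.I))))
    (germSector (direction k j) α) (𝓝 D)

/-- A function on the `j`-th petal in the coordinate at infinity. -/
noncomputable def petalMap (k : ℕ) (j : ℤ) (s : ℂ → ℂ) (X : ℂ) : ℂ :=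
  petalSign j * s (unchart k (direction k j) X)

variable {g : ℂ → ℂ} {k : ℕ} {b D : ℂ} {j : ℤ} {s : ℂ → ℂ}

theorem petalSign_ne_zero (j : ℤ) : petalSign j ≠ 0 := fun h => by
  have := petalSign_mul_self j; rw [h] at this; simp at this

theorem div_lt_pi_div (hk : 1 ≤ k) {β : ℝ} (hβ : β < Real.pi) : β / k < Real.pi / k :=
  div_lt_div_of_pos_right hβ (by exact_mod_cast hk)

theorem mul_lt_pi (hk : 1 ≤ k) {α : ℝ} (hα : α < Real.pi / k) : k * α < Real.pi := by
  have hkr : (0:ℝ) < k := by exact_mod_cast hk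
  rw [lt_div_iff₀ hkr] at hα; linarith

theorem pi_div_le (hk : 1 ≤ k) : Real.pi / k ≤ Real.pi :=
  div_le_self Real.pi_pos.le (by exact_mod_cast hk)

theorem eventually_differentiableAt_petalMap (hk : 1 ≤ k) {β : ℝ} (hβ : β ≤ Real.pi)
    (h : ∀ᶠ z in germSector (direction k j) (β / k), DifferentiableAt ℂ s z) :
    ∀ᶠ X in infSector β, DifferentiableAt ℂ (petalMap k j s) X := by
  filter_upwards [(tendsto_unchart hk (direction k j) hβ).eventually h, infSector_ne_zero,
    eventually_infSector_arg] with X h1 h2 h3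
  exact (DifferentiableAt.comp X h1
    (differentiableAt_unchart hk _ h2 (h3.trans_le hβ))).const_mul _

theorem tendsto_log_div_infSector (hk : 1 ≤ k) {β : ℝ} :
    Tendsto (fun X : ℂ => Complex.log (k * X) / X) (infSector β) (𝓝 0) := by
  have hkr : (0:ℝ) < k := by exact_mod_cast hk
  have h0 : Tendsto (fun X : ℂ => (k:ℝ) * ‖X‖) (infSector β) atTop :=
    tendsto_norm_infSector.const_mul_atTop hkr
  have h1 : Tendsto (fun X : ℂ => |Real.log (k * ‖X‖)| / (k * ‖X‖) * k + Real.pi / ‖X‖)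
      (infSector β) (𝓝 0) := by
    have h2 := ((Real.isLittleO_log_id_atTop).tendsto_div_nhds_zero).comp h0
    have h3 := (h2.abs.mul_const (k:ℝ)).add
      ((tendsto_norm_infSector (β := β)).const_div_atTop Real.pi)
    rw [abs_zero, zero_mul, add_zero] at h3
    refine h3.congr fun X => ?_
    simp only [Function.comp, id]
    rw [abs_div, abs_of_nonneg (show (0:ℝ) ≤ k * ‖X‖ by positivity)]
  refine squeeze_zero_norm' ?_ h1
  filter_upwards [infSector_ne_zero] with X hX
  have hXp := norm_pos_iff.2 hX
  rw [norm_div, div_mul_eq_mul_div, mul_comm (k:ℝ) ‖X‖, mul_div_mul_right _ _ hkr.ne', ← add_div]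
  gcongr
  refine (Complex.norm_le_abs_re_add_abs_im _).trans ?_
  rw [Complex.log_re, Complex.log_im, norm_mul, Complex.norm_natCast, mul_comm]
  gcongr
  exact Complex.abs_arg_le_pi _

namespace IsStandardCoordinate

theorem eventually_differentiableAt_petalMap (h : IsStandardCoordinate g k b D j s) (hk : 1 ≤ k)
    {β : ℝ} (hβ : β < Real.pi) : ∀ᶠ X in infSector β, DifferentiableAt ℂ (petalMap k j s) X :=
  ParabolicGerm.eventually_differentiableAt_petalMap hk hβ.le
    (h.differentiable _ (div_lt_pi_div hk hβ))

theorem tendsto_petalMap_sub (h : IsStandardCoordinate g k b D j s) (hk : 1 ≤ k)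
    {β : ℝ} (hβ : β < Real.pi) :
    Tendsto (fun X => petalMap k j s X - X + petalSign j * b / k * Complex.log (k * X))
      (infSector β) (𝓝 (petalSign j * D)) := by
  have h1 := ((h.expansion _ (div_lt_pi_div hk hβ)).comp
    (tendsto_unchart hk (direction k j) hβ.le)).const_mul (petalSign j)
  refine h1.congr' ?_
  filter_upwards [infSector_ne_zero, eventually_infSector_arg] with X h2 h3
  have e1 := petalSign_mul_chart hk j (unchart k (direction k j) X)
  rw [chart_unchart hk _ h2] at e1
  simp only [Function.comp, petalMap]
  rw [log_unchart hk _ (h3.trans hβ), ← neg_eq_iff_eq_neg.2 e1]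
  linear_combination (-X) * petalSign_mul_self j

theorem tendsto_petalMap_div (h : IsStandardCoordinate g k b D j s) (hk : 1 ≤ k)
    {β : ℝ} (hβ : β < Real.pi) : Tendsto (fun X => petalMap k j s X / X) (infSector β) (𝓝 1) := by
  have h1 := (h.tendsto_petalMap_sub hk hβ).mul (tendsto_inv_infSector (β := β))
  have h2 := (tendsto_log_div_infSector hk (β := β)).const_mul (petalSign j * b / k)
  have h3 := (h1.sub h2).add_const 1
  simp only [mul_zero, sub_zero, zero_add] at h3
  refine h3.congr' ?_
  filter_upwards [infSector_ne_zero] with X hX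
  field_simp
  ring

end IsStandardCoordinate

/-- The dynamics on a petal in the coordinate at infinity. -/
theorem IsPrenormalized.exists_dynamics (hg : IsPrenormalized g k b) (hk : 1 ≤ k) (j : ℤ) :
    ∃ H : ℂ → ℂ,
      (∀ β < Real.pi, ∀ᶠ X in infSector β, DifferentiableAt ℂ H X) ∧
      (∀ β < Real.pi, Tendsto (fun X => H X / X) (infSector β) (𝓝 1)) ∧
      (∀ β < Real.pi, (fun X => H X - X - 1 - (petalSign j * b / k) / X) =O[infSector β]
        fun X => ‖X‖ ^ (-(1 + 1 / k) : ℝ)) ∧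
      (∀ (s : ℂ → ℂ) (β₁ β₂ : ℝ), β₁ < β₂ → β₂ ≤ Real.pi →
        (∀ᶠ z in germSector (direction k j) (β₂ / k), s (g z) = s z + 1) →
        ∀ᶠ X in infSector β₁, petalMap k j s (H X) = petalMap k j s X + 1) ∧
      (∀ (Φ : ℂ → ℂ) (α : ℝ), α < Real.pi / k →
        (∀ β < Real.pi, ∀ᶠ X in infSector β, Φ (H X) = Φ X + 1) →
        ∀ c : ℂ, ∀ᶠ z in germSector (direction k j) α,
          petalSign j * (Φ (chart k (direction k j) (g z)) - c) =
            petalSign j * (Φ (chart k (direction k j) z) - c) + 1) := by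
  have hk0 := natCast_ne_zero_of_pos hk
  have hkr : (0:ℝ) < k := by exact_mod_cast hk
  obtain ⟨f, hf, hft, hE, h1, h2⟩ := hg.exists_attracting hk j
  set θ := direction k j with hθ
  have hu : ∀ β ≤ Real.pi, Tendsto (unchart k θ) (infSector β) (germSector θ (β / k)) :=
    fun β hβ => tendsto_unchart hk θ hβ
  have hfd : ∀ᶠ z in 𝓝 (0:ℂ), DifferentiableAt ℂ f z :=
    Complex.analyticAt_iff_eventually_differentiableAt.1 hf
  have hfne := eventually_ne_zero_of_tendsto_div one_ne_zero hft
  have hO : ∀ β < Real.pi, (fun X => chart k θ (f (unchart k θ X)) - X - 1 -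
      (petalSign j * b / k) / X) =O[infSector β] fun X => ‖X‖ ^ (-(1 + 1 / k) : ℝ) := by
    intro β hβ
    have h3 := hE.comp_tendsto ((hu β hβ.le).mono_right germSector_le)
    refine (h3.congr' ?_ EventuallyEq.rfl).trans ?_
    · filter_upwards [infSector_ne_zero] with X hX
      simp only [Function.comp, chart_unchart hk θ hX]
    -- With |z| = (k|X|)^(-1/k), the remainder z^(k+1) has modulus (k|X|)^(-(1 + 1/k)).
    · refine IsBigO.of_bound ((k : ℝ) ^ (-(1 + 1 / k) : ℝ)) ?_
      filter_upwards [infSector_ne_zero] with X hX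
      have hXp := norm_pos_iff.2 hX
      simp only [Function.comp]
      rw [norm_pow, norm_unchart hk θ hX, Real.norm_of_nonneg (by positivity),
        ← Real.rpow_natCast, ← Real.rpow_mul (by positivity), ← Real.mul_rpow hkr.le hXp.le]
      refine le_of_eq ?_
      congr 1
      push_cast
      field_simp
  have hHt : ∀ β < Real.pi, Tendsto (fun X => chart k θ (f (unchart k θ X)) / X)
      (infSector β) (𝓝 1) := by
    intro β hβ
    have h3 := (hO β hβ).trans_tendsto (tendsto_norm_rpow_infSector (by positivity))
    have h4 := (((h3.add_const 1).add
      ((tendsto_inv_infSector (β := β)).const_mul (petalSign j * b / k))).mul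
      (tendsto_inv_infSector (β := β))).add_const 1
    simp only [mul_zero, zero_add] at h4
    refine h4.congr' ?_
    filter_upwards [infSector_ne_zero] with X hX
    rw [div_eq_mul_inv _ X, div_eq_mul_inv _ X]
    field_simp
    ring
  have hun : ∀ β < Real.pi, ∀ᶠ X in infSector β,
      unchart k θ (chart k θ (f (unchart k θ X))) = f (unchart k θ X) := by
    intro β hβ
    have h3 : Tendsto f (germSector θ (β / k)) (germSector θ (Real.pi / k)) :=
      tendsto_germSector_of_tangent (div_lt_pi_div hk hβ) (pi_div_le hk) (hft.mono_left germSector_le)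
    exact (h3.comp (hu β hβ.le)).eventually (eventually_unchart_chart hk le_rfl)
  refine ⟨fun X => chart k θ (f (unchart k θ X)), ?_, hHt, hO, ?_, ?_⟩
  · intro β hβ
    filter_upwards [infSector_ne_zero, eventually_infSector_arg,
      ((hu β hβ.le).mono_right germSector_le_nhds).eventually hfd,
      ((hu β hβ.le).mono_right germSector_le).eventually hfne] with X h3 h4 h5 h6
    exact DifferentiableAt.comp (g := chart k θ) (f := f ∘ unchart k θ) X
      (differentiableAt_chart hk θ h6)
      (DifferentiableAt.comp X h5 (differentiableAt_unchart hk θ h3 (h4.trans hβ)))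
  · intro s β₁ β₂ h12 hβ₂ hs
    have h3 := h1 s (β₁ / k) (β₂ / k) (div_lt_div_of_pos_right h12 hkr)
      ((div_le_div_of_nonneg_right hβ₂ hkr.le).trans (pi_div_le hk)) hs
    filter_upwards [(hu β₁ (by linarith)).eventually h3, hun β₁ (by linarith)] with X h4 h5
    simp only [petalMap]
    rw [← hθ, h5, h4]
  · intro Φ α hα hΦ c
    obtain ⟨α₂, ha1, ha2⟩ := exists_between hα
    refine h2 (fun z => petalSign j * (Φ (chart k θ z) - c)) α α₂ ha1 (ha2.le.trans (pi_div_le hk)) ?_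
    refine eventually_germSector_of_infSector hk ha2.le ?_
    filter_upwards [hΦ _ (mul_lt_pi hk ha2), infSector_ne_zero] with X h3 h4
    rw [h3, chart_unchart hk θ h4, ← mul_assoc, ← mul_assoc, petalSign_mul_self]
    ring

/-- Existence of standard Fatou coordinates. -/
theorem IsPrenormalized.exists_isStandardCoordinate (hg : IsPrenormalized g k b) (hk : 1 ≤ k)
    (j : ℤ) : ∃ s, IsStandardCoordinate g k b 0 j s := by
  have hk0 := natCast_ne_zero_of_pos hk
  have hkr : (0:ℝ) < k := by exact_mod_cast hk
  obtain ⟨H, hd, -, hO, -, h2⟩ := hg.exists_dynamics hk j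
  set a := petalSign j * b / k with ha
  obtain ⟨Φ, hΦ⟩ := exists_fatou (δ := 1 / k) (by positivity)
    (by rw [div_le_one hkr]; exact_mod_cast hk) hd hO
  -- `exists_fatou` expands in log X, whereas k log w = -log(kX) for the rotated variable w;
  -- subtracting a log k accounts for the difference and makes D = 0.
  refine ⟨fun z => petalSign j * (Φ (chart k (direction k j) z) - a * Complex.log k), ?_, ?_, ?_⟩
  · intro α hα
    filter_upwards [(tendsto_chart hk hα.le).eventually (hΦ _ (mul_lt_pi hk hα)).1,
      germSector_ne_zero] with z h3 h4
    exact ((DifferentiableAt.comp z h3.1 (differentiableAt_chart hk _ h4)).sub_const _).const_mul _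
  · intro α hα
    exact h2 Φ α hα (fun β hβ => (hΦ β hβ).1.mono fun X hX => hX.2) _
  · intro α hα
    have h3 := (((hΦ _ (mul_lt_pi hk hα)).2.comp (tendsto_chart hk (θ := direction k j) hα.le))).const_mul
      (petalSign j)
    rw [mul_zero] at h3
    refine h3.congr' ?_
    filter_upwards [germSector_ne_zero, germSector_relArg] with z h4 h5
    have e1 := log_natCast_mul_chart hk hα.le h4 h5
    have e2 : chart k (direction k j) z ≠ 0 := by
      unfold chart
      exact inv_ne_zero (mul_ne_zero hk0 (pow_ne_zero _ (mul_ne_zero h4 (Complex.exp_ne_zero _))))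
    have e3 : Complex.log (k * chart k (direction k j) z) =
        Complex.log k + Complex.log (chart k (direction k j) z) := by
      have := Complex.log_ofReal_mul hkr e2
      rw [Complex.ofReal_natCast] at this
      rw [this, Complex.ofReal_log hkr.le, Complex.ofReal_natCast]
    have e4 := petalSign_mul_chart hk j z
    have e5 := petalSign_mul_self j
    have e6 : a * k = petalSign j * b := by rw [ha]; field_simp
    simp only [Function.comp]
    rw [e3] at e1
    generalize Complex.log (z * Complex.exp (-((direction k j : ℝ) * Complex.I))) = L at *
    have e7 : Complex.log (chart k (direction k j) z) = -(k * L) - Complex.log k := by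
      linear_combination e1
    rw [e7]
    linear_combination -e4 - petalSign j * L * e6 - b * L * e5

/-- Uniqueness of Fatou coordinates on a petal. -/
theorem IsStandardCoordinate.exists_eq_add (h : IsStandardCoordinate g k b D j s)
    (hg : IsPrenormalized g k b) (hk : 1 ≤ k) {φ : ℂ → ℂ} {α α' : ℝ} (h0 : 0 < α) (hα' : α' < α)
    (hα : α < Real.pi / k)
    (hd : ∀ᶠ z in germSector (direction k j) α, DifferentiableAt ℂ φ z)
    (ha : ∀ᶠ z in germSector (direction k j) α, φ (g z) = φ z + 1)
    (hi : ∃ ρ : ℝ, 0 < ρ ∧ Set.InjOn φ (sector (direction k j) α ρ)) :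
    ∃ C, ∀ᶠ z in germSector (direction k j) α', φ z = s z + C := by
  have hkr : (0:ℝ) < k := by exact_mod_cast hk
  have hk0' := hkr.ne'
  obtain ⟨H, -, hHt, -, hA, -⟩ := hg.exists_dynamics hk j
  obtain ⟨α₁, ha1, ha2⟩ := exists_between (max_lt hα' h0)
  have ha0 : 0 < α₁ := (le_max_right _ _).trans_lt ha1
  have ha1 : α' < α₁ := (le_max_left _ _).trans_lt ha1
  have hb1 : k * α' < k * α₁ := mul_lt_mul_of_pos_left ha1 hkr
  have hb2 : k * α₁ < k * α := mul_lt_mul_of_pos_left ha2 hkr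
  have hb3 : k * α < Real.pi := mul_lt_pi hk hα
  have hd' : k * α / k = α := by field_simp
  have hu := tendsto_unchart hk (direction k j) hb3.le
  rw [hd'] at hu
  obtain ⟨ρ, hρ, hi⟩ := hi
  obtain ⟨C, hC⟩ := exists_eq_add_of_abel (mul_pos hkr ha0) hb1 (hb2.trans hb3).le
    (hHt _ (hb2.trans hb3))
    (h.eventually_differentiableAt_petalMap hk (hb2.trans hb3))
    (h.tendsto_petalMap_div hk (hb2.trans hb3))
    (hA s _ _ hb2 hb3.le (by rw [hd']; exact h.abel α hα))
    (φ := petalMap k j φ)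
    ((ParabolicGerm.eventually_differentiableAt_petalMap hk hb3.le (by rwa [hd'])).filter_mono
      (infSector_mono hb2.le)) (by
      have h1 : ∀ᶠ X in infSector (k * α), unchart k (direction k j) X ∈ sector (direction k j) α ρ :=
        hu.eventually (eventually_germSector.2 ⟨ρ, hρ, fun z hz => hz⟩)
      obtain ⟨R, hR, h2⟩ := eventually_infSector.1 (h1.and infSector_ne_zero)
      refine ⟨R, fun X hX Y hY hXY => ?_⟩
      have h3 := h2 X hX.1 (hX.2.trans hb2)
      have h4 := h2 Y hY.1 (hY.2.trans hb2)
      have h5 := hi h3.1 h4.1 (mul_left_cancel₀ (petalSign_ne_zero j) hXY)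
      rw [← chart_unchart hk (direction k j) h3.2, h5, chart_unchart hk _ h4.2])
    (hA φ _ _ hb2 hb3.le (by rwa [hd']))
  refine ⟨petalSign j * C, ?_⟩
  refine eventually_germSector_of_infSector hk ((ha1.trans ha2).trans hα).le ?_
  filter_upwards [hC] with X hX
  simp only [petalMap] at hX
  linear_combination petalSign j * hX - (φ (unchart k (direction k j) X) -
    s (unchart k (direction k j) X)) * petalSign_mul_self j

/-- Standard coordinates are injective near the origin. -/
theorem exists_injOn_of_petalMap (hk : 1 ≤ k) {α α' : ℝ} (hα' : α' < α)
    (hα : α ≤ Real.pi / k) (hd : ∀ᶠ X in infSector (k * α), DifferentiableAt ℂ (petalMap k j s) X)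
    (ht : Tendsto (fun X => petalMap k j s X / X) (infSector (k * α)) (𝓝 1)) :
    ∃ ρ : ℝ, 0 < ρ ∧ Set.InjOn s (sector (direction k j) α' ρ) := by
  have hkr : (0:ℝ) < k := by exact_mod_cast hk
  have hka : k * α ≤ Real.pi := by rw [le_div_iff₀ hkr] at hα; linarith
  obtain ⟨R, hR, hi⟩ := exists_injOn (mul_lt_mul_of_pos_left hα' hkr) hka hd ht
  have h1 : ∀ᶠ X in infSector (k * α'), X ∈ {X : ℂ | R ≤ ‖X‖ ∧ |X.arg| < k * α'} :=
    (tendsto_norm_infSector.eventually_ge_atTop R).and eventually_infSector_arg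
  obtain ⟨ρ, hρ, h2⟩ := eventually_germSector.1
    (((tendsto_chart hk (θ := direction k j) (hα'.le.trans hα)).eventually h1).and
      (eventually_unchart_chart hk (hα'.le.trans hα)))
  refine ⟨ρ, hρ, fun z hz w hw hzw => ?_⟩
  obtain ⟨h3, h4⟩ := h2 z hz
  obtain ⟨h5, h6⟩ := h2 w hw
  rw [← h4, ← h6, hi h3 h5 (by simp only [petalMap, h4, h6, hzw])]

theorem IsStandardCoordinate.exists_injOn (h : IsStandardCoordinate g k b D j s) (hk : 1 ≤ k)
    {α : ℝ} (hα : α < Real.pi / k) :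
    ∃ ρ : ℝ, 0 < ρ ∧ Set.InjOn s (sector (direction k j) α ρ) := by
  obtain ⟨α₁, h1, h2⟩ := exists_between hα
  have hb := mul_lt_pi hk h2
  exact exists_injOn_of_petalMap hk h1 h2.le (h.eventually_differentiableAt_petalMap hk hb)
    (h.tendsto_petalMap_div hk hb)

theorem IsStandardCoordinate.add_const (h : IsStandardCoordinate g k b D j s) (C : ℂ) :
    IsStandardCoordinate g k b (D + C) j (fun z => s z + C) where
  differentiable α hα := (h.differentiable α hα).mono fun z hz => hz.add_const C
  abel α hα := (h.abel α hα).mono fun z hz => by rw [hz]; ring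
  expansion α hα := ((h.expansion α hα).add_const C).congr fun z => by ring

end

/-! ### Positions, middle sectors between petals, and ends of the plane. -/

section

/-- The bisector of the intersection of the petals `p - 1` and `p`. -/
noncomputable abbrev midDirection (k : ℕ) (p : ℤ) : ℝ := (2 * p - 1) * Real.pi / (2 * k)

/-- The repelling one among the petals `p - 1` and `p`. -/
def source (p : ℤ) : ℤ := if Odd p then p - 1 else p

/-- The attracting one among the petals `p - 1` and `p`. -/
def target (p : ℤ) : ℤ := if Odd p then p else p - 1

/-- The sign of `petalSign` as a real number. -/
noncomputable def endSign (p : ℤ) : ℝ := if Odd p then 1 else -1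

theorem petalSign_eq (p : ℤ) : petalSign p = (endSign p : ℝ) := by
  unfold endSign
  split_ifs with h
  · rw [petalSign_of_odd h]; simp
  · rw [petalSign_of_even (Int.not_odd_iff_even.1 h)]; simp

theorem endSign_mul_self (p : ℤ) : endSign p * endSign p = 1 := by
  unfold endSign; split_ifs <;> norm_num

theorem endSign_add_even (p m : ℤ) : endSign (p + 2 * m) = endSign p := by
  unfold endSign
  have : Odd (p + 2 * m) ↔ Odd p := by
    rw [Int.odd_add]; simp
  simp [this]

theorem source_add_even (p m : ℤ) : source (p + 2 * m) = source p + 2 * m := by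
  unfold source
  have : Odd (p + 2 * m) ↔ Odd p := by
    rw [Int.odd_add]; simp
  simp only [this]; split_ifs <;> ring

theorem target_add_even (p m : ℤ) : target (p + 2 * m) = target p + 2 * m := by
  unfold target
  have : Odd (p + 2 * m) ↔ Odd p := by
    rw [Int.odd_add]; simp
  simp only [this]; split_ifs <;> ring

theorem source_eq_or (p : ℤ) : source p = p ∨ source p = p - 1 := by
  unfold source; split_ifs <;> simp

theorem target_eq_or (p : ℤ) : target p = p ∨ target p = p - 1 := by
  unfold target; split_ifs <;> simp

/-- The end of the plane where the transition function in position `p` is defined. -/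
noncomputable def planeEnd (p : ℤ) : Filter ℂ := comap (fun W => endSign p * W.im) atTop

theorem eventually_planeEnd {p : ℤ} {P : ℂ → Prop} :
    (∀ᶠ W in planeEnd p, P W) ↔ ∃ M : ℝ, ∀ W : ℂ, M ≤ endSign p * W.im → P W := by
  unfold planeEnd
  rw [(atTop_basis.comap _).eventually_iff]
  simp

/-- A negative index has a position of the opposite parity, so the distinction by sign and parity in
`farEnd` and `constantTerm` is one by parity of the position alone. -/
theorem position_odd_iff (k : ℕ) (j : ℤ) :
    (0 < j ↔ Odd j) ↔ Odd (position k j) := by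
  unfold position
  by_cases h : 0 < j
  · simp [h]
  · have : Odd (j + 2 * (k : ℤ) + 1) ↔ ¬ Odd j := by
      rw [Int.not_odd_iff_even]
      exact ⟨fun ⟨a, ha⟩ => ⟨a - k, by omega⟩, fun ⟨a, ha⟩ => ⟨a + k, by omega⟩⟩
    simp [h, this]

theorem farEnd_eq_planeEnd (k : ℕ) (j : ℤ) : farEnd j = planeEnd (position k j) := by
  unfold farEnd planeEnd endSign
  simp only [position_odd_iff k j]
  split_ifs
  · simp
  · simp only [neg_one_mul]
    rw [show (fun W : ℂ => -W.im) = Neg.neg ∘ Complex.im from rfl, ← comap_comap, comap_neg_atTop]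

theorem constantTerm_eq (k : ℕ) (j : ℤ) (b : ℂ) :
    constantTerm k b j = -((endSign (position k j) : ℝ) * (Complex.I * Real.pi * b / k)) := by
  unfold constantTerm endSign
  simp only [position_odd_iff k j]
  split_ifs <;> simp

theorem exp_neg_add_int_mul (θ : ℝ) (n : ℤ) :
    Complex.exp (-(((θ + n * (2 * Real.pi) : ℝ) : ℂ) * Complex.I)) =
      Complex.exp (-(θ * Complex.I)) := by
  rw [Complex.exp_eq_exp_iff_exists_int]
  exact ⟨-n, by push_cast; ring⟩

theorem sector_add_int_mul (θ α r : ℝ) (n : ℤ) :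
    sector (θ + n * (2 * Real.pi)) α r = sector θ α r := by
  unfold sector
  simp only [exp_neg_add_int_mul]

theorem germSector_add_int_mul (θ α : ℝ) (n : ℤ) :
    germSector (θ + n * (2 * Real.pi)) α = germSector θ α := by
  unfold germSector
  rw [sector_add_int_mul]

variable {g : ℂ → ℂ} {k : ℕ} {b D : ℂ}

theorem direction_add_period (hk : 1 ≤ k) (j n : ℤ) :
    direction k (j + 2 * k * n) = direction k j + n * (2 * Real.pi) := by
  have hkr : (k:ℝ) ≠ 0 := by positivity
  unfold direction
  push_cast
  field_simp

theorem midDirection_add_period (hk : 1 ≤ k) (p n : ℤ) :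
    midDirection k (p + 2 * k * n) = midDirection k p + n * (2 * Real.pi) := by
  have hkr : (k:ℝ) ≠ 0 := by positivity
  unfold midDirection
  push_cast
  field_simp
  ring

/-- The logarithm in the expansion is taken relative to the bisector, so a full turn does not change
it. The price is that the branches on adjacent petals do not continue each other, and their
discrepancy is the constant term of the transition functions. -/
theorem IsStandardCoordinate.of_period {s : ℂ → ℂ} {j : ℤ} (hk : 1 ≤ k) (n : ℤ)
    (h : IsStandardCoordinate g k b D j s) : IsStandardCoordinate g k b D (j + 2 * k * n) s := by
  have e : ∀ α, germSector (direction k (j + 2 * k * n)) α = germSector (direction k j) α := fun α => by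
    rw [direction_add_period hk, germSector_add_int_mul]
  refine ⟨fun α hα => ?_, fun α hα => ?_, fun α hα => ?_⟩
  · rw [e]; exact h.differentiable α hα
  · rw [e]; exact h.abel α hα
  · rw [e, direction_add_period hk]
    simp only [exp_neg_add_int_mul]
    exact h.expansion α hα

/-- A compatible choice of standard Fatou coordinates on all petals. -/
structure IsStandardFamily (g : ℂ → ℂ) (k : ℕ) (b D : ℂ) (s : ℤ → ℂ → ℂ) : Prop where
  coord : ∀ j, IsStandardCoordinate g k b D j (s j)
  periodic : ∀ j n : ℤ, s (j + 2 * k * n) = s j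

theorem IsPrenormalized.exists_isStandardFamily (hg : IsPrenormalized g k b) (hk : 1 ≤ k) :
    ∃ s, IsStandardFamily g k b 0 s := by
  choose s hs using hg.exists_isStandardCoordinate hk
  refine ⟨fun j => s (j % (2 * k)), fun j => ?_, fun j n => ?_⟩
  · have := (hs (j % (2 * k))).of_period hk (j / (2 * k))
    rwa [show j % (2 * (k:ℤ)) + 2 * k * (j / (2 * k)) = j from Int.emod_add_mul_ediv j (2 * k)] at this
  · simp only [Int.add_mul_emod_self_left]

theorem IsStandardFamily.add_const {s : ℤ → ℂ → ℂ} (h : IsStandardFamily g k b D s) (C : ℂ) :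
    IsStandardFamily g k b (D + C) (fun j z => s j z + C) :=
  ⟨fun j => (h.coord j).add_const C, fun j n => by simp only [h.periodic]⟩

theorem direction_eq_mid_sub (hk : 1 ≤ k) (p : ℤ) :
    direction k (p - 1) = midDirection k p + -(Real.pi / (2 * k)) := by
  have hkr : (k:ℝ) ≠ 0 := by positivity
  unfold midDirection direction
  push_cast
  field_simp
  ring

theorem direction_eq_mid_add (hk : 1 ≤ k) (p : ℤ) :
    direction k p = midDirection k p + Real.pi / (2 * k) := by
  have hkr : (k:ℝ) ≠ 0 := by positivity
  unfold midDirection direction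
  field_simp
  ring

theorem log_rotate {θ t δ : ℝ} (h : δ + |t| ≤ Real.pi) {z : ℂ} (hz : z ≠ 0)
    (hza : |relArg θ z| < δ) :
    Complex.log (z * Complex.exp (-(((θ + t : ℝ) : ℂ) * Complex.I))) =
      Complex.log (z * Complex.exp (-(θ * Complex.I))) - t * Complex.I := by
  have h1 : |t| < Real.pi := by linarith [abs_nonneg (relArg θ z)]
  have h2 := abs_lt.1 h1
  have e : z * Complex.exp (-(((θ + t : ℝ) : ℂ) * Complex.I)) =
      (z * Complex.exp (-(θ * Complex.I))) * Complex.exp (-(t * Complex.I)) := by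
    rw [show -(((θ + t : ℝ) : ℂ) * Complex.I) = -(θ * Complex.I) + -(t * Complex.I) by
      push_cast; ring, Complex.exp_add, mul_assoc]
  have h3 : Complex.log (Complex.exp (-(t * Complex.I))) = -(t * Complex.I) :=
    Complex.log_exp (by simp; linarith) (by simp; linarith)
  have h4 : (Complex.exp (-(t * Complex.I))).arg = -t := by
    rw [← Complex.log_im, h3]; simp
  rw [e, log_mul_of_abs_lt (mul_ne_zero hz (Complex.exp_ne_zero _)) (Complex.exp_ne_zero _), h3]
  · ring
  · rw [h4, abs_neg]; unfold relArg at hza; linarith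

theorem germSector_le_rotate {θ t δ α : ℝ} (h : δ + |t| ≤ α) (hα : α ≤ Real.pi) :
    germSector θ δ ≤ germSector (θ + t) α := by
  have : Tendsto id (germSector θ δ) (germSector (θ + t) α) := by
    refine tendsto_germSector_iff.2 ⟨germSector_le_nhds, ?_⟩
    filter_upwards [germSector_ne_zero, germSector_relArg] with z h1 h2
    refine ⟨h1, ?_⟩
    have := congrArg Complex.im (log_rotate (h.trans hα) h1 h2)
    rw [Complex.log_im] at this
    unfold relArg at h2 ⊢
    rw [id, this, Complex.sub_im, Complex.log_im]
    simp only [Complex.mul_im, Complex.ofReal_re, Complex.I_im, mul_one, Complex.ofReal_im,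
      Complex.I_re, mul_zero, add_zero]
    exact (abs_sub _ _).trans_lt (by linarith)
  exact this

theorem abs_pi_div_two_mul (k : ℕ) : |Real.pi / (2 * k)| = Real.pi / (2 * k) :=
  abs_of_nonneg (by positivity)

theorem pi_div_two_mul_add (hk : 1 ≤ k) : Real.pi / (2 * k) + Real.pi / (2 * k) = Real.pi / k := by
  have hkr : (k:ℝ) ≠ 0 := by positivity
  field_simp; ring

/-- The middle sector `p` lies in the petals `p` and `p - 1`. -/
theorem germSector_mid_le (hk : 1 ≤ k) {p i : ℤ} (hi : i = p ∨ i = p - 1) {δ α : ℝ}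
    (h : δ + Real.pi / (2 * k) ≤ α) (hα : α ≤ Real.pi / k) :
    germSector (midDirection k p) δ ≤ germSector (direction k i) α := by
  rcases hi with rfl | rfl
  · rw [direction_eq_mid_add hk]
    exact germSector_le_rotate (by rwa [abs_pi_div_two_mul]) (hα.trans (pi_div_le hk))
  · rw [direction_eq_mid_sub hk]
    exact germSector_le_rotate (by rwa [abs_neg, abs_pi_div_two_mul]) (hα.trans (pi_div_le hk))

/-- The logarithm is negligible against z^(-k). This leading term no longer refers to the bisector,
so it can be used on middle sectors and after a conjugacy. -/
theorem IsStandardCoordinate.tendsto_mul {s : ℂ → ℂ} {j : ℤ}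
    (h : IsStandardCoordinate g k b D j s) (hk : 1 ≤ k) {α : ℝ} (hα : α < Real.pi / k) :
    Tendsto (fun z => s z * (k * z ^ k)) (germSector (direction k j) α) (𝓝 (-1)) := by
  refine tendsto_germSector_of_infSector hk hα.le ?_
  have := (h.tendsto_petalMap_div hk (mul_lt_pi hk hα)).neg
  refine this.congr' ?_
  filter_upwards [infSector_ne_zero] with X hX
  have e := petalSign_mul_chart hk j (unchart k (direction k j) X)
  rw [chart_unchart hk _ hX] at e
  have e2 : (k * unchart k (direction k j) X ^ k : ℂ) = -(petalSign j * X)⁻¹ := by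
    rw [e, neg_inv, neg_neg, inv_inv]
  rw [e2, petalMap, mul_inv]
  have : (petalSign j)⁻¹ = petalSign j := inv_eq_of_mul_eq_one_right (petalSign_mul_self j)
  rw [this]
  field_simp

theorem exp_midDirection_pow (hk : 1 ≤ k) (p : ℤ) :
    Complex.exp (-((midDirection k p : ℝ) * Complex.I)) ^ k = -(petalSign p * Complex.I) := by
  have hk0 := natCast_ne_zero_of_pos hk
  rw [← Complex.exp_nat_mul]
  have : (k : ℂ) * -((midDirection k p : ℝ) * Complex.I) =
      -((p : ℂ) * (Real.pi * Complex.I)) + Real.pi / 2 * Complex.I := by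
    push_cast; field_simp; ring
  rw [this, Complex.exp_add, Complex.exp_neg, Complex.exp_int_mul, Complex.exp_pi_mul_I,
    Complex.exp_pi_div_two_mul_I, petalSign]
  rcases Int.even_or_odd p with h | h
  · rw [h.neg_one_zpow]; norm_num
  · rw [h.neg_one_zpow]; norm_num

/-- A Fatou coordinate on the middle sector `p`, turned so that it is asymptotic to `X`. -/
noncomputable def midMap (k : ℕ) (p : ℤ) (s : ℂ → ℂ) (X : ℂ) : ℂ :=
  -(petalSign p * Complex.I) * s (unchart k (midDirection k p) X)

theorem midMap_spec (p : ℤ) (s : ℂ → ℂ) (X : ℂ) :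
    s (unchart k (midDirection k p) X) = petalSign p * Complex.I * midMap k p s X := by
  unfold midMap
  linear_combination (s (unchart k (midDirection k p) X)) *
    (Complex.I * Complex.I * petalSign_mul_self p + Complex.I_mul_I)

theorem mul_div_natCast (hk : 1 ≤ k) (x : ℝ) : k * (x / k) = x := by
  have hkr : (k:ℝ) ≠ 0 := by positivity
  field_simp

theorem div_add_lt_pi_div (hk : 1 ≤ k) {β : ℝ} (hβ : β < Real.pi / 2) :
    β / k + Real.pi / (2 * k) < Real.pi / k := by
  have hkr : (0:ℝ) < k := by exact_mod_cast hk
  rw [← pi_div_two_mul_add hk, show Real.pi / (2 * k) = (Real.pi / 2) / k by field_simp]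
  gcongr

theorem IsStandardCoordinate.eventually_differentiableAt_midMap {s : ℂ → ℂ} {i p : ℤ}
    (h : IsStandardCoordinate g k b D i s) (hk : 1 ≤ k) (hi : i = p ∨ i = p - 1)
    {β : ℝ} (hβ : β < Real.pi / 2) :
    ∀ᶠ X in infSector β, DifferentiableAt ℂ (midMap k p s) X := by
  have hβ' : β < Real.pi := by linarith [Real.pi_pos]
  have hle := germSector_mid_le hk hi (le_refl (β / k + Real.pi / (2 * k)))
    (div_add_lt_pi_div hk hβ).le
  filter_upwards [((tendsto_unchart hk (midDirection k p) hβ'.le).mono_right hle).eventually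
    (h.differentiable _ (div_add_lt_pi_div hk hβ)), infSector_ne_zero,
    eventually_infSector_arg] with X h1 h2 h3
  exact (DifferentiableAt.comp X h1
    (differentiableAt_unchart hk _ h2 (h3.trans hβ'))).const_mul _

theorem IsStandardCoordinate.tendsto_midMap_div {s : ℂ → ℂ} {i p : ℤ}
    (h : IsStandardCoordinate g k b D i s) (hk : 1 ≤ k) (hi : i = p ∨ i = p - 1)
    {β : ℝ} (hβ : β < Real.pi / 2) :
    Tendsto (fun X => midMap k p s X / X) (infSector β) (𝓝 1) := by
  have hβ' : β < Real.pi := by linarith [Real.pi_pos]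
  have hle := germSector_mid_le hk hi (le_refl (β / k + Real.pi / (2 * k)))
    (div_add_lt_pi_div hk hβ).le
  have h1 := ((h.tendsto_mul hk (div_add_lt_pi_div hk hβ)).comp
    ((tendsto_unchart hk (midDirection k p) hβ'.le).mono_right hle)).neg
  rw [neg_neg] at h1
  refine h1.congr' ?_
  filter_upwards [infSector_ne_zero] with X hX
  have e := chart_unchart hk (midDirection k p) hX
  set z := unchart k (midDirection k p) X with hz
  unfold chart at e
  rw [mul_pow, exp_midDirection_pow hk, inv_eq_iff_eq_inv] at e
  simp only [Function.comp, midMap, ← hz]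
  rw [div_eq_mul_inv _ X, ← e]
  linear_combination (-(s z * (k * z ^ k))) *
    (Complex.I * Complex.I * petalSign_mul_self p + Complex.I_mul_I)

theorem tendsto_re_infSector {β : ℝ} (hβ : β < Real.pi / 2) :
    Tendsto Complex.re (infSector β) atTop := by
  have hpi := Real.pi_pos
  set β' := max β (Real.pi / 4) with hβ'
  have h1 : β' < Real.pi / 2 := max_lt hβ (by linarith)
  have h2 : 0 < β' := lt_of_lt_of_le (by linarith) (le_max_right _ _)
  have hc : 0 < Real.cos β' := Real.cos_pos_of_mem_Ioo ⟨by linarith, h1⟩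
  refine tendsto_atTop_mono' _ ?_ (tendsto_norm_infSector.const_mul_atTop hc)
  filter_upwards [infSector_ne_zero, eventually_infSector_arg] with X h3 h4
  exact ((abs_arg_lt_iff h3 h2.le (by linarith)).1 (h4.trans_le (le_max_left _ _))).le

theorem endSign_mul_im (p : ℤ) (W : ℂ) :
    endSign p * (petalSign p * Complex.I * W).im = W.re := by
  rw [petalSign_eq, mul_assoc, Complex.im_ofReal_mul, ← mul_assoc, endSign_mul_self]
  simp

/-- Fatou coordinates map the middle sector to the corresponding end of the plane. -/
theorem IsStandardCoordinate.tendsto_planeEnd {s : ℂ → ℂ} {i p : ℤ}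
    (h : IsStandardCoordinate g k b D i s) (hk : 1 ≤ k) (hi : i = p ∨ i = p - 1)
    {δ : ℝ} (hδ : δ < Real.pi / (2 * k)) :
    Tendsto s (germSector (midDirection k p) δ) (planeEnd p) := by
  have hkr : (0:ℝ) < k := by exact_mod_cast hk
  have hβ : k * δ < Real.pi / 2 := by
    rw [lt_div_iff₀ (by positivity)] at hδ; linarith
  obtain ⟨β', h1, h2⟩ := exists_between hβ
  have hpi := Real.pi_pos
  refine tendsto_germSector_of_infSector hk (by rw [← pi_div_two_mul_add hk]; have : 0 < Real.pi / (2 * k) := by positivity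
                                                linarith) ?_
  refine tendsto_comap_iff.2 ?_
  have h3 := tendsto_infSector h1 (by linarith) (h.tendsto_midMap_div hk hi hβ)
  refine ((tendsto_re_infSector h2).comp h3).congr fun X => ?_
  simp only [Function.comp]
  rw [midMap_spec p s, endSign_mul_im]

/-- A property invariant under `W ↦ W + 1` that holds on the image of the middle sector holds on
the corresponding end of the plane. -/
theorem IsStandardCoordinate.eventually_planeEnd_of_germSector {s : ℂ → ℂ} {i p : ℤ}
    (h : IsStandardCoordinate g k b D i s) (hk : 1 ≤ k) (hi : i = p ∨ i = p - 1)
    {δ : ℝ} (hδ : 0 < δ) {P : ℂ → Prop}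
    (hP : ∀ᶠ z in germSector (midDirection k p) δ, P (s z))
    (hP1 : ∀ᶠ W in planeEnd p, P (W + 1) ↔ P W) : ∀ᶠ W in planeEnd p, P W := by
  have hkr : (0:ℝ) < k := by exact_mod_cast hk
  have hpi := Real.pi_pos
  set β := min (k * δ) (Real.pi / 4) with hβ
  have hβ0 : 0 < β := lt_min (by positivity) (by positivity)
  have hβ1 : β < Real.pi / 2 := (min_le_right _ _).trans_lt (by linarith)
  have hβ2 : β / 3 < β / 2 := by linarith
  obtain ⟨G, hG, hGt, -⟩ := exists_inverse (show β / 2 < β by linarith) (by linarith)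
    (h.eventually_differentiableAt_midMap hk hi hβ1) (h.tendsto_midMap_div hk hi hβ1)
  have hm : Tendsto G (infSector (β / 2)) (infSector β) :=
    tendsto_infSector (by linarith) (by linarith) hGt
  have hle : germSector (midDirection k p) (β / k) ≤ germSector (midDirection k p) δ := by
    refine germSector_mono ?_
    rw [div_le_iff₀ hkr, mul_comm]; exact min_le_left _ _
  have h1 : ∀ᶠ W in infSector (β / 2), P (petalSign p * Complex.I * W) := by
    filter_upwards [(((tendsto_unchart hk (midDirection k p) (show β ≤ Real.pi by linarith)).mono_right
      hle).comp hm).eventually hP, hG] with W h2 h3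
    simp only [Function.comp] at h2
    rwa [midMap_spec p s, h3.2] at h2
  obtain ⟨R, hR, h1⟩ := eventually_infSector.1 h1
  obtain ⟨M, hM⟩ := eventually_planeEnd.1 hP1
  have hshift : ∀ n : ℕ, ∀ W : ℂ, M ≤ endSign p * W.im → (P (W + n) ↔ P W) := by
    intro n
    induction n with
    | zero => intro W _; simp
    | succ n ih =>
      intro W hW
      rw [← ih W hW, ← hM (W + n) (by simpa using hW)]
      push_cast
      rw [add_assoc]
  have hcos : Real.cos (β / 2) < 1 := by
    rw [← Real.cos_zero]
    exact Real.cos_lt_cos_of_nonneg_of_le_pi le_rfl (by linarith) (by linarith)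
  -- After turning the end of the plane to the positive axis, a point U of the unit-width strip
  -- satisfies ‖U‖ ≤ 1 + Re U; it lies in the sector of half-opening β/2 once Re U > 1/(1 -
  -- cos(β/2)).
  refine eventually_planeEnd.2 ⟨max (max M R) (1 / (1 - Real.cos (β / 2)) + 1), fun W hW => ?_⟩
  have hW1 : M ≤ endSign p * W.im := (le_max_left _ _).trans ((le_max_left _ _).trans hW)
  have hW2 : R ≤ endSign p * W.im := (le_max_right _ _).trans ((le_max_left _ _).trans hW)
  have hW3 := (le_max_right _ _).trans hW
  -- points of the vertical strip
  have key : ∀ V : ℂ, V.im = W.im → 0 ≤ V.re → V.re < 1 → P V := by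
    intro V hV hV0 hV1
    set U : ℂ := -(petalSign p * Complex.I) * V with hU
    have hVU : V = petalSign p * Complex.I * U := by
      rw [hU]; linear_combination V * (Complex.I * Complex.I * petalSign_mul_self p + Complex.I_mul_I)
    have hre : U.re = endSign p * W.im := by
      rw [← hV, ← endSign_mul_im p U, ← hVU]
    have hnorm : ‖U‖ = ‖V‖ := by
      rw [hU, petalSign_eq, norm_mul, norm_neg, norm_mul, Complex.norm_real, Complex.norm_I, mul_one]
      have : ‖endSign p‖ = 1 := by
        unfold endSign; split_ifs <;> simp
      rw [this, one_mul]
    have hn2 : ‖U‖ ≤ 1 + U.re := by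
      rw [hnorm, hre]
      refine (Complex.norm_le_abs_re_add_abs_im V).trans ?_
      rw [abs_of_nonneg hV0, hV]
      have : |W.im| = endSign p * W.im := by
        have e1 : |endSign p * W.im| = |W.im| := by
          rw [abs_mul]; unfold endSign; split_ifs <;> simp
        rw [← e1, abs_of_nonneg (by linarith)]
      linarith
    rw [hVU]
    refine h1 U (hW2.trans (by rw [← hre]; exact Complex.re_le_norm U)) ?_
    have hU0 : U ≠ 0 := by
      intro h0; rw [h0, Complex.zero_re] at hre; linarith
    rw [abs_arg_lt_iff hU0 (by linarith) (by linarith)]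
    have hd : 0 < 1 - Real.cos (β / 2) := by linarith
    have : 1 / (1 - Real.cos (β / 2)) < U.re := by rw [hre]; linarith
    rw [div_lt_iff₀ hd] at this
    have hc0 : 0 < Real.cos (β / 2) := Real.cos_pos_of_mem_Ioo ⟨by linarith, by linarith⟩
    nlinarith
  -- Every point of the half-plane is an integer translate of a point of the strip, and P is
  -- invariant under these translations.
  have hfl : P (W - ⌊W.re⌋) := key _ (by simp) (by simp)
    (by simp only [Complex.sub_re, Complex.intCast_re]; linarith [Int.lt_floor_add_one W.re])
  rcases le_total 0 ⌊W.re⌋ with h0 | h0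
  · obtain ⟨n, hn⟩ := Int.eq_ofNat_of_zero_le h0
    have := (hshift n (W - ⌊W.re⌋) (by simpa using hW1)).2 hfl
    rw [hn] at this; simpa using this
  · obtain ⟨n, hn⟩ := Int.eq_ofNat_of_zero_le (neg_nonneg.2 h0)
    refine (hshift n W hW1).1 ?_
    have hn' : ⌊W.re⌋ = -(n : ℤ) := by omega
    rw [hn'] at hfl; simpa using hfl

/-- The difference of two adjacent standard coordinates. -/
theorem IsStandardFamily.tendsto_sub {s : ℤ → ℂ → ℂ} (h : IsStandardFamily g k b D s) (hk : 1 ≤ k)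
    (p : ℤ) {δ : ℝ} (hδ : δ < Real.pi / (2 * k)) :
    Tendsto (fun z => s (target p) z - s (source p) z) (germSector (midDirection k p) δ)
      (𝓝 (-((endSign p : ℝ) * (Complex.I * Real.pi * b / k)))) := by
  have hk0 := natCast_ne_zero_of_pos hk
  have hα : δ + Real.pi / (2 * k) < Real.pi / k := by
    rw [← pi_div_two_mul_add hk]; linarith
  have h1 := ((h.coord p).expansion _ hα).mono_left
    (germSector_mid_le hk (i := p) (p := p) (Or.inl rfl) le_rfl hα.le)
  have h2 := ((h.coord (p - 1)).expansion _ hα).mono_left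
    (germSector_mid_le hk (i := p - 1) (p := p) (Or.inr rfl) le_rfl hα.le)
  have h3 := h1.sub h2
  rw [sub_self] at h3
  have hpk := pi_div_le hk
  -- Both expansions have the same D and the same polar term; their logarithms refer to bisectors at
  -- angle π/k, so they differ by iπ/k.
  have h4 : Tendsto (fun z => s p z - s (p - 1) z) (germSector (midDirection k p) δ)
      (𝓝 (-(Complex.I * Real.pi * b / k))) := by
    have h5 := h3.add_const (-(Complex.I * Real.pi * b / k))
    rw [zero_add] at h5
    refine h5.congr' ?_
    filter_upwards [germSector_ne_zero, germSector_relArg] with z hz hza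
    have e1 := log_rotate (t := Real.pi / (2 * k)) (by rw [abs_pi_div_two_mul]; linarith) hz hza
    have e2 := log_rotate (t := -(Real.pi / (2 * k))) (by rw [abs_neg, abs_pi_div_two_mul]; linarith) hz hza
    rw [← direction_eq_mid_add hk] at e1
    rw [← direction_eq_mid_sub hk] at e2
    rw [e1, e2]
    push_cast
    field_simp
    ring
  unfold source target endSign
  split_ifs with hp
  · simpa using h4
  · have := h4.neg
    simp only [neg_neg, neg_sub] at this
    simpa using this

end

/-! ### Normalized transition functions determine a common normalization of the Fatou coordinates.
-/

section

variable {g : ℂ → ℂ} {k : ℕ} {b D : ℂ} {s : ℤ → ℂ → ℂ}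

theorem sector_subset {θ α α' r r' : ℝ} (hα : α' ≤ α) (hr : r' ≤ r) :
    sector θ α' r' ⊆ sector θ α r := by
  intro z hz
  exact ⟨hz.1, hz.2.1.trans_le hr, hz.2.2.trans_le hα⟩

theorem isOpen_sector {θ α r : ℝ} (hα : α ≤ Real.pi) : IsOpen (sector θ α r) := by
  refine isOpen_iff_mem_nhds.2 fun z hz => ?_
  obtain ⟨h1, h2, h3⟩ := hz
  have hs : z * Complex.exp (-(θ * Complex.I)) ∈ Complex.slitPlane := by
    rw [Complex.mem_slitPlane_iff_arg]
    refine ⟨fun h => ?_, mul_ne_zero (norm_pos_iff.1 h1) (Complex.exp_ne_zero _)⟩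
    rw [h, abs_of_pos Real.pi_pos] at h3; linarith
  have hc : ContinuousAt (fun w : ℂ => |(w * Complex.exp (-(θ * Complex.I))).arg|) z :=
    (ContinuousAt.comp (f := fun w : ℂ => w * Complex.exp (-(θ * Complex.I)))
      (Complex.continuousAt_arg hs) (by fun_prop)).abs
  have hn : ContinuousAt (fun w : ℂ => ‖w‖) z := continuous_norm.continuousAt
  filter_upwards [hc.eventually (gt_mem_nhds h3), hn.eventually (gt_mem_nhds h2),
    hn.eventually (lt_mem_nhds h1)] with w a b c using ⟨c, b, a⟩

/-- `Ψ` is the change of Fatou coordinates in position `p`. -/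
def IsGluing (k : ℕ) (s : ℤ → ℂ → ℂ) (Ψ : ℂ → ℂ) (p : ℤ) (δ : ℝ) : Prop :=
  ∀ᶠ z in germSector (midDirection k p) δ, Ψ (s (source p) z) = s (target p) z

theorem IsGluing.of_period {Ψ : ℂ → ℂ} {p : ℤ} {δ : ℝ} (hk : 1 ≤ k) (hs : IsStandardFamily g k b D s)
    (h : IsGluing k s Ψ p δ) (n : ℤ) : IsGluing k s Ψ (p + 2 * k * n) δ := by
  unfold IsGluing at h ⊢
  rw [midDirection_add_period hk, germSector_add_int_mul, mul_assoc, source_add_even,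
    target_add_even, ← mul_assoc, hs.periodic, hs.periodic]
  exact h

theorem germSector_neBot (hk : 1 ≤ k) (θ : ℝ) {δ : ℝ} (hδ : 0 < δ) : (germSector θ δ).NeBot := by
  have hkr : (0:ℝ) < k := by exact_mod_cast hk
  have h1 : 0 < min (k * δ) Real.pi := lt_min (by positivity) Real.pi_pos
  have := infSector_neBot h1
  have h2 := (tendsto_unchart hk θ (min_le_right (k * δ) Real.pi)).mono_right (germSector_mono (by
    rw [div_le_iff₀ hkr, mul_comm]; exact min_le_left _ _ : min (k * δ) Real.pi / k ≤ δ))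
  exact h2.neBot

theorem planeEnd_add_period (p n : ℤ) : planeEnd (p + 2 * k * n) = planeEnd p := by
  unfold planeEnd
  rw [mul_assoc, endSign_add_even]

/-- A position representing the index `j`, between `1 - k` and `k`. -/
def midIndex (j : ℤ) : ℤ := if 0 < j then j else j + 1

theorem position_eq_midIndex (k : ℕ) (j : ℤ) : ∃ n : ℤ, position k j = midIndex j + 2 * k * n := by
  unfold position midIndex
  split_ifs
  · exact ⟨0, by ring⟩
  · exact ⟨1, by ring⟩

/-- For j < 0 the sector of index j lies between the petals j and j + 1, so the upper of the two
petals is j + 1; this translates the formulas in j - sgn j into source and target. -/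
theorem midIndex_spec {j : ℤ} (hj : j ≠ 0) :
    2 * j - j.sign = 2 * midIndex j - 1 ∧
    (Odd j → source (midIndex j) = j - j.sign ∧ target (midIndex j) = j) ∧
    (Even j → source (midIndex j) = j ∧ target (midIndex j) = j - j.sign) := by
  unfold midIndex source target
  rcases lt_or_gt_of_ne hj with h | h
  · rw [Int.sign_eq_neg_one_of_neg h, if_neg (by omega)]
    have : Odd (j + 1) ↔ ¬ Odd j := by
      rw [Int.not_odd_iff_even]
      exact ⟨fun ⟨a, ha⟩ => ⟨a, by omega⟩, fun ⟨a, ha⟩ => ⟨a, by omega⟩⟩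
    simp only [this]
    refine ⟨by ring, fun ho => by simp [ho], fun he => ?_⟩
    rw [← Int.not_odd_iff_even] at he
    simp [he]
  · rw [Int.sign_eq_one_of_pos h, if_pos h]
    refine ⟨by ring, fun ho => by simp [ho], fun he => ?_⟩
    rw [← Int.not_odd_iff_even] at he
    simp [he]

/-- Normalized transition functions come from a common normalization of Fatou coordinates. -/
theorem IsTransition.exists_family {Ψ : ℤ → ℂ → ℂ} (hT : IsTransition g k b Ψ)
    (hg : IsPrenormalized g k b) (hk : 1 ≤ k) :
    ∃ (D : ℂ) (s : ℤ → ℂ → ℂ) (δ : ℝ), IsStandardFamily g k b D s ∧ 0 < δ ∧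
      δ < Real.pi / (2 * k) ∧ ∀ j, IsIndex k j → IsGluing k s (Ψ j) (position k j) δ := by
  have hkr : (0:ℝ) < k := by exact_mod_cast hk
  have hpi := Real.pi_pos
  obtain ⟨α, r, φ, hα1, hα2, hr, hφ, -, hΨ⟩ := hT
  obtain ⟨s, hs⟩ := hg.exists_isStandardFamily hk
  obtain ⟨α', ha1, ha2⟩ := exists_between hα1
  obtain ⟨α₁, ha3, ha4⟩ := exists_between ha2
  have hpk0 : 0 < Real.pi / (2 * k) := by positivity
  -- By uniqueness the given coordinate on each petal is the standard one plus a constant, which at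
  -- this stage may depend on the petal.
  have hC : ∀ i : ℤ, ∃ C : ℂ, -(k:ℤ) ≤ i → i ≤ k →
      ∀ᶠ z in germSector (direction k i) α', φ i z = s i z + C := by
    intro i
    by_cases hi : -(k:ℤ) ≤ i ∧ i ≤ k
    · obtain ⟨h1, h2, h3⟩ := hφ i hi.1 hi.2
      have hopen : ∀ᶠ z in germSector (direction k i) α, DifferentiableAt ℂ (φ i) z := by
        refine eventually_germSector.2 ⟨r, hr, fun z hz => (h1 z hz).differentiableAt ?_⟩
        exact (isOpen_sector (hα2.le.trans (pi_div_le hk))).mem_nhds hz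
      have hinj : Set.InjOn (φ i) (sector (direction k i) α₁ r) :=
        h2.mono (sector_subset ha4.le le_rfl)
      obtain ⟨C, hC⟩ := (hs.coord i).exists_eq_add hg hk (by linarith) ha3
        (by linarith) (φ := φ i) (hopen.filter_mono (germSector_mono ha4.le)) (by
          have h4 := eventually_germSector.2 ⟨r, hr, fun z (hz : z ∈ sector (direction k i) α r) => hz⟩
          filter_upwards [h4.filter_mono (germSector_mono ha4.le),
            (tendsto_germSector_of_tangent ha4 (hα2.le.trans (pi_div_le hk))
              ((hg.tendsto_div hk).mono_left germSector_le)).eventually h4] with z h5 h6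
          exact h3 z h5 h6)
        ⟨r, hr, hinj⟩
      exact ⟨C, fun _ _ => hC⟩
    · refine ⟨0, fun h1 h2 => ?_⟩
      exact absurd (And.intro h1 h2) hi
  choose C hC using hC
  have hδ0 : 0 < α' - Real.pi / (2 * k) := by linarith
  have hδ1 : α' - Real.pi / (2 * k) < Real.pi / (2 * k) := by
    have := pi_div_two_mul_add hk; linarith
  -- the transition relation, in terms of the standard coordinates
  have hglue : ∀ j, IsIndex k j → ∀ᶠ z in germSector (midDirection k (midIndex j))
      (α' - Real.pi / (2 * k)), Ψ j (s (source (midIndex j)) z + C (source (midIndex j))) =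
        s (target (midIndex j)) z + C (target (midIndex j)) := by
    intro j hj
    obtain ⟨-, -, -, ρ, hρ, h1⟩ := hΨ j hj
    obtain ⟨hj0, hj1, hj2⟩ := hj
    obtain ⟨e1, e2, e3⟩ := midIndex_spec hj0
    have hmid : (2 * j - j.sign) * Real.pi / (2 * k) = midDirection k (midIndex j) := by
      unfold midDirection
      have : (2 * (j:ℝ) - (j.sign : ℤ)) = 2 * (midIndex j : ℤ) - 1 := by exact_mod_cast e1
      rw [this]
    rw [hmid] at h1
    have h2 := eventually_germSector.2 ⟨ρ, hρ, h1⟩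
    have hrange : ∀ i, i = midIndex j ∨ i = midIndex j - 1 → -(k:ℤ) ≤ i ∧ i ≤ k := by
      intro i hi
      unfold midIndex at hi
      split_ifs at hi <;> omega
    have hin : ∀ i, i = midIndex j ∨ i = midIndex j - 1 →
        ∀ᶠ z in germSector (midDirection k (midIndex j)) (α' - Real.pi / (2 * k)),
          φ i z = s i z + C i := fun i hi =>
      (hC i (hrange i hi).1 (hrange i hi).2).filter_mono
        (germSector_mid_le hk hi (by linarith) (by linarith))
    filter_upwards [h2.filter_mono (germSector_mono (by linarith)),
      hin _ (source_eq_or _), hin _ (target_eq_or _)] with z h3 h4 h5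
    rcases Int.even_or_odd j with h | h
    · rw [← h4, ← h5, (e3 h).1, (e3 h).2]; exact h3.2 h
    · rw [← h4, ← h5, (e2 h).1, (e2 h).2]; exact h3.1 h
  -- The limit of Ψ_j(W) - W along the middle sector is known twice: from the normalization and from
  -- `tendsto_sub` shifted by the two constants. The values -iπb/k and iπb/k are chosen so that the
  -- comparison makes the constants equal.
  have hCeq : ∀ j, IsIndex k j → C (target (midIndex j)) = C (source (midIndex j)) := by
    intro j hj
    obtain ⟨-, -, h1, -⟩ := hΨ j hj
    rw [farEnd_eq_planeEnd k, constantTerm_eq k] at h1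
    obtain ⟨n, hn⟩ := position_eq_midIndex k j
    rw [hn, planeEnd_add_period, mul_assoc, endSign_add_even] at h1
    set p := midIndex j
    have h2 := h1.comp (((hs.coord (source p)).add_const (C (source p))).tendsto_planeEnd hk
      (source_eq_or p) hδ1)
    have h3 := (hs.tendsto_sub hk p hδ1).add_const (C (target p) - C (source p))
    have := germSector_neBot hk (midDirection k p) hδ0
    have h4 := tendsto_nhds_unique_of_eventuallyEq h2 h3 (by
      filter_upwards [hglue j hj] with z hz
      simp only [Function.comp]
      rw [hz]; ring)
    linear_combination -h4
  have hstep : ∀ i : ℤ, -(k:ℤ) < i → i ≤ k → C i = C (i - 1) := by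
    intro i h1 h2
    have : ∃ j, IsIndex k j ∧ midIndex j = i := by
      by_cases h : 0 < i
      · exact ⟨i, ⟨by omega, by omega, h2⟩, by simp [midIndex, h]⟩
      · exact ⟨i - 1, ⟨by omega, by omega, by omega⟩, by unfold midIndex; rw [if_neg (by omega)]; ring⟩
    obtain ⟨j, hj, rfl⟩ := this
    have := hCeq j hj
    unfold source target at this
    split_ifs at this
    · exact this
    · exact this.symm
  have hpos : ∀ n : ℕ, (n:ℤ) ≤ k → C n = C 0 ∧ C (-n) = C 0 := by
    intro n
    induction n with
    | zero => simp
    | succ n ih =>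
      intro hn
      obtain ⟨h1, h2⟩ := ih (by push_cast at hn; omega)
      push_cast at hn ⊢
      refine ⟨?_, ?_⟩
      · rw [hstep _ (by omega) hn]; simpa using h1
      · rw [← h2, hstep (-n) (by omega) (by omega)]
        congr 1; ring
  have hall : ∀ i : ℤ, -(k:ℤ) ≤ i → i ≤ k → C i = C 0 := by
    intro i h1 h2
    rcases Int.eq_nat_or_neg i with ⟨n, rfl | rfl⟩
    · exact (hpos n h2).1
    · exact (hpos n (by omega)).2
  refine ⟨0 + C 0, fun j z => s j z + C 0, α' - Real.pi / (2 * k), hs.add_const _, hδ0, hδ1,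
    fun j hj => ?_⟩
  obtain ⟨n, hn⟩ := position_eq_midIndex k j
  rw [hn]
  refine IsGluing.of_period hk (hs.add_const (C 0)) ?_ n
  have hrange : ∀ i, i = midIndex j ∨ i = midIndex j - 1 → -(k:ℤ) ≤ i ∧ i ≤ k := by
    intro i hi
    obtain ⟨hj0, hj1, hj2⟩ := hj
    unfold midIndex at hi
    split_ifs at hi <;> omega
  have e1 := hall _ (hrange _ (source_eq_or _)).1 (hrange _ (source_eq_or _)).2
  have e2 := hall _ (hrange _ (target_eq_or _)).1 (hrange _ (target_eq_or _)).2
  have := hglue j hj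
  rw [e1, e2] at this
  exact this

end

/-! ### Existence of normalized transition functions. -/

section

variable {g : ℂ → ℂ} {k : ℕ} {b D : ℂ} {s : ℤ → ℂ → ℂ}

/-- The turning factor inverse to `petalSign p * I`. -/
theorem neg_mul_turn (p : ℤ) (W : ℂ) :
    petalSign p * Complex.I * (-(petalSign p * Complex.I) * W) = W := by
  linear_combination (-W) * (Complex.I * Complex.I * petalSign_mul_self p + Complex.I_mul_I)

theorem turn_mul_neg (p : ℤ) (W : ℂ) :
    -(petalSign p * Complex.I) * (petalSign p * Complex.I * W) = W := by
  linear_combination (-W) * (Complex.I * Complex.I * petalSign_mul_self p + Complex.I_mul_I)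

theorem turn_re (p : ℤ) (W : ℂ) : (-(petalSign p * Complex.I) * W).re = endSign p * W.im := by
  rw [← endSign_mul_im p, neg_mul_turn]

theorem turn_im (p : ℤ) (W : ℂ) : |(-(petalSign p * Complex.I) * W).im| = |W.re| := by
  rw [petalSign_eq, neg_mul, mul_assoc, Complex.neg_im, Complex.im_ofReal_mul, abs_neg, abs_mul]
  unfold endSign
  split_ifs <;> simp

/-- The part of a quadrant-like neighbourhood of the end `p` of the plane. -/
def endCone (p : ℤ) (M : ℝ) : Set ℂ := {W | M ≤ endSign p * W.im ∧ |W.re| ≤ endSign p * W.im}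

/-- The cone has half-opening π/4 < π/3: in it ‖X‖ ≤ √2 Re X < 2 Re X after turning. -/
theorem exists_endCone {p : ℤ} {P : ℂ → Prop}
    (h : ∀ᶠ X in infSector (Real.pi / 3), P (petalSign p * Complex.I * X)) :
    ∃ M : ℝ, ∀ W ∈ endCone p M, P W := by
  obtain ⟨R, hR, h⟩ := eventually_infSector.1 h
  refine ⟨R, fun W ⟨h1, h2⟩ => ?_⟩
  have h3 := h (-(petalSign p * Complex.I) * W)
  rw [neg_mul_turn] at h3
  set X := -(petalSign p * Complex.I) * W with hX
  have hre : X.re = endSign p * W.im := turn_re p W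
  have him : |X.im| ≤ X.re := by rw [hre, hX, turn_im]; exact h2
  have hR' : R ≤ X.re := by rw [hre]; exact h1
  refine h3 (hR'.trans (Complex.re_le_norm X)) ?_
  have hX0 : X ≠ 0 := by intro h0; rw [h0, Complex.zero_re] at hR'; linarith
  have hpi := Real.pi_pos
  rw [abs_arg_lt_iff hX0 (by linarith) (by linarith), Real.cos_pi_div_three]
  have h4 : ‖X‖ ^ 2 = X.re ^ 2 + X.im ^ 2 := by
    rw [← Complex.normSq_eq_norm_sq, Complex.normSq_apply]; ring
  have h5 : X.im ^ 2 ≤ X.re ^ 2 := sq_le_sq' (by linarith [(abs_le.1 him).1]) (abs_le.1 him).2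
  have h6 : ‖X‖ ^ 2 < (2 * X.re) ^ 2 := by nlinarith
  have := lt_of_pow_lt_pow_left₀ 2 (by linarith) h6
  linarith

theorem eventually_mem_endCone (p : ℤ) (M : ℝ) :
    ∀ᶠ X in infSector (Real.pi / 4), petalSign p * Complex.I * X ∈ endCone p M := by
  have hpi := Real.pi_pos
  filter_upwards [(tendsto_re_infSector (show Real.pi / 4 < Real.pi / 2 by linarith)).eventually_ge_atTop
    (max M 0), infSector_ne_zero, eventually_infSector_arg] with X h1 h2 h3
  have e : |(petalSign p * Complex.I * X).re| = |X.im| := by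
    rw [← turn_im p, turn_mul_neg]
  unfold endCone
  refine ⟨?_, ?_⟩
  · rw [endSign_mul_im]; exact (le_max_left _ _).trans h1
  · rw [endSign_mul_im, e]
    rw [abs_arg_lt_iff h2 (by linarith) (by linarith), Real.cos_pi_div_four] at h3
    have h4 : ‖X‖ ^ 2 = X.re ^ 2 + X.im ^ 2 := by
      rw [← Complex.normSq_eq_norm_sq, Complex.normSq_apply]; ring
    have h5 : (√2 / 2 * ‖X‖) ^ 2 < X.re ^ 2 := by
      exact pow_lt_pow_left₀ h3 (by positivity) two_ne_zero
    rw [mul_pow, div_pow, Real.sq_sqrt (by norm_num), h4] at h5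
    have h0 : 0 ≤ X.re := (le_max_right _ _).trans h1
    exact abs_le_of_sq_le_sq (by nlinarith) h0

/-- The change of Fatou coordinates between the petals `p - 1` and `p`, around the vertical
direction. -/
theorem IsStandardFamily.exists_transition_infSector (hs : IsStandardFamily g k b D s)
    (hg : IsPrenormalized g k b) (hk : 1 ≤ k) (p : ℤ) :
    ∃ V : ℂ → ℂ,
      (∀ᶠ X in infSector (Real.pi / 3), DifferentiableAt ℂ V (petalSign p * Complex.I * X) ∧
        V (petalSign p * Complex.I * X + 1) = V (petalSign p * Complex.I * X) + 1) ∧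
      Tendsto (fun X => V (petalSign p * Complex.I * X) - petalSign p * Complex.I * X)
        (infSector (Real.pi / 3)) (𝓝 (-((endSign p : ℝ) * (Complex.I * Real.pi * b / k)))) ∧
      ∀ M : ℝ, ∀ᶠ z in germSector (midDirection k p) (Real.pi / 8 / k),
        s (source p) z ∈ endCone p M ∧ V (s (source p) z) = s (target p) z := by
  have hkr : (0:ℝ) < k := by exact_mod_cast hk
  have hpi := Real.pi_pos
  set θ := midDirection k p with hθ
  set a := s (source p) with ha
  set t := s (target p) with ht
  set c : ℂ := -((endSign p : ℝ) * (Complex.I * Real.pi * b / k)) with hc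
  have hca := hs.coord (source p)
  have hct := hs.coord (target p)
  rw [← ha] at hca
  rw [← ht] at hct
  -- Openings π/3 < 17π/48 < 3π/8 < 5π/12 < π/2: inverting the coordinate and applying maps tangent
  -- to the identity each cost a little of the opening.
  set β₀ := 5 * Real.pi / 12 with hβ₀
  set β₂ := 3 * Real.pi / 8 with hβ₂
  set β₃ := 17 * Real.pi / 48 with hβ₃
  set β₁ := Real.pi / 3 with hβ₁
  have hb0 : β₀ < Real.pi / 2 := by rw [hβ₀]; linarith
  have hb20 : β₂ < β₀ := by rw [hβ₀, hβ₂]; linarith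
  have hb32 : β₃ < β₂ := by rw [hβ₃, hβ₂]; linarith
  have hb13 : β₁ < β₃ := by rw [hβ₃, hβ₁]; linarith
  obtain ⟨G, hG, hGt, hGS⟩ := exists_inverse hb20 (by linarith)
    (hca.eventually_differentiableAt_midMap hk (source_eq_or p) hb0)
    (hca.tendsto_midMap_div hk (source_eq_or p) hb0)
  have hGm : Tendsto G (infSector β₁) (infSector β₃) :=
    tendsto_infSector hb13 (by linarith) (hGt.mono_left (infSector_mono (by linarith)))
  have hu : ∀ β < Real.pi, Tendsto (unchart k θ) (infSector β) (germSector θ (β / k)) :=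
    fun β hβ => tendsto_unchart hk θ hβ.le
  have hz : Tendsto (fun X => unchart k θ (G X)) (infSector β₁) (germSector θ (β₃ / k)) :=
    (hu β₃ (by linarith)).comp hGm
  have hβ₃k : β₃ / k < Real.pi / (2 * k) := by
    rw [show Real.pi / (2 * k) = (Real.pi / 2) / k by field_simp]
    exact div_lt_div_of_pos_right (by linarith) hkr
  have hβ₃k' : β₃ / k + Real.pi / (2 * k) < Real.pi / k := div_add_lt_pi_div hk (by linarith)
  have hsrc : ∀ᶠ X in infSector β₁, a (unchart k θ (G X)) = petalSign p * Complex.I * X := by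
    filter_upwards [hG.filter_mono (infSector_mono (by linarith))] with X hX
    rw [hθ, midMap_spec p a, hX.2]
  -- the transition on a sector around the vertical direction
  set V : ℂ → ℂ := fun W => t (unchart k θ (G (-(petalSign p * Complex.I) * W))) with hV
  have hVX : ∀ X, V (petalSign p * Complex.I * X) = t (unchart k θ (G X)) := fun X => by
    simp only [hV, turn_mul_neg]
  have hgt := hg.tendsto_div hk
  have hVshift : ∀ᶠ X in infSector β₁,
      V (petalSign p * Complex.I * X + 1) = V (petalSign p * Complex.I * X) + 1 := by
    have hab : ∀ i, i = p ∨ i = p - 1 → ∀ᶠ z in germSector θ (β₃ / k), s i (g z) = s i z + 1 :=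
      fun i hi => ((hs.coord i).abel _ hβ₃k').filter_mono (germSector_mid_le hk hi le_rfl hβ₃k'.le)
    have hgm : Tendsto g (germSector θ (β₃ / k)) (germSector θ (β₂ / k)) :=
      tendsto_germSector_of_tangent (div_lt_div_of_pos_right hb32 hkr)
        ((div_le_div_of_nonneg_right (by linarith) hkr.le).trans (pi_div_le hk))
        (hgt.mono_left germSector_le)
    have hbk : β₂ / k ≤ Real.pi / k := div_le_div_of_nonneg_right (by linarith) hkr.le
    have hchart : Tendsto (fun X => chart k θ (g (unchart k θ (G X)))) (infSector β₁)
        (infSector β₂) := by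
      have := (tendsto_chart hk (θ := θ) hbk).comp (hgm.comp hz)
      rwa [mul_div_natCast hk] at this
    filter_upwards [hz.eventually (hab _ (source_eq_or p)), hz.eventually (hab _ (target_eq_or p)),
      (hgm.comp hz).eventually (eventually_unchart_chart hk hbk), hchart.eventually hGS, hsrc]
      with X h1 h2 h3 h4 h5
    have e1 : -(petalSign p * Complex.I) * (petalSign p * Complex.I * X + 1) =
        midMap k p a (chart k θ (g (unchart k θ (G X)))) := by
      simp only [Function.comp] at h3
      rw [midMap, ← hθ, h3, ha, h1, ← ha, h5]
    rw [hVX, ht, ← h2, ← ht, hV]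
    simp only [e1, h4]
    simp only [Function.comp] at h3
    rw [h3]
  have hVdiff : ∀ᶠ X in infSector β₁, DifferentiableAt ℂ V (petalSign p * Complex.I * X) := by
    filter_upwards [hz.eventually ((hct.differentiable _ hβ₃k').filter_mono
      (germSector_mid_le hk (target_eq_or p) le_rfl hβ₃k'.le)),
      hG.filter_mono (infSector_mono (show β₁ ≤ β₂ by linarith)),
      hGm.eventually infSector_ne_zero, hGm.eventually eventually_infSector_arg] with X h1 h2 h3 h4
    have e2 : DifferentiableAt ℂ (fun W => G (-(petalSign p * Complex.I) * W))
        (petalSign p * Complex.I * X) := by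
      refine DifferentiableAt.comp (g := G) (f := fun W => -(petalSign p * Complex.I) * W) _ ?_
        (by fun_prop)
      rw [turn_mul_neg]; exact h2.1
    have e3 : DifferentiableAt ℂ (fun W => unchart k θ (G (-(petalSign p * Complex.I) * W)))
        (petalSign p * Complex.I * X) := by
      refine DifferentiableAt.comp (g := unchart k θ)
        (f := fun W => G (-(petalSign p * Complex.I) * W)) _ ?_ e2
      rw [turn_mul_neg]; exact differentiableAt_unchart hk θ h3 (h4.trans (by linarith))
    refine DifferentiableAt.comp (g := t)
      (f := fun W => unchart k θ (G (-(petalSign p * Complex.I) * W))) _ ?_ e3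
    rw [turn_mul_neg]; exact h1
  have hVlim : Tendsto (fun X => V (petalSign p * Complex.I * X) - petalSign p * Complex.I * X)
      (infSector β₁) (𝓝 c) := by
    refine ((hs.tendsto_sub hk p hβ₃k).comp hz).congr' ?_
    filter_upwards [hsrc] with X hX
    rw [hVX]
    simp only [Function.comp, ← ha, ← ht]
    rw [hX]
  refine ⟨V, hVdiff.and hVshift, hVlim, fun M => ?_⟩
  have hb8 : Real.pi / 8 / k ≤ Real.pi / k := div_le_div_of_nonneg_right (by linarith) hkr.le
  refine eventually_germSector_of_infSector hk hb8 ?_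
  rw [mul_div_natCast hk]
  have hSm : Tendsto (midMap k p a) (infSector (Real.pi / 8)) (infSector (Real.pi / 4)) :=
    tendsto_infSector (by linarith) (by linarith)
      (hca.tendsto_midMap_div hk (source_eq_or p) (by linarith))
  filter_upwards [hSm.eventually (eventually_mem_endCone p M),
    hGS.filter_mono (infSector_mono (show Real.pi / 8 ≤ β₂ by linarith))] with X h1 h2
  rw [← midMap_spec p a, ← hθ] at h1
  refine ⟨h1, ?_⟩
  simp only [hV]
  have : -(petalSign p * Complex.I) * a (unchart k θ X) = midMap k p a X := by
    rw [midMap, ← hθ]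
  rw [this, h2]

/-- Periodic extension to a half-plane. -/
theorem exists_periodic_extension (p : ℤ) {V : ℂ → ℂ} {c : ℂ}
    (hV : ∀ᶠ X in infSector (Real.pi / 3), DifferentiableAt ℂ V (petalSign p * Complex.I * X) ∧
        V (petalSign p * Complex.I * X + 1) = V (petalSign p * Complex.I * X) + 1)
    (hVlim : Tendsto (fun X => V (petalSign p * Complex.I * X) - petalSign p * Complex.I * X)
        (infSector (Real.pi / 3)) (𝓝 c)) :
    ∃ Ψ : ℂ → ℂ, (∀ᶠ W in planeEnd p, DifferentiableAt ℂ Ψ W) ∧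
      (∀ᶠ W in planeEnd p, Ψ (W + 1) = Ψ W + 1) ∧
      Tendsto (fun W => Ψ W - W) (planeEnd p) (𝓝 c) ∧ ∃ M, ∀ W ∈ endCone p M, Ψ W = V W := by
  obtain ⟨M, hM⟩ := exists_endCone (p := p)
    (P := fun W => DifferentiableAt ℂ V W ∧ V (W + 1) = V W + 1) hV
  have hVn : ∀ n : ℕ, ∀ W, W ∈ endCone p M → W + n ∈ endCone p M → V (W + n) = V W + n := by
    intro n
    induction n with
    | zero => intro W _ _; simp
    | succ n ih =>
      intro W hW hWn
      -- A horizontal line meets the cone in an interval, so the intermediate translates between two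
      -- points of the cone stay in it.
      have hmid : W + n ∈ endCone p M := by
        obtain ⟨h1, h2⟩ := hW
        obtain ⟨h3, h4⟩ := hWn
        simp only [Complex.add_im, Complex.natCast_im, add_zero, Complex.add_re,
          Complex.natCast_re] at h3 h4
        push_cast at h4
        rw [abs_le] at h2 h4
        have hn : (0:ℝ) ≤ n := Nat.cast_nonneg n
        refine ⟨by simpa using h1, ?_⟩
        simp only [Complex.add_im, Complex.natCast_im, add_zero, Complex.add_re,
          Complex.natCast_re]
        rw [abs_le]
        constructor <;> linarith [h2.1, h4.2]
      have h1 := (hM _ hmid).2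
      have h2 := ih W hW hmid
      push_cast
      rw [← add_assoc, h1, h2]; ring
  have hVz : ∀ m n : ℤ, ∀ W : ℂ, W - m ∈ endCone p M → W - n ∈ endCone p M →
      V (W - m) + m = V (W - n) + n := by
    have : ∀ m n : ℤ, m ≤ n → ∀ W : ℂ, W - m ∈ endCone p M → W - n ∈ endCone p M →
        V (W - m) + m = V (W - n) + n := by
      intro m n hmn W h1 h2
      obtain ⟨d, hd⟩ := Int.eq_ofNat_of_zero_le (sub_nonneg.2 hmn)
      have hnd : n = m + d := by omega
      subst hnd
      have e : W - m = (W - ((m + d : ℤ) : ℂ)) + d := by push_cast; ring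
      rw [e] at h1 ⊢
      rw [hVn d _ h2 h1]; push_cast; ring
    intro m n W h1 h2
    rcases le_total m n with h | h
    · exact this m n h W h1 h2
    · exact (this n m h W h2 h1).symm
  -- The tolerance 2 is 1 for the distance of Re W to its floor plus 1 for moving W in a unit ball.
  have hcone : ∀ M' : ℝ, ∀ m : ℤ, ∀ W : ℂ, max M' 2 ≤ endSign p * W.im → |W.re - m| ≤ 2 →
      W - m ∈ endCone p M' := by
    intro M' m W h1 h2
    refine ⟨?_, ?_⟩
    · simpa using (le_max_left _ _).trans h1
    · simpa using h2.trans ((le_max_right _ _).trans h1)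
  have hfl : ∀ W : ℂ, |W.re - ⌊W.re⌋| ≤ 1 := by
    intro W
    rw [abs_le]
    constructor <;> linarith [Int.floor_le W.re, Int.lt_floor_add_one W.re]
  -- W is brought to the strip 0 ≤ Re W < 1, where high points lie in the cone. By `hVz` other
  -- integer shifts give the same value, so the jumps of the floor are harmless: near W₀ the floor
  -- of Re W₀ may be used throughout.
  refine ⟨fun W => V (W - ⌊W.re⌋) + ⌊W.re⌋, ?_, ?_, ?_, ?_⟩
  · refine eventually_planeEnd.2 ⟨max M 2 + 1, fun W₀ h0 => ?_⟩
    have hnear : ∀ᶠ W in 𝓝 W₀, |W.re - W₀.re| < 1 ∧ |W.im - W₀.im| < 1 := by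
      filter_upwards [Metric.ball_mem_nhds W₀ one_pos] with W hW
      rw [Metric.mem_ball, dist_eq_norm] at hW
      exact ⟨(Complex.abs_re_le_norm (W - W₀)).trans_lt hW, (Complex.abs_im_le_norm (W - W₀)).trans_lt hW⟩
    have heq : (fun W => V (W - ⌊W.re⌋) + ⌊W.re⌋) =ᶠ[𝓝 W₀] fun W => V (W - ⌊W₀.re⌋) + ⌊W₀.re⌋ := by
      filter_upwards [hnear] with W hW
      have h1 : max M 2 ≤ endSign p * W.im := by
        have : |endSign p * (W.im - W₀.im)| < 1 := by
          rw [abs_mul]; unfold endSign; split_ifs <;> simpa using hW.2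
        have := (abs_lt.1 this).1
        linarith
      refine hVz _ _ W (hcone M _ W h1 ((hfl W).trans one_le_two)) (hcone M _ W h1 ?_)
      have h2 := hfl W₀
      have : W.re - ⌊W₀.re⌋ = (W.re - W₀.re) + (W₀.re - ⌊W₀.re⌋) := by ring
      rw [this]
      exact (abs_add_le _ _).trans (by linarith [hW.1])
    refine heq.differentiableAt_iff.2 ?_
    have hd := (hM _ (hcone M ⌊W₀.re⌋ W₀ (by linarith) ((hfl W₀).trans one_le_two))).1
    exact (DifferentiableAt.comp (g := V) (f := fun W => W - (⌊W₀.re⌋ : ℂ)) W₀ hd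
      (by fun_prop)).add_const _
  · refine Eventually.of_forall fun W => ?_
    have : ⌊(W + 1).re⌋ = ⌊W.re⌋ + 1 := by simp
    simp only [this]
    push_cast
    rw [add_sub_add_right_eq_sub, add_assoc]
  · rw [Metric.tendsto_nhds]
    intro ε hε
    obtain ⟨M', hM'⟩ := exists_endCone (P := fun W => dist (V W - W) c < ε)
      (Metric.tendsto_nhds.1 hVlim ε hε)
    refine eventually_planeEnd.2 ⟨max M' 2, fun W hW => ?_⟩
    have := hM' _ (hcone M' ⌊W.re⌋ W hW ((hfl W).trans one_le_two))
    rwa [show V (W - ⌊W.re⌋) - (W - ⌊W.re⌋) = V (W - ⌊W.re⌋) + ⌊W.re⌋ - W by ring] at this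
  · refine ⟨max M 2, fun W h1 => ?_⟩
    have h3 : W - ((0 : ℤ) : ℂ) ∈ endCone p M := by
      rw [Int.cast_zero, sub_zero]; exact ⟨(le_max_left _ _).trans h1.1, h1.2⟩
    have h4 := hVz _ 0 _ (hcone M ⌊W.re⌋ _ h1.1 ((hfl _).trans one_le_two)) h3
    exact h4.trans (by rw [Int.cast_zero, sub_zero, add_zero])

/-- The transition function in position `p`. -/
theorem IsStandardFamily.exists_transition (hs : IsStandardFamily g k b D s)
    (hg : IsPrenormalized g k b) (hk : 1 ≤ k) (p : ℤ) :
    ∃ Ψ : ℂ → ℂ, (∀ᶠ W in planeEnd p, DifferentiableAt ℂ Ψ W) ∧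
      (∀ᶠ W in planeEnd p, Ψ (W + 1) = Ψ W + 1) ∧
      Tendsto (fun W => Ψ W - W) (planeEnd p)
        (𝓝 (-((endSign p : ℝ) * (Complex.I * Real.pi * b / k)))) ∧
      IsGluing k s Ψ p (Real.pi / 8 / k) := by
  obtain ⟨V, h1, h2, h3⟩ := hs.exists_transition_infSector hg hk p
  obtain ⟨Ψ, h4, h5, h6, M, h7⟩ := exists_periodic_extension p h1 h2
  refine ⟨Ψ, h4, h5, h6, (h3 M).mono fun z hz => ?_⟩
  rw [h7 _ hz.1, hz.2]

/-- Existence of normalized transition functions. -/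
theorem IsPrenormalized.exists_isTransition (hg : IsPrenormalized g k b) (hk : 1 ≤ k) :
    ∃ Ψ, IsTransition g k b Ψ := by
  have hkr : (0:ℝ) < k := by exact_mod_cast hk
  have hpi := Real.pi_pos
  obtain ⟨s, hs⟩ := hg.exists_isStandardFamily hk
  choose Ψ hΨ using hs.exists_transition hg hk
  have hα2 : Real.pi / 8 / k + Real.pi / (2 * k) < Real.pi / k := div_add_lt_pi_div hk (by linarith)
  set α := Real.pi / 8 / k + Real.pi / (2 * k) with hα
  have hα1 : Real.pi / (2 * k) < α := by
    have : 0 < Real.pi / 8 / k := by positivity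
    linarith
  have hρ : ∀ j : ℤ, ∃ ρ : ℝ, 0 < ρ ∧ ∀ r ≤ ρ, IsFatouCoordinate g k j α r (s j) := by
    intro j
    have hj := hs.coord j
    obtain ⟨ρ₁, h1, h2⟩ := hj.exists_injOn hk hα2
    obtain ⟨ρ₂, h3, h4⟩ := eventually_germSector.1 ((hj.differentiable _ hα2).and (hj.abel _ hα2))
    refine ⟨min ρ₁ ρ₂, lt_min h1 h3, fun r hr => ⟨?_, ?_, ?_⟩⟩
    · intro z hz
      exact (h4 z ⟨hz.1, hz.2.1.trans_le (hr.trans (min_le_right _ _)), hz.2.2⟩).1.differentiableWithinAt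
    · exact h2.mono (sector_subset le_rfl (hr.trans (min_le_left _ _)))
    · intro z hz _
      exact (h4 z ⟨hz.1, hz.2.1.trans_le (hr.trans (min_le_right _ _)), hz.2.2⟩).2
  choose ρ hρ0 hρ using hρ
  obtain ⟨r, hr0, hr⟩ : ∃ r : ℝ, 0 < r ∧ ∀ j ∈ Finset.Icc (-(k:ℤ)) k, r ≤ ρ j := by
    have hne : (Finset.Icc (-(k:ℤ)) k).Nonempty := ⟨0, by simp⟩
    refine ⟨(Finset.Icc (-(k:ℤ)) k).inf' hne ρ, (Finset.lt_inf'_iff hne).2 fun j _ => hρ0 j,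
      fun j hj => Finset.inf'_le _ hj⟩
  refine ⟨fun j => Ψ (midIndex j), α, r, s, hα1, hα2, hr0, fun j h1 h2 =>
    hρ j r (hr j (Finset.mem_Icc.2 ⟨h1, h2⟩)), ?_, fun j hj => ?_⟩
  · have := hs.periodic (-(k:ℤ)) 1
    rw [← this]; congr 1; ring
  · obtain ⟨h1, h2, h3, h4⟩ := hΨ (midIndex j)
    obtain ⟨n, hn⟩ := position_eq_midIndex k j
    have hend : farEnd j = planeEnd (midIndex j) := by
      rw [farEnd_eq_planeEnd k, hn, planeEnd_add_period]
    have hcon : constantTerm k b j = -((endSign (midIndex j) : ℝ) * (Complex.I * Real.pi * b / k)) := by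
      rw [constantTerm_eq, hn, mul_assoc, endSign_add_even]
    rw [hend, hcon]
    refine ⟨h1, h2, h3, ?_⟩
    obtain ⟨ρ', hρ', h5⟩ := eventually_germSector.1 h4
    obtain ⟨e1, e2, e3⟩ := midIndex_spec hj.1
    refine ⟨ρ', hρ', fun z hz => ?_⟩
    have hmid : (2 * j - j.sign) * Real.pi / (2 * k) = midDirection k (midIndex j) := by
      unfold midDirection
      have : (2 * (j:ℝ) - (j.sign : ℤ)) = 2 * (midIndex j : ℤ) - 1 := by exact_mod_cast e1
      rw [this]
    rw [hmid, hα, add_sub_cancel_right] at hz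
    have h6 := h5 z hz
    refine ⟨fun h => ?_, fun h => ?_⟩
    · rw [(e2 h).1, (e2 h).2] at h6; exact h6
    · rw [(e3 h).1, (e3 h).2] at h6; exact h6

end

/-! ### Action of conjugacies on the standard coordinates. -/

section

variable {k : ℕ}

theorem relArg_eq_sub {θ a : ℝ} {z : ℂ} (hz : z ≠ 0) (h : z = ‖z‖ * Complex.exp (a * Complex.I))
    (ha : |a - θ| < Real.pi) : relArg θ z = a - θ := by
  have h1 := abs_lt.1 ha
  have e : z * Complex.exp (-(θ * Complex.I)) =
      (‖z‖ : ℝ) * (Complex.cos (a - θ : ℝ) + Complex.sin (a - θ : ℝ) * Complex.I) := by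
    rw [← Complex.exp_mul_I]
    conv_lhs => rw [h, mul_assoc, ← Complex.exp_add]
    congr 2
    push_cast; ring
  unfold relArg
  rw [e, Complex.arg_mul_cos_add_sin_mul_I (norm_pos_iff.2 hz) ⟨h1.1, h1.2.le⟩]

/-- The petal whose bisector is closest to `z`. -/
noncomputable def nearestPetal (k : ℕ) (z : ℂ) : ℤ := round (k * z.arg / Real.pi)

theorem abs_arg_sub_nearestPetal (hk : 1 ≤ k) (z : ℂ) :
    |z.arg - direction k (nearestPetal k z)| ≤ Real.pi / (2 * k) := by
  have hkr : (0:ℝ) < k := by exact_mod_cast hk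
  have hpi := Real.pi_pos
  have h1 := abs_sub_round (k * z.arg / Real.pi)
  have h2 : z.arg - direction k (nearestPetal k z) =
      Real.pi / k * (k * z.arg / Real.pi - nearestPetal k z) := by
    unfold direction; field_simp
  rw [h2, abs_mul, abs_of_pos (by positivity)]
  calc Real.pi / k * |k * z.arg / Real.pi - nearestPetal k z| ≤ Real.pi / k * (1 / 2) := by
        gcongr; exact h1
    _ = Real.pi / (2 * k) := by field_simp

theorem abs_nearestPetal_le (z : ℂ) : -(k:ℤ) ≤ nearestPetal k z ∧ nearestPetal k z ≤ k := by
  have hpi := Real.pi_pos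
  have h := abs_le.1 (Complex.abs_arg_le_pi z)
  have hk0 : (0:ℝ) ≤ k := Nat.cast_nonneg k
  have h1 := abs_le.1 (abs_sub_round (k * z.arg / Real.pi))
  have h2 : k * z.arg / Real.pi ≤ k := by
    rw [div_le_iff₀ hpi]; exact mul_le_mul_of_nonneg_left h.2 hk0
  have h3 : -(k:ℝ) ≤ k * z.arg / Real.pi := by
    rw [le_div_iff₀ hpi]; nlinarith [mul_le_mul_of_nonneg_left h.1 hk0]
  unfold nearestPetal
  constructor
  · have : -(k:ℝ) - 1 < (round (k * z.arg / Real.pi) : ℤ) := by linarith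
    have : -(k:ℤ) - 1 < round (k * z.arg / Real.pi) := by exact_mod_cast this
    omega
  · have : ((round (k * z.arg / Real.pi) : ℤ) : ℝ) < k + 1 := by linarith
    have : round (k * z.arg / Real.pi) < (k:ℤ) + 1 := by exact_mod_cast this
    omega

theorem abs_relArg_nearestPetal (hk : 1 ≤ k) {z : ℂ} (hz : z ≠ 0) :
    |relArg (direction k (nearestPetal k z)) z| ≤ Real.pi / (2 * k) := by
  have hkr : (1:ℝ) ≤ k := by exact_mod_cast hk
  have h1 := abs_arg_sub_nearestPetal hk z
  have h2 : Real.pi / (2 * k) < Real.pi := by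
    rw [div_lt_iff₀ (by positivity)]; nlinarith [Real.pi_pos]
  rwa [relArg_eq_sub hz (Complex.norm_mul_exp_arg_mul_I z).symm (h1.trans_lt h2)]

/-- The petals cover a punctured neighbourhood of the origin. -/
theorem nhdsNE_le_iSup_germSector (hk : 1 ≤ k) {α : ℝ} (hα : Real.pi / (2 * k) < α) :
    𝓝[≠] (0:ℂ) ≤ ⨆ j ∈ Set.Icc (-(k:ℤ)) k, germSector (direction k j) α := by
  unfold germSector
  rw [← nhdsWithin_biUnion (Set.finite_Icc _ _), nhdsWithin_le_iff]
  filter_upwards [self_mem_nhdsWithin, nhdsWithin_le_nhds (Metric.ball_mem_nhds (0:ℂ) one_pos)]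
    with z hz hb
  have hz : z ≠ 0 := hz
  rw [mem_ball_zero_iff] at hb
  refine Set.mem_iUnion₂.2 ⟨nearestPetal k z, abs_nearestPetal_le z, norm_pos_iff.2 hz, hb, ?_⟩
  exact (abs_relArg_nearestPetal hk hz).trans_lt hα

theorem tendsto_nhdsNE_of_germSector (hk : 1 ≤ k) {α : ℝ} (hα : Real.pi / (2 * k) < α) {X : Type*}
    {f : ℂ → X} {l : Filter X} (h : ∀ j, Tendsto f (germSector (direction k j) α) l) :
    Tendsto f (𝓝[≠] 0) l := by
  refine Tendsto.mono_left ?_ (nhdsNE_le_iSup_germSector hk hα)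
  exact tendsto_iSup.2 fun j => tendsto_iSup.2 fun _ => h j

theorem eventually_nhdsNE_of_germSector (hk : 1 ≤ k) {α : ℝ} (hα : Real.pi / (2 * k) < α)
    {P : ℂ → Prop} (h : ∀ j, ∀ᶠ z in germSector (direction k j) α, P z) : ∀ᶠ z in 𝓝[≠] 0, P z := by
  have : Tendsto id (𝓝[≠] 0) (𝓟 {z | P z}) := tendsto_nhdsNE_of_germSector hk hα fun j =>
    tendsto_principal.2 (h j)
  exact tendsto_principal.1 this

theorem tendsto_mul_log_germSector (θ α : ℝ) :
    Tendsto (fun z => z * Complex.log (z * Complex.exp (-(θ * Complex.I)))) (germSector θ α) (𝓝 0) := by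
  have h0 : Tendsto (fun z : ℂ => ‖z‖) (germSector θ α) (𝓝 0) :=
    (tendsto_norm_zero (E := ℂ)).mono_left germSector_le_nhds
  have h1 : Tendsto (fun z : ℂ => |‖z‖ * Real.log ‖z‖| + ‖z‖ * Real.pi) (germSector θ α) (𝓝 0) := by
    have := ((Real.continuous_mul_log.tendsto 0).comp h0).abs.add (h0.mul_const Real.pi)
    simpa using this
  refine squeeze_zero_norm (fun z => ?_) h1
  rw [norm_mul, abs_mul, abs_of_nonneg (norm_nonneg z), ← mul_add]
  gcongr
  refine (Complex.norm_le_abs_re_add_abs_im _).trans ?_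
  rw [Complex.log_re, norm_mul, norm_exp_neg_mul_I, mul_one, Complex.log_im]
  gcongr
  exact Complex.abs_arg_le_pi _

/-- Its real part contains log‖z‖ → -∞. It excludes a difference of the formal invariants of two
conjugate germs, which would leave a multiple of log z in a function having a limit. -/
theorem not_tendsto_mul_log_germSector (hk : 1 ≤ k) {θ α : ℝ} (hα : 0 < α) {c L : ℂ} (hc : c ≠ 0) :
    ¬ Tendsto (fun z => c * Complex.log (z * Complex.exp (-(θ * Complex.I)))) (germSector θ α) (𝓝 L) := by
  intro h
  have := germSector_neBot hk θ hα
  have h1 := (Complex.continuous_re.tendsto _).comp (h.const_mul c⁻¹)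
  have h2 : Tendsto (fun z : ℂ => Real.log ‖z‖) (germSector θ α) atBot :=
    Real.tendsto_log_nhdsGT_zero.comp ((tendsto_norm_nhdsNE_zero (E := ℂ)).mono_left germSector_le)
  refine not_tendsto_nhds_of_tendsto_atBot h2 _ (h1.congr fun z => ?_)
  simp only [Function.comp]
  rw [inv_mul_cancel_left₀ hc, Complex.log_re, norm_mul, norm_exp_neg_mul_I, mul_one]

theorem tendsto_log_sub_of_tendsto_div {θ ψ α : ℝ} (hα : α < Real.pi) {h : ℂ → ℂ}
    (hh : Tendsto (fun z => h z / z) (germSector θ α) (𝓝 (Complex.exp (ψ * Complex.I)))) :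
    Tendsto (fun z => Complex.log (h z * Complex.exp (-(((θ + ψ : ℝ) : ℂ) * Complex.I))) -
      Complex.log (z * Complex.exp (-(θ * Complex.I)))) (germSector θ α) (𝓝 0) := by
  have h1 : Tendsto (fun z => h z / z * Complex.exp (-(ψ * Complex.I))) (germSector θ α) (𝓝 1) := by
    have := hh.mul_const (Complex.exp (-(ψ * Complex.I)))
    rwa [exp_mul_exp_neg] at this
  have h2 := (continuousAt_clog (show (1:ℂ) ∈ Complex.slitPlane by simp)).tendsto.comp h1
  rw [Complex.log_one] at h2
  have h3 := ((Complex.continuousAt_arg (show (1:ℂ) ∈ Complex.slitPlane by simp)).tendsto.comp h1).abs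
  rw [Complex.arg_one, abs_zero] at h3
  refine h2.congr' ?_
  filter_upwards [germSector_ne_zero, germSector_relArg, h1.eventually_ne one_ne_zero,
    h3.eventually (gt_mem_nhds (sub_pos.2 hα))] with z hz hz1 hq hq1
  have hw : z * Complex.exp (-(θ * Complex.I)) ≠ 0 := mul_ne_zero hz (Complex.exp_ne_zero _)
  have e : h z * Complex.exp (-(((θ + ψ : ℝ) : ℂ) * Complex.I)) =
      (h z / z * Complex.exp (-(ψ * Complex.I))) * (z * Complex.exp (-(θ * Complex.I))) := by
    push_cast
    rw [add_mul, neg_add, Complex.exp_add]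
    field_simp
  simp only [Function.comp] at hq1 ⊢
  rw [e, log_mul_of_abs_lt hq hw (by unfold relArg at hz1; linarith), add_sub_cancel_right]

theorem exp_direction_pow_even (hk : 1 ≤ k) (m : ℤ) :
    Complex.exp ((direction k (2 * m) : ℝ) * Complex.I) ^ k = 1 := by
  have h1 := exp_direction_pow hk (2 * m)
  rw [(even_two_mul m).neg_one_zpow, Complex.exp_neg, inv_pow, inv_eq_one] at h1
  exact h1

theorem direction_add (k : ℕ) (i j : ℤ) : direction k (i + j) = direction k i + direction k j := by
  unfold direction; push_cast; ring

/-- A conjugacy acts on the standard coordinates by a permutation and a common translation. -/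
theorem IsConjugacy.exists_eq_add {h g₀ g₁ : ℂ → ℂ} {b₀ b₁ D₀ D₁ : ℂ} {s₀ s₁ : ℤ → ℂ → ℂ} {m : ℤ}
    (hh : IsConjugacy h g₀ g₁) (hk : 1 ≤ k) (hg₀ : IsPrenormalized g₀ k b₀)
    (hs₀ : IsStandardFamily g₀ k b₀ D₀ s₀)
    (hs₁ : IsStandardFamily g₁ k b₁ D₁ s₁)
    (hm : deriv h 0 = Complex.exp ((direction k (2 * m) : ℝ) * Complex.I))
    {α : ℝ} (hα : Real.pi / (2 * k) < α) (hα1 : α < Real.pi / k) :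
    b₁ = b₀ ∧ ∃ C : ℂ, ∀ j, ∀ᶠ z in germSector (direction k j) α, s₁ (j + 2 * m) (h z) = s₀ j z + C := by
  have hk0 := natCast_ne_zero_of_pos hk
  have hpk : 0 < Real.pi / (2 * k) := by have := Real.pi_pos; positivity
  obtain ⟨α₁, ha1, ha2⟩ := exists_between hα1
  obtain ⟨α₂, ha3, ha4⟩ := exists_between ha2
  obtain ⟨α₃, ha5, ha6⟩ := exists_between ha4
  obtain ⟨α₅, ha9, ha10⟩ := exists_between ha6
  have hq := tendsto_div_of_deriv hh.analyticAt.differentiableAt hh.map_zero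
  rw [hm] at hq
  have hmap : ∀ j, ∀ α' α'', α' < α'' → α'' < Real.pi / k →
      Tendsto h (germSector (direction k j) α') (germSector (direction k (j + 2 * m)) α'') := by
    intro j α' α'' h1 h2
    rw [direction_add]
    exact tendsto_germSector h1 (h2.le.trans (pi_div_le hk)) (hq.mono_left germSector_le)
  have hqk : Tendsto (fun z => (z / h z) ^ k) (𝓝[≠] 0) (𝓝 1) := by
    have h1 := (hq.inv₀ (Complex.exp_ne_zero _)).pow k
    rw [inv_pow, exp_direction_pow_even hk, inv_one] at h1
    exact h1.congr fun z => by rw [inv_div]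
  have hne := eventually_ne_zero_of_tendsto_div (Complex.exp_ne_zero _) hq
  have hdiff : ∀ᶠ z in 𝓝 (0:ℂ), DifferentiableAt ℂ h z :=
    hh.analyticAt.eventually_analyticAt.mono fun z hz => hz.differentiableAt
  -- Pulling back a standard coordinate of g₁ by h gives a Fatou coordinate of g₀ on each petal,
  -- hence the standard one up to a constant, possibly depending on j.
  have hC : ∀ j, ∃ C, ∀ᶠ z in germSector (direction k j) α, s₁ (j + 2 * m) (h z) = s₀ j z + C := by
    intro j
    have hsj := hs₁.coord (j + 2 * m)
    have hd : ∀ᶠ z in germSector (direction k j) α₃,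
        DifferentiableAt ℂ (fun z => s₁ (j + 2 * m) (h z)) z := by
      filter_upwards [(hmap j α₃ _ ha9 ha10).eventually
        (hsj.differentiable _ ha10), hdiff.filter_mono germSector_le_nhds] with z h1 h2
      exact DifferentiableAt.comp z h1 h2
    have hkα : k * (α₃ : ℝ) ≤ Real.pi := (mul_lt_pi hk (by linarith)).le
    obtain ⟨α₄, ha7, ha8⟩ := exists_between ha5
    refine (hs₀.coord j).exists_eq_add hg₀ hk (α := α₄) (by linarith) (by linarith) (by linarith)
      (hd.filter_mono (germSector_mono ha8.le)) ?_ (exists_injOn_of_petalMap hk ha8 (by linarith) ?_ ?_)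
    · have h1 := hh.conj_eq.filter_mono (germSector_le_nhds (θ := direction k j) (α := α₄))
      filter_upwards [h1, (hmap j α₄ α₃ ha8 (by linarith)).eventually (hsj.abel _ (by linarith))]
        with z h2 h3
      simp only [Function.comp] at h2
      rw [h2, h3]
    · refine eventually_differentiableAt_petalMap hk hkα ?_
      rwa [mul_div_cancel_left₀ _ (by exact_mod_cast (by omega : k ≠ 0))]
    · have h1 := (hsj.tendsto_mul hk ha10).comp (hmap j α₃ _ ha9 ha10)
      have h2 : Tendsto (fun z => -(s₁ (j + 2 * m) (h z) * (k * z ^ k)))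
          (germSector (direction k j) α₃) (𝓝 1) := by
        have h3 := (h1.mul (hqk.mono_left germSector_le)).neg
        rw [mul_one, neg_neg] at h3
        refine h3.congr' ?_
        filter_upwards [hne.filter_mono germSector_le] with z hz
        simp only [Function.comp, div_pow]
        field_simp
      have h3 := h2.comp (tendsto_unchart hk (direction k j) hkα |>.mono_right
        (by rw [mul_div_cancel_left₀ _ (by exact_mod_cast (by omega : k ≠ 0))]))
      refine h3.congr' ?_
      filter_upwards [infSector_ne_zero] with X hX
      have h4 := petalSign_mul_chart hk j (unchart k (direction k j) X)
      rw [chart_unchart hk _ hX] at h4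
      have hp := petalSign_mul_self j
      have hp0 := petalSign_ne_zero j
      have h5 : (k : ℂ) * unchart k (direction k j) X ^ k = -(petalSign j * X)⁻¹ := by
        rw [h4, inv_neg, neg_neg, inv_inv]
      simp only [Function.comp, petalMap, h5]
      field_simp
      linear_combination (-(s₁ (j + 2 * m) (h (unchart k (direction k j) X)))) * hp
  choose C hC using hC
  -- The difference of the polar terms is single-valued around 0. On the j-th petal it is (b₁ - b₀)
  -- log z + D₁ - D₀ - C_j + o(1), so z N tends to 0 and the singularity is removable. Its limit at
  -- 0 excludes the logarithm, giving b₁ = b₀, and does not depend on the petal, so neither does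
  -- C_j.
  set N : ℂ → ℂ := fun z => ((k:ℂ) * h z ^ k)⁻¹ - ((k:ℂ) * z ^ k)⁻¹ with hN
  have hlim : ∀ j, Tendsto (fun z => N z -
      (b₁ - b₀) * Complex.log (z * Complex.exp (-((direction k j : ℝ) * Complex.I))))
      (germSector (direction k j) α) (𝓝 (D₁ - D₀ - C j)) := by
    intro j
    have h1 := ((hs₁.coord (j + 2 * m)).expansion α₁ ha2).comp (hmap j α α₁ ha1 ha2)
    have h2 := (hs₀.coord j).expansion α hα1
    have h3 := (tendsto_log_sub_of_tendsto_div (hα1.trans_le (pi_div_le hk)) (θ := direction k j)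
      (hq.mono_left germSector_le)).const_mul b₁
    rw [← direction_add, mul_zero] at h3
    have h4 := ((h1.sub h2).sub_const (C j)).add h3
    rw [add_zero] at h4
    refine h4.congr' ?_
    filter_upwards [hC j] with z hz
    simp only [Function.comp, hN]
    rw [hz]; ring
  have hzN : Tendsto (fun z => z * N z) (𝓝[≠] 0) (𝓝 0) := by
    refine tendsto_nhdsNE_of_germSector hk hα fun j => ?_
    have h0 : Tendsto (fun z : ℂ => z) (germSector (direction k j) α) (𝓝 0) :=
      tendsto_id.mono_left germSector_le_nhds
    have h1 := (h0.mul (hlim j)).add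
      ((tendsto_mul_log_germSector (direction k j) α).const_mul (b₁ - b₀))
    rw [zero_mul, mul_zero, add_zero] at h1
    refine h1.congr fun z => by ring
  have hNd : ∀ᶠ z in 𝓝[≠] 0, DifferentiableAt ℂ N z := by
    filter_upwards [self_mem_nhdsWithin, hne, nhdsWithin_le_nhds hdiff] with z hz h1 h2
    have hz : z ≠ 0 := hz
    have e1 : (k:ℂ) * h z ^ k ≠ 0 := mul_ne_zero hk0 (pow_ne_zero _ h1)
    have e2 : (k:ℂ) * z ^ k ≠ 0 := mul_ne_zero hk0 (pow_ne_zero _ hz)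
    exact (((h2.pow k).const_mul _).inv e1).sub (DifferentiableAt.inv (by fun_prop) e2)
  have hNlim := Complex.tendsto_limUnder_of_differentiable_on_punctured_nhds_of_isLittleO hNd (by
    have h0 : Tendsto (fun z : ℂ => z) (𝓝[≠] 0) (𝓝 0) := tendsto_id.mono_left nhdsWithin_le_nhds
    have h1 := hzN.sub (h0.mul_const (N 0))
    rw [zero_mul, sub_zero] at h1
    rw [isLittleO_iff_tendsto']
    · refine h1.congr fun z => ?_
      rw [sub_zero, div_inv_eq_mul]; ring
    · filter_upwards [self_mem_nhdsWithin] with z hz h2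
      have hz : z ≠ 0 := hz
      simp [hz] at h2)
  set N₀ := limUnder (𝓝[≠] (0:ℂ)) N
  have hb : b₁ = b₀ := by
    by_contra hb
    have h1 := (hNlim.mono_left (germSector_le (θ := direction k 0) (α := α))).sub (hlim 0)
    refine not_tendsto_mul_log_germSector hk (hpk.trans hα) (sub_ne_zero.2 hb) (h1.congr fun z => ?_)
    ring
  refine ⟨hb, D₁ - D₀ - N₀, fun j => ?_⟩
  have h1 := hlim j
  rw [hb, sub_self] at h1
  simp only [zero_mul, sub_zero] at h1
  have := germSector_neBot hk (direction k j) (hpk.trans hα)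
  have h2 := tendsto_nhds_unique h1 (hNlim.mono_left germSector_le)
  filter_upwards [hC j] with z hz
  rw [hz, ← h2]; ring

end

/-! ### Germs with the same transition functions are conjugate. -/

section

variable {k : ℕ}

theorem petalSign_add_even (j m : ℤ) : petalSign (j + 2 * m) = petalSign j := by
  rw [petalSign_eq, petalSign_eq, endSign_add_even]

/-- On one petal take f = s₁⁻¹ ∘ s₀. In the charts at infinity both factors are asymptotic to the
identity, so f is tangent to the rotation carrying the petal j to the petal j + 2m; an even shift
preserves the attracting or repelling type. -/
theorem exists_sectorial_conjugacy {g₀ g₁ : ℂ → ℂ} {b₀ b₁ D₀ D₁ : ℂ} {s₀ s₁ : ℂ → ℂ} {j m : ℤ}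
    (hk : 1 ≤ k) (hs₀ : IsStandardCoordinate g₀ k b₀ D₀ j s₀)
    (hs₁ : IsStandardCoordinate g₁ k b₁ D₁ (j + 2 * m) s₁) {α : ℝ} (hα : α < Real.pi / k) :
    ∃ f : ℂ → ℂ,
      (∀ᶠ z in germSector (direction k j) α, DifferentiableAt ℂ f z ∧ s₁ (f z) = s₀ z) ∧
      Tendsto (fun z => f z / z) (germSector (direction k j) α)
        (𝓝 (Complex.exp ((direction k (2 * m) : ℝ) * Complex.I))) := by
  obtain ⟨β₁, h1, h2⟩ := exists_between (mul_lt_pi hk hα)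
  obtain ⟨β₂, h3, h4⟩ := exists_between h2
  have hβ := mul_lt_pi hk hα
  set F := petalMap k j s₀ with hF
  have hFd := hs₀.eventually_differentiableAt_petalMap hk hβ
  have hFt := hs₀.tendsto_petalMap_div hk hβ
  have hFm : Tendsto F (infSector (k * α)) (infSector β₁) := tendsto_infSector h1 h2.le hFt
  obtain ⟨G, hG, hGt, -⟩ := exists_inverse h3 h4.le (hs₁.eventually_differentiableAt_petalMap hk h4)
    (hs₁.tendsto_petalMap_div hk h4)
  have hGm : Tendsto G (infSector β₁) (infSector β₂) := tendsto_infSector h3 h4.le hGt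
  have hKt : Tendsto (fun X => G (F X) / X) (infSector (k * α)) (𝓝 1) := by
    have := (hGt.comp hFm).mul hFt
    rw [mul_one] at this
    refine this.congr' ?_
    filter_upwards [hFm.eventually infSector_ne_zero] with X hX
    simp only [Function.comp]
    rw [← hF, div_mul_div_cancel₀ hX]
  set f : ℂ → ℂ := fun z => unchart k (direction k (j + 2 * m)) (G (F (chart k (direction k j) z)))
    with hf
  have hch := tendsto_chart hk (θ := direction k j) hα.le
  refine ⟨f, ?_, ?_⟩
  · filter_upwards [hch.eventually hFd, (hFm.comp hch).eventually hG,
      (hGm.comp (hFm.comp hch)).eventually infSector_ne_zero,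
      (hGm.comp (hFm.comp hch)).eventually eventually_infSector_arg, germSector_ne_zero,
      eventually_unchart_chart hk hα.le] with z a1 a2 a3 a4 a5 a6
    simp only [Function.comp] at a2 a3 a4
    refine ⟨?_, ?_⟩
    · refine DifferentiableAt.comp (g := unchart k (direction k (j + 2 * m)))
        (f := fun z => G (F (chart k (direction k j) z))) z
        (differentiableAt_unchart hk _ a3 (a4.trans h4)) ?_
      refine DifferentiableAt.comp (g := G) (f := fun z => F (chart k (direction k j) z)) z a2.1 ?_
      exact DifferentiableAt.comp (g := F) z a1 (differentiableAt_chart hk _ a5)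
    · have e1 := a2.2
      simp only [petalMap, hF, petalSign_add_even, a6] at e1
      have e2 := mul_left_cancel₀ (petalSign_ne_zero j) e1
      simp only [hf, hF, petalMap, a6]
      exact e2
  · refine tendsto_germSector_of_infSector hk hα.le ?_
    have h5 := tendsto_unchart_div hk (θ := direction k j) (θ' := direction k (j + 2 * m)) hβ hKt
    rw [direction_add, add_sub_cancel_left] at h5
    refine h5.congr' ?_
    filter_upwards [infSector_ne_zero] with X hX
    simp only [hf]
    rw [chart_unchart hk _ hX, direction_add]

theorem eventually_germSector_nhds {θ α : ℝ} (hα : α ≤ Real.pi) {P : ℂ → Prop}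
    (h : ∀ᶠ z in germSector θ α, P z) : ∀ᶠ z in germSector θ α, ∀ᶠ w in 𝓝 z, P w := by
  obtain ⟨ρ, hρ, h⟩ := eventually_germSector.1 h
  refine eventually_germSector.2 ⟨ρ, hρ, fun z hz => ?_⟩
  filter_upwards [(isOpen_sector hα).mem_nhds hz] with w hw using h w hw

theorem eq_norm_mul_exp_relArg (θ : ℝ) (z : ℂ) :
    z = ‖z‖ * Complex.exp (((θ + relArg θ z : ℝ) : ℂ) * Complex.I) := by
  have h1 := Complex.norm_mul_exp_arg_mul_I (z * Complex.exp (-(θ * Complex.I)))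
  rw [norm_mul, norm_exp_neg_mul_I, mul_one] at h1
  have h2 := exp_mul_exp_neg θ
  unfold relArg
  push_cast
  rw [add_mul, Complex.exp_add]
  linear_combination (-(Complex.exp (θ * Complex.I))) * h1 - z * h2

/-- Two petals that meet near their bisecting halves are equal or adjacent. -/
theorem exists_adjacent (hk : 1 ≤ k) {i j : ℤ} {z : ℂ} (hz : z ≠ 0) {η : ℝ}
    (hη : η ≤ Real.pi / (2 * k) / 2)
    (hi : |relArg (direction k i) z| ≤ Real.pi / (2 * k))
    (hj : |relArg (direction k j) z| < Real.pi / (2 * k) + η) :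
    ∃ n : ℤ, i = j + 2 * k * n ∨
      (i = j + 1 + 2 * k * n ∧ |relArg (midDirection k (j + 1)) z| ≤ η) ∨
      (i = j - 1 + 2 * k * n ∧ |relArg (midDirection k j) z| ≤ η) := by
  have hkr : (0:ℝ) < k := by exact_mod_cast hk
  have hpi := Real.pi_pos
  set x := relArg (direction k i) z with hx
  set y := relArg (direction k j) z with hy
  have e1 := eq_norm_mul_exp_relArg (direction k i) z
  have e2 := eq_norm_mul_exp_relArg (direction k j) z
  rw [← hx] at e1
  rw [← hy] at e2
  have hn : (‖z‖ : ℂ) ≠ 0 := by exact_mod_cast norm_ne_zero_iff.2 hz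
  have e3 := mul_left_cancel₀ hn (e1.symm.trans e2)
  obtain ⟨n, e4⟩ := Complex.exp_eq_exp_iff_exists_int.1 e3
  have e5 : direction k i + x = direction k j + y + n * (2 * Real.pi) := by
    have := congrArg Complex.im e4
    simpa using this
  set q := Real.pi / (2 * k) with hq
  have hq0 : 0 < q := by positivity
  -- The bisectors differ by an integral multiple of 2q = π/k modulo full turns, and |y - x| < 4q,
  -- so that integer is -1, 0 or 1.
  have e6 : (i - j - 2 * k * n : ℝ) * (2 * q) = y - x := by
    have : direction k i - direction k j - n * (2 * Real.pi) = (i - j - 2 * k * n : ℝ) * (2 * q) := by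
      rw [hq]; unfold direction; field_simp
    rw [← this]; linarith
  have hx' := abs_le.1 hi
  have hy' := abs_lt.1 hj
  have e7 : (i - j - 2 * k * n : ℝ) < 2 := by
    by_contra h
    have := mul_le_mul_of_nonneg_right (not_lt.1 h) (show 0 ≤ 2 * q by linarith)
    linarith
  have e8 : (-2 : ℝ) < (i - j - 2 * k * n : ℝ) := by
    by_contra h
    have := mul_le_mul_of_nonneg_right (not_lt.1 h) (show 0 ≤ 2 * q by linarith)
    linarith
  have e7' : i - j - 2 * k * n < 2 := by exact_mod_cast e7
  have e8' : -2 < i - j - 2 * k * n := by exact_mod_cast e8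
  have hqpi : q ≤ Real.pi / 2 := by
    have hk1 : (1:ℝ) ≤ k := by exact_mod_cast hk
    rw [hq, div_le_div_iff₀ (by positivity) (by positivity)]; nlinarith
  refine ⟨n, ?_⟩
  obtain h | h | h : i - j - 2 * k * n = 0 ∨ i - j - 2 * k * n = 1 ∨ i - j - 2 * k * n = -1 := by omega
  · left; linarith
  · right; left
    refine ⟨by linarith, ?_⟩
    have h' : (i - j - 2 * k * n : ℝ) = 1 := by exact_mod_cast h
    rw [h'] at e6
    have e9 : midDirection k (j + 1) = direction k j + q := by
      rw [show direction k j = direction k (j + 1 - 1) by ring_nf, direction_eq_mid_sub hk]; ring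
    rw [relArg_eq_sub hz e2 (by rw [e9, abs_lt]; constructor <;> linarith), e9, abs_le]
    constructor <;> linarith
  · right; right
    refine ⟨by linarith, ?_⟩
    have h' : (i - j - 2 * k * n : ℝ) = -1 := by exact_mod_cast h
    rw [h'] at e6
    have e9 : midDirection k j = direction k j - q := by
      rw [direction_eq_mid_add hk]; ring
    rw [relArg_eq_sub hz e2 (by rw [e9, abs_lt]; constructor <;> linarith), e9, abs_le]
    constructor <;> linarith

theorem germSector_period (hk : 1 ≤ k) (j n : ℤ) (α : ℝ) :
    germSector (direction k (j + 2 * k * n)) α = germSector (direction k j) α := by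
  rw [direction_add_period hk, germSector_add_int_mul]

/-- Holomorphic maps on the petals that agree on the middle sectors come from a holomorphic
germ. -/
theorem exists_germ_of_sectorial (hk : 1 ≤ k) {f : ℤ → ℂ → ℂ} {c : ℂ} {α δ : ℝ}
    (hα : Real.pi / (2 * k) < α) (hα1 : α < Real.pi / k) (hδ : 0 < δ)
    (hper : ∀ j n : ℤ, f (j + 2 * k * n) = f j)
    (hd : ∀ j, ∀ᶠ z in germSector (direction k j) α, DifferentiableAt ℂ (f j) z)
    (ht : ∀ j, Tendsto (fun z => f j z / z) (germSector (direction k j) α) (𝓝 c))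
    (hmid : ∀ p, ∀ᶠ z in germSector (midDirection k p) δ, f p z = f (p - 1) z) :
    ∃ h : ℂ → ℂ, AnalyticAt ℂ h 0 ∧ h 0 = 0 ∧ Tendsto (fun z => h z / z) (𝓝[≠] 0) (𝓝 c) ∧
      ∃ α', Real.pi / (2 * k) < α' ∧ α' < α ∧
        ∀ j, ∀ᶠ z in germSector (direction k j) α', h z = f j z := by
  have hpi := Real.pi_pos
  have hkr : (0:ℝ) < k := by exact_mod_cast hk
  set q := Real.pi / (2 * k) with hq
  have hq0 : 0 < q := by positivity
  set η := min (q / 2) (min (δ / 2) ((α - q) / 2)) with hη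
  have hη0 : 0 < η := lt_min (by linarith) (lt_min (by linarith) (by linarith))
  have hη1 : η ≤ q / 2 := min_le_left _ _
  have hη2 : η < δ := ((min_le_right _ _).trans (min_le_left _ _)).trans_lt (by linarith)
  have hη3 : q + η < α := by
    have : η ≤ (α - q) / 2 := (min_le_right _ _).trans (min_le_right _ _)
    linarith
  set h : ℂ → ℂ := fun z => if z = 0 then 0 else f (nearestPetal k z) z with hh
  -- Widening the half-petal by η, the nearest petal can only be the j-th or an adjacent one; in the
  -- latter case z is within η < δ of the middle direction, where the two maps agree.
  have hclaim : ∀ j, ∀ᶠ z in germSector (direction k j) (q + η), h z = f j z := by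
    intro j
    obtain ⟨ρ₁, h1, h2⟩ := eventually_germSector.1 (hmid j)
    obtain ⟨ρ₂, h3, h4⟩ := eventually_germSector.1 (hmid (j + 1))
    refine eventually_germSector.2 ⟨min ρ₁ ρ₂, lt_min h1 h3, fun z hz => ?_⟩
    have hz0 : z ≠ 0 := norm_pos_iff.1 hz.1
    simp only [hh, if_neg hz0]
    obtain ⟨n, e | ⟨e, h5⟩ | ⟨e, h5⟩⟩ := exists_adjacent hk hz0 hη1 (abs_relArg_nearestPetal hk hz0)
      hz.2.2
    · rw [e, hper]
    · rw [e, hper]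
      have := h4 z ⟨hz.1, hz.2.1.trans_le (min_le_right _ _), h5.trans_lt hη2⟩
      rwa [add_sub_cancel_right] at this
    · rw [e, hper]
      exact (h2 z ⟨hz.1, hz.2.1.trans_le (min_le_left _ _), h5.trans_lt hη2⟩).symm
  have hlim : Tendsto (fun z => h z / z) (𝓝[≠] 0) (𝓝 c) := by
    refine tendsto_nhdsNE_of_germSector hk (show q < q + η by linarith) fun j => ?_
    refine ((ht j).mono_left (germSector_mono hη3.le)).congr' ?_
    filter_upwards [hclaim j] with z hz
    rw [hz]
  have hdiff : ∀ᶠ z in 𝓝[≠] 0, DifferentiableAt ℂ h z := by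
    refine eventually_nhdsNE_of_germSector hk (show q < q + η by linarith) fun j => ?_
    filter_upwards [(hd j).filter_mono (germSector_mono hη3.le),
      eventually_germSector_nhds (by linarith [pi_div_le hk]) (hclaim j)] with z h1 h2
    exact (EventuallyEq.differentiableAt_iff h2).2 h1
  have h0 : h 0 = 0 := by simp [hh]
  refine ⟨h, ?_, h0, hlim, q + η, by linarith, hη3, hclaim⟩
  exact Complex.analyticAt_of_differentiable_on_punctured_nhds_of_continuousAt hdiff
    (hasDerivAt_of_tendsto_div h0 hlim).continuousAt

/-- Germs with the same transition functions are conjugate. -/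
theorem exists_isConjugacy_of_isGluing {g₀ g₁ : ℂ → ℂ} {b₀ b₁ D₀ D₁ : ℂ} {s₀ s₁ : ℤ → ℂ → ℂ}
    {m : ℤ} (hk : 1 ≤ k) (hg₀ : IsPrenormalized g₀ k b₀) (hg₁ : IsPrenormalized g₁ k b₁)
    (hs₀ : IsStandardFamily g₀ k b₀ D₀ s₀) (hs₁ : IsStandardFamily g₁ k b₁ D₁ s₁) {δ : ℝ}
    (hδ : 0 < δ) (hglue : ∀ p, ∃ Ψ, IsGluing k s₀ Ψ p δ ∧ IsGluing k s₁ Ψ (p + 2 * m) δ) :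
    ∃ h, IsConjugacy h g₀ g₁ ∧
      deriv h 0 = Complex.exp ((direction k (2 * m) : ℝ) * Complex.I) ∧
      ∃ α, Real.pi / (2 * k) < α ∧ α < Real.pi / k ∧
        ∀ j, ∀ᶠ z in germSector (direction k j) α, s₁ (j + 2 * m) (h z) = s₀ j z := by
  have hpi := Real.pi_pos
  have hkr : (0:ℝ) < k := by exact_mod_cast hk
  have hq0 : 0 < Real.pi / (2 * k) := by positivity
  have hq1 := pi_div_two_mul_add hk
  obtain ⟨α, ha1, ha2⟩ := exists_between (show Real.pi / (2 * k) < Real.pi / k by linarith)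
  obtain ⟨α₁, ha3, ha4⟩ := exists_between ha2
  choose F hF hFt using fun j => exists_sectorial_conjugacy (m := m) hk (hs₀.coord j)
    (hs₁.coord (j + 2 * m)) ha2
  set c := Complex.exp ((direction k (2 * m) : ℝ) * Complex.I) with hc
  -- The maps are chosen petal by petal; reduction modulo 2k makes the choice single-valued around
  -- 0.
  set f : ℤ → ℂ → ℂ := fun j => F (j % (2 * k)) with hf
  have hmod : ∀ j : ℤ, j = j % (2 * (k:ℤ)) + 2 * k * (j / (2 * k)) := fun j =>
    (Int.emod_add_mul_ediv j (2 * k)).symm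
  have hper : ∀ j n : ℤ, f (j + 2 * k * n) = f j := fun j n => by
    simp only [hf, Int.add_mul_emod_self_left]
  have hfs : ∀ j, ∀ᶠ z in germSector (direction k j) α,
      DifferentiableAt ℂ (f j) z ∧ s₁ (j + 2 * m) (f j z) = s₀ j z := by
    intro j
    have h1 := hF (j % (2 * k))
    have e0 := hs₀.periodic (j % (2 * k)) (j / (2 * k))
    have e1 := hs₁.periodic (j % (2 * k) + 2 * m) (j / (2 * k))
    rw [add_right_comm] at e1
    rw [← germSector_period hk _ (j / (2 * k)), ← e0, ← e1, ← hmod j] at h1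
    exact h1
  have hft : ∀ j, Tendsto (fun z => f j z / z) (germSector (direction k j) α) (𝓝 c) := by
    intro j
    have h1 := hFt (j % (2 * k))
    rw [← germSector_period hk _ (j / (2 * k)), ← hmod j] at h1
    exact h1
  have hmap : ∀ j, Tendsto (f j) (germSector (direction k j) α)
      (germSector (direction k (j + 2 * m)) α₁) := fun j => by
    rw [direction_add]; exact tendsto_germSector ha3 (ha4.le.trans (pi_div_le hk)) (hft j)
  have hmid_add : ∀ p, midDirection k (p + 2 * m) = midDirection k p + direction k (2 * m) := by
    intro p
    unfold midDirection direction; push_cast; field_simp; ring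
  have hmid : ∀ p, ∀ᶠ z in germSector (midDirection k p) (min (δ / 2) (α - Real.pi / (2 * k))),
      f p z = f (p - 1) z := by
    intro p
    set ε := min (δ / 2) (α - Real.pi / (2 * k)) with hε
    have hεδ : ε < δ := (min_le_left _ _).trans_lt (by linarith)
    have hεα : ε + Real.pi / (2 * k) ≤ α := by linarith [min_le_right (δ / 2) (α - Real.pi / (2 * k))]
    have hle : ∀ i, i = p ∨ i = p - 1 → germSector (midDirection k p) ε ≤
        germSector (direction k i) α := fun i hi => germSector_mid_le hk hi hεα ha2.le
    obtain ⟨Ψ, h1, h2⟩ := hglue p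
    unfold IsGluing at h1 h2
    rw [source_add_even, target_add_even] at h2
    have hmapp : Tendsto (f (source p)) (germSector (midDirection k p) ε)
        (germSector (midDirection k (p + 2 * m)) (min δ (Real.pi))) := by
      rw [hmid_add]
      exact tendsto_germSector (lt_min hεδ (by linarith [pi_div_le hk])) (min_le_right _ _)
        ((hft _).mono_left (hle _ (source_eq_or p)))
    have hsrc : Tendsto (f (source p)) (germSector (midDirection k p) ε)
        (germSector (direction k (target p + 2 * m)) α₁) := by
      have hi : target p + 2 * m = p + 2 * m ∨ target p + 2 * m = p + 2 * m - 1 := by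
        rcases target_eq_or p with h | h <;> rw [h]
        · left; rfl
        · right; ring
      have h5 : Tendsto (f (source p)) (germSector (midDirection k p) ε)
          (germSector (midDirection k (p + 2 * m)) (α₁ - Real.pi / (2 * k))) := by
        rw [hmid_add]
        exact tendsto_germSector (by linarith) (by linarith [pi_div_le hk])
          ((hft _).mono_left (hle _ (source_eq_or p)))
      exact h5.mono_right (germSector_mid_le hk hi (by linarith) ha4.le)
    have htgt := (hmap (target p)).mono_left (hle _ (target_eq_or p))
    obtain ⟨ρ, hρ, hinj⟩ := (hs₁.coord (target p + 2 * m)).exists_injOn hk ha4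
    have hmem : ∀ᶠ w in germSector (direction k (target p + 2 * m)) α₁,
        w ∈ sector (direction k (target p + 2 * m)) α₁ ρ :=
      eventually_germSector.2 ⟨ρ, hρ, fun _ h => h⟩
    -- Both maps have the same image under the target coordinate of g₁: going through the source, Ψ
    -- ∘ s₁ ∘ f = Ψ ∘ s₀ is the target coordinate s₀ again. Injectivity concludes.
    have heq : ∀ᶠ z in germSector (midDirection k p) ε, f (target p) z = f (source p) z := by
      filter_upwards [h1.filter_mono (germSector_mono hεδ.le),
        hmapp.eventually (h2.filter_mono (germSector_mono (min_le_left _ _))),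
        (hfs _).filter_mono (hle _ (source_eq_or p)), (hfs _).filter_mono (hle _ (target_eq_or p)),
        hsrc.eventually hmem, htgt.eventually hmem] with z b1 b2 b3 b4 b5 b6
      refine hinj b6 b5 ?_
      rw [b4.2, ← b1, ← b2, b3.2]
    filter_upwards [heq] with z hz
    unfold source target at hz
    split_ifs at hz
    · exact hz
    · exact hz.symm
  obtain ⟨h, hha, h0, hlim, α', hb1, hb2, hheq⟩ := exists_germ_of_sectorial hk ha1 ha2
    (lt_min (by linarith) (by linarith)) hper (fun j => (hfs j).mono fun z hz => hz.1) hft hmid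
  have hder := (hasDerivAt_of_tendsto_div h0 hlim).deriv
  have hspec : ∀ j, ∀ᶠ z in germSector (direction k j) α', s₁ (j + 2 * m) (h z) = s₀ j z := by
    intro j
    filter_upwards [hheq j, (hfs j).filter_mono (germSector_mono hb2.le)] with z h1 h2
    rw [h1, h2.2]
  obtain ⟨α'', hc1, hc2⟩ := exists_between hb1
  -- On each petal both sides have the s₁-coordinate s₀(z) + 1, and s₁ is injective.
  have hconj : ∀ᶠ z in 𝓝[≠] (0:ℂ), h (g₀ z) = g₁ (h z) := by
    refine eventually_nhdsNE_of_germSector hk hc1 fun j => ?_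
    have hgm : Tendsto g₀ (germSector (direction k j) α'') (germSector (direction k j) α') :=
      tendsto_germSector_of_tangent hc2 (by linarith [pi_div_le hk])
        ((hg₀.tendsto_div hk).mono_left germSector_le)
    have hhm : Tendsto h (germSector (direction k j) α') (germSector (direction k (j + 2 * m)) α) := by
      rw [direction_add]
      exact tendsto_germSector hb2 (by linarith [pi_div_le hk]) (hlim.mono_left germSector_le)
    have hgm1 : Tendsto g₁ (germSector (direction k (j + 2 * m)) α)
        (germSector (direction k (j + 2 * m)) α₁) :=
      tendsto_germSector_of_tangent ha3 (by linarith [pi_div_le hk])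
        ((hg₁.tendsto_div hk).mono_left germSector_le)
    have hid : Tendsto id (germSector (direction k j) α'') (germSector (direction k j) α') :=
      tendsto_id.mono_right (germSector_mono hc2.le)
    obtain ⟨ρ, hρ, hinj⟩ := (hs₁.coord (j + 2 * m)).exists_injOn hk ha4
    have hmem : ∀ᶠ w in germSector (direction k (j + 2 * m)) α₁,
        w ∈ sector (direction k (j + 2 * m)) α₁ ρ :=
      eventually_germSector.2 ⟨ρ, hρ, fun _ h => h⟩
    have hmem' := hmem.filter_mono (germSector_mono ha3.le)
    filter_upwards [(hhm.comp hgm).eventually hmem', ((hgm1.comp hhm).comp hid).eventually hmem,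
      hgm.eventually (hspec j), hid.eventually (hspec j),
      ((hs₀.coord j).abel α'' (by linarith)),
      (hhm.comp hid).eventually ((hs₁.coord (j + 2 * m)).abel α (by linarith))]
      with z b1 b2 b3 b4 b5 b6
    refine hinj b1 b2 ?_
    simp only [Function.comp, id] at b4 b6 ⊢
    rw [b3, b5, b6, b4]
  refine ⟨h, ⟨hha, h0, by rw [hder]; exact Complex.exp_ne_zero _, ?_⟩, hder, α', hb1,
    by linarith, hspec⟩
  rw [eventually_nhdsWithin_iff] at hconj
  filter_upwards [hconj] with z hz
  by_cases hz0 : z = 0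
  · simp only [hz0, Function.comp, hg₀.map_zero, h0, hg₁.map_zero]
  · exact hz hz0

end

/-! ### Rotations and reflections of the indices; symmetries of equivalent tuples. -/

section

section

variable {k : ℕ}

theorem isIndex_ofPosition (hk : 1 ≤ k) (p : ℤ) : IsIndex k (ofPosition k p) := by
  have h1 := Int.emod_nonneg (p - 1) (show (2 * (k:ℤ)) ≠ 0 by omega)
  have h2 := Int.emod_lt_of_pos (p - 1) (show (0:ℤ) < 2 * k by omega)
  unfold ofPosition IsIndex
  split_ifs <;> omega

theorem position_ofPosition (hk : 1 ≤ k) (p : ℤ) : ∃ n : ℤ, position k (ofPosition k p) = p + 2 * k * n := by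
  have h1 := Int.emod_nonneg (p - 1) (show (2 * (k:ℤ)) ≠ 0 by omega)
  have h2 := Int.emod_lt_of_pos (p - 1) (show (0:ℤ) < 2 * k by omega)
  have h3 := Int.emod_add_mul_ediv (p - 1) (2 * k)
  refine ⟨-((p - 1) / (2 * k)), ?_⟩
  rw [mul_neg]
  unfold ofPosition position
  split_ifs <;> omega

theorem ofPosition_add (k : ℕ) (p n : ℤ) : ofPosition k (p + 2 * k * n) = ofPosition k p := by
  unfold ofPosition
  rw [show p + 2 * k * n - 1 = p - 1 + 2 * k * n by ring, Int.add_mul_emod_self_left]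

theorem ofPosition_position {j : ℤ} (hj : IsIndex k j) : ofPosition k (position k j) = j := by
  obtain ⟨h0, h1, h2⟩ := hj
  unfold ofPosition position
  by_cases h : 0 < j
  · rw [if_pos h, Int.emod_eq_of_lt (by omega) (by omega), if_pos (by omega)]; omega
  · rw [if_neg h, Int.emod_eq_of_lt (by omega) (by omega), if_neg (by omega)]; omega

theorem farEnd_ofPosition (hk : 1 ≤ k) (p : ℤ) : farEnd (ofPosition k p) = planeEnd p := by
  obtain ⟨n, hn⟩ := position_ofPosition hk p
  rw [farEnd_eq_planeEnd k, hn, planeEnd_add_period]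

theorem isIndex_rotateIndex (hk : 1 ≤ k) (m j : ℤ) : IsIndex k (rotateIndex k m j) :=
  isIndex_ofPosition hk _

theorem isIndex_reflectIndex (hk : 1 ≤ k) (l j : ℤ) : IsIndex k (reflectIndex k l j) :=
  isIndex_ofPosition hk _

theorem reflectIndex_reflectIndex (hk : 1 ≤ k) (l : ℤ) {j : ℤ} (hj : IsIndex k j) :
    reflectIndex k l (reflectIndex k l j) = j := by
  obtain ⟨n, hn⟩ := position_ofPosition hk (2 * l + 1 - position k j)
  unfold reflectIndex
  rw [hn, show 2 * l + 1 - (2 * l + 1 - position k j + 2 * k * n) = position k j + 2 * k * (-n) by ring,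
    ofPosition_add, ofPosition_position hj]

/-- The rotation by 2mπ/k carries the axis of argument πℓ/k to that of argument π(ℓ + 2m)/k, and so
conjugates the two reflections. -/
theorem reflectIndex_rotateIndex (hk : 1 ≤ k) (l m j : ℤ) :
    reflectIndex k (l + 2 * m) (rotateIndex k m j) = rotateIndex k m (reflectIndex k l j) := by
  obtain ⟨n, hn⟩ := position_ofPosition hk (2 * l + 1 - position k j)
  obtain ⟨n', hn'⟩ := position_ofPosition hk (position k j + 2 * m)
  unfold reflectIndex rotateIndex
  rw [hn, hn', show 2 * (l + 2 * m) + 1 - (position k j + 2 * m + 2 * k * n') =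
    2 * l + 1 - position k j + 2 * m + 2 * k * (-n') by ring,
    show 2 * l + 1 - position k j + 2 * k * n + 2 * m =
    2 * l + 1 - position k j + 2 * m + 2 * k * n by ring, ofPosition_add, ofPosition_add]

theorem rotateIndex_rotateIndex_neg (hk : 1 ≤ k) (m : ℤ) {j : ℤ} (hj : IsIndex k j) :
    rotateIndex k m (rotateIndex k (-m) j) = j := by
  obtain ⟨n, hn⟩ := position_ofPosition hk (position k j + 2 * -m)
  unfold rotateIndex
  rw [hn, show position k j + 2 * -m + 2 * k * n + 2 * m = position k j + 2 * k * n by ring,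
    ofPosition_add, ofPosition_position hj]

theorem rotateIndex_zero {j : ℤ} (hj : IsIndex k j) : rotateIndex k 0 j = j := by
  unfold rotateIndex
  rw [mul_zero, add_zero, ofPosition_position hj]

/-- Adding k to ℓ turns the axis by π, which is the same line. -/
theorem reflectIndex_add_codim (l j : ℤ) : reflectIndex k (l + k) j = reflectIndex k l j := by
  unfold reflectIndex
  rw [show 2 * (l + k) + 1 - position k j = 2 * l + 1 - position k j + 2 * k * 1 by ring,
    ofPosition_add]

theorem farEnd_rotateIndex (hk : 1 ≤ k) (m j : ℤ) : farEnd (rotateIndex k m j) = farEnd j := by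
  unfold rotateIndex
  rw [farEnd_ofPosition hk, farEnd_eq_planeEnd k j]
  unfold planeEnd
  rw [endSign_add_even]

/-- The reflection changes the parity of positions, in agreement with Σ exchanging upper and lower
half-planes. -/
theorem endSign_reflect (l p : ℤ) : endSign (2 * l + 1 - p) = -endSign p := by
  unfold endSign
  have : Odd (2 * l + 1 - p) ↔ ¬ Odd p := by
    rw [Int.not_odd_iff_even]
    exact ⟨fun ⟨a, ha⟩ => ⟨l - a, by omega⟩, fun ⟨a, ha⟩ => ⟨l - a, by omega⟩⟩
  simp only [this]
  split_ifs <;> simp_all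

theorem tendsto_conj_planeEnd (l p : ℤ) {F : ℂ → ℂ} {c : ℝ} (hF : ∀ W, (F W).im = c - W.im) :
    Tendsto F (planeEnd p) (planeEnd (2 * l + 1 - p)) := by
  unfold planeEnd
  rw [endSign_reflect]
  refine tendsto_comap_iff.2 ?_
  have h1 : Tendsto (fun W : ℂ => endSign p * W.im) (comap (fun W => endSign p * W.im) atTop) atTop :=
    tendsto_comap
  have h2 := tendsto_atTop_add_const_right _ (-endSign p * c) h1
  refine h2.congr fun W => ?_
  simp only [Function.comp, hF]
  ring

theorem tendsto_farEnd_reflectIndex (hk : 1 ≤ k) (l j : ℤ) {F : ℂ → ℂ} {c : ℝ}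
    (hF : ∀ W, (F W).im = c - W.im) : Tendsto F (farEnd j) (farEnd (reflectIndex k l j)) := by
  unfold reflectIndex
  rw [farEnd_ofPosition hk, farEnd_eq_planeEnd k j]
  exact tendsto_conj_planeEnd l _ hF

theorem tendsto_T_planeEnd (p : ℤ) (C : ℂ) : Tendsto (T C) (planeEnd p) (planeEnd p) := by
  unfold planeEnd
  refine tendsto_comap_iff.2 ?_
  have h1 : Tendsto (fun W : ℂ => endSign p * W.im) (comap (fun W => endSign p * W.im) atTop) atTop :=
    tendsto_comap
  refine (tendsto_atTop_add_const_right _ (endSign p * C.im) h1).congr fun W => ?_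
  simp only [Function.comp, T, Complex.add_im]
  ring

theorem tendsto_T_farEnd (j : ℤ) (C : ℂ) : Tendsto (T C) (farEnd j) (farEnd j) := by
  rw [farEnd_eq_planeEnd 1]; exact tendsto_T_planeEnd _ C

theorem Sig_im (W : ℂ) : (Sig W).im = 0 - W.im := by simp [Sig]

theorem Sig_add (V W : ℂ) : Sig (V + W) = Sig V + Sig W := by simp [Sig]

/-- For y = 0 the two identities are the same up to exchanging j and s_ℓ(j), and s_ℓ is an
involution. -/
theorem isSymmetric_iff_isTwistedSymmetric (hk : 1 ≤ k) (l : ℤ) (Ψ : ℤ → ℂ → ℂ) :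
    IsSymmetric k l Ψ ↔ IsTwistedSymmetric k l 0 Ψ := by
  have hT : T (Complex.I * ((0:ℝ):ℂ)) = id := by funext W; simp [T]
  unfold IsTwistedSymmetric IsSymmetric
  simp only [hT, Function.id_comp, Function.comp_id]
  constructor
  · intro h j hj
    have h1 := h _ (isIndex_reflectIndex hk l j)
    rw [reflectIndex_reflectIndex hk l hj] at h1
    exact h1.symm
  · intro h j hj
    have h1 := h _ (isIndex_reflectIndex hk l j)
    rw [reflectIndex_reflectIndex hk l hj] at h1
    exact h1.symm

/-- Conjugating Σ ∘ T_{iy} by T_C replaces iy by iy + C - Σ(C) = i(y + 2 Im C), while a rotation of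
the positions by 2m moves the axis ℓ to ℓ + 2m. Real parts of C do not matter. -/
theorem isTwistedSymmetric_iff_of_equivalent (hk : 1 ≤ k) {Ψ Ψ' : ℤ → ℂ → ℂ} {C : ℂ} {m : ℤ}
    (h : ∀ j : ℤ, IsIndex k j → Ψ j =ᶠ[farEnd j] T C ∘ Ψ' (rotateIndex k m j) ∘ T (-C))
    (l : ℤ) (y : ℝ) :
    IsTwistedSymmetric k l y Ψ ↔ IsTwistedSymmetric k (l + 2 * m) (y + 2 * C.im) Ψ' := by
  have hC : C = (starRingEnd ℂ) C + 2 * (Complex.I * C.im) := by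
    apply Complex.ext <;> simp; ring
  have hS : ∀ V : ℂ, ∀ y : ℝ, Sig (V + Complex.I * y) = Sig V - Complex.I * y := by
    intro V y; rw [Sig_add]; simp [Sig, sub_eq_add_neg]
  -- the two identities at corresponding indices
  have key : ∀ j, IsIndex k j →
      ((Sig ∘ T (Complex.I * y) ∘ Ψ j =ᶠ[farEnd j]
        Ψ (reflectIndex k l j) ∘ Sig ∘ T (Complex.I * y)) ↔
      (Sig ∘ T (Complex.I * (y + 2 * C.im : ℝ)) ∘ Ψ' (rotateIndex k m j) =ᶠ[farEnd j]
        Ψ' (reflectIndex k (l + 2 * m) (rotateIndex k m j)) ∘ Sig ∘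
          T (Complex.I * (y + 2 * C.im : ℝ)))) := by
    intro j hj
    have h1 := h j hj
    have h2 := h _ (isIndex_reflectIndex hk l j)
    have hm : Tendsto (Sig ∘ T (Complex.I * y)) (farEnd j) (farEnd (reflectIndex k l j)) := by
      refine tendsto_farEnd_reflectIndex hk l j (c := -y) fun W => ?_
      simp only [Function.comp, T, Sig_im]; simp; ring
    rw [← reflectIndex_rotateIndex hk] at h2
    have h3 := hm.eventually h2
    constructor
    · intro h4
      have h5 := (tendsto_T_farEnd j C).eventually (h1.and (h3.and h4))
      filter_upwards [h5] with W ⟨a1, a2, a3⟩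
      simp only [Function.comp, T, Sig_add, add_neg_cancel_right] at a1 a2 a3 ⊢
      rw [a1, a2] at a3
      have e : Sig W + Sig C + Sig (Complex.I * ↑y) + -C =
          Sig W + Sig (Complex.I * ((y + 2 * C.im : ℝ) : ℂ)) := by
        simp only [Sig, map_mul, Complex.conj_I, Complex.conj_ofReal]; push_cast
        linear_combination -hC
      rw [e] at a3
      rw [← sub_eq_iff_eq_add.2 a3]
      simp only [Sig, map_mul, map_add, Complex.conj_I, Complex.conj_ofReal]; push_cast
      linear_combination hC
    · intro h4
      have h5 := (tendsto_T_farEnd j (-C)).eventually h4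
      filter_upwards [h5, h1, h3] with W a3 a1 a2
      simp only [Function.comp, T, Sig_add] at a1 a2 a3 ⊢
      rw [a1, a2]
      have e : Sig W + Sig (Complex.I * ↑y) + -C =
          Sig W + Sig (-C) + Sig (Complex.I * ((y + 2 * C.im : ℝ) : ℂ)) := by
        simp only [Sig, map_mul, map_neg, Complex.conj_I, Complex.conj_ofReal]; push_cast
        linear_combination -hC
      rw [e, ← a3]
      simp only [Sig, map_mul, map_add, Complex.conj_I, Complex.conj_ofReal]; push_cast
      linear_combination -hC
  unfold IsTwistedSymmetric
  constructor
  · intro h' j hj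
    have h1 := (key _ (isIndex_rotateIndex hk (-m) j)).1 (h' _ (isIndex_rotateIndex hk (-m) j))
    rwa [rotateIndex_rotateIndex_neg hk m hj, farEnd_rotateIndex hk] at h1
  · intro h' j hj
    refine (key j hj).2 ?_
    have h1 := h' _ (isIndex_rotateIndex hk m j)
    rwa [farEnd_rotateIndex hk] at h1

theorem isTwistedSymmetric_add_codim {l : ℤ} {y : ℝ} {Ψ : ℤ → ℂ → ℂ} :
    IsTwistedSymmetric k (l + k) y Ψ ↔ IsTwistedSymmetric k l y Ψ := by
  unfold IsTwistedSymmetric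
  simp only [reflectIndex_add_codim]

/-- Translating all the Fatou coordinates. -/
theorem IsTransition.translate {g : ℂ → ℂ} {b : ℂ} {Ψ : ℤ → ℂ → ℂ} (h : IsTransition g k b Ψ)
    (C : ℂ) : IsTransition g k b fun j => T C ∘ Ψ j ∘ T (-C) := by
  obtain ⟨α, r, φ, h1, h2, h3, h4, h5, h6⟩ := h
  refine ⟨α, r, fun j z => φ j z + C, h1, h2, h3, fun j a1 a2 => ?_, by simp only [h5], fun j hj => ?_⟩
  · obtain ⟨b1, b2, b3⟩ := h4 j a1 a2
    refine ⟨b1.add_const C, fun z hz w hw hzw => b2 hz hw (add_right_cancel hzw), fun z hz hgz => ?_⟩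
    simp only [b3 z hz hgz]; ring
  · obtain ⟨b1, b2, b3, ρ, hρ, b4⟩ := h6 j hj
    have hm := tendsto_T_farEnd j (-C)
    refine ⟨?_, ?_, ?_, ρ, hρ, fun z hz => ⟨fun ho => ?_, fun he => ?_⟩⟩
    · filter_upwards [hm.eventually b1] with W hW
      exact (DifferentiableAt.comp (g := Ψ j) (f := fun W => W + -C) W hW (by fun_prop)).add_const C
    · filter_upwards [hm.eventually b2] with W hW
      simp only [Function.comp, T] at hW ⊢
      rw [add_right_comm W 1 (-C), hW]; ring
    · refine (b3.comp hm).congr fun W => ?_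
      simp only [Function.comp, T]; ring
    · simp only [Function.comp, T, add_neg_cancel_right]
      rw [(b4 z hz).1 ho]
    · simp only [Function.comp, T, add_neg_cancel_right]
      rw [(b4 z hz).2 he]

end

end

/-! ### Mirror images, real germs and invariant curves. -/

/-- The germ obtained by conjugating with the reflection across the real axis. -/
noncomputable def conjGerm (f : ℂ → ℂ) : ℂ → ℂ := starRingEnd ℂ ∘ f ∘ starRingEnd ℂ

theorem conjGerm_apply (f : ℂ → ℂ) (z : ℂ) :
    conjGerm f z = (starRingEnd ℂ) (f ((starRingEnd ℂ) z)) := rfl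

theorem tendsto_conj_nhds_zero : Tendsto (starRingEnd ℂ) (𝓝 0) (𝓝 0) := by
  have := Complex.continuous_conj.tendsto 0
  rwa [map_zero] at this

theorem analyticAt_conjGerm {f : ℂ → ℂ} (hf : AnalyticAt ℂ f 0) : AnalyticAt ℂ (conjGerm f) 0 := by
  rw [Complex.analyticAt_iff_eventually_differentiableAt] at hf ⊢
  filter_upwards [tendsto_conj_nhds_zero.eventually hf] with z hz
  exact differentiableAt_conj_conj_iff.2 hz

theorem deriv_conjGerm (f : ℂ → ℂ) : deriv (conjGerm f) 0 = (starRingEnd ℂ) (deriv f 0) := by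
  unfold conjGerm
  rw [deriv_conj_conj]; simp

theorem iteratedDeriv_conjGerm (f : ℂ → ℂ) (n : ℕ) :
    iteratedDeriv n (conjGerm f) 0 = (starRingEnd ℂ) (iteratedDeriv n f 0) := by
  have : ∀ n, iteratedDeriv n (conjGerm f) = conjGerm (iteratedDeriv n f) := by
    intro n
    induction n with
    | zero => simp
    | succ n ih => rw [iteratedDeriv_succ, ih, iteratedDeriv_succ]; exact deriv_conj_conj
  rw [this, conjGerm_apply, map_zero]

theorem IsPrenormalized.conjGerm {g : ℂ → ℂ} {k : ℕ} {b : ℂ} (hg : IsPrenormalized g k b) :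
    IsPrenormalized (conjGerm g) k ((starRingEnd ℂ) b) := by
  refine ⟨analyticAt_conjGerm hg.1, ?_⟩
  have h := hg.2.comp_tendsto tendsto_conj_nhds_zero
  rw [← isLittleO_norm_norm] at h ⊢
  refine (h.congr (fun z => ?_) (fun z => ?_))
  · rw [← Complex.norm_conj]
    simp [conjGerm_apply, map_ofNat]
  · simp

theorem hasRealCoefficients_iff {r : ℂ → ℂ} (hr : AnalyticAt ℂ r 0) :
    HasRealCoefficients r ↔ conjGerm r =ᶠ[𝓝 0] r := by
  unfold HasRealCoefficients
  rw [and_iff_right hr]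
  have him : ∀ w : ℂ, w.im = 0 ↔ (starRingEnd ℂ) w = w := fun w => Complex.conj_eq_iff_im.symm
  constructor
  · intro h
    obtain ⟨ρ₁, h1, h2⟩ := Metric.eventually_nhds_iff_ball.1 hr.eventually_analyticAt
    obtain ⟨ρ₂, h3, h4⟩ := Metric.eventually_nhds_iff_ball.1
      (analyticAt_conjGerm hr).eventually_analyticAt
    have d1 : DifferentiableOn ℂ r (Metric.ball 0 (min ρ₁ ρ₂)) := fun z hz =>
      (h2 z (Metric.ball_subset_ball (min_le_left _ _) hz)).differentiableAt.differentiableWithinAt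
    have d2 : DifferentiableOn ℂ (ParabolicGerm.conjGerm r) (Metric.ball 0 (min ρ₁ ρ₂)) := fun z hz =>
      (h4 z (Metric.ball_subset_ball (min_le_right _ _) hz)).differentiableAt.differentiableWithinAt
    filter_upwards [Metric.ball_mem_nhds (0:ℂ) (lt_min h1 h3)] with z hz
    rw [← Complex.taylorSeries_eq_on_ball d1 hz, ← Complex.taylorSeries_eq_on_ball d2 hz]
    simp only [iteratedDeriv_conjGerm, (him _).1 (h _)]
  · intro h n
    rw [him, ← iteratedDeriv_conjGerm]
    exact h.iteratedDeriv_eq n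

theorem analyticAt_eq_of_real {f₁ f₂ : ℂ → ℂ} (h₁ : AnalyticAt ℂ f₁ 0) (h₂ : AnalyticAt ℂ f₂ 0)
    (h : ∀ᶠ t : ℝ in 𝓝 0, f₁ t = f₂ t) : f₁ =ᶠ[𝓝 0] f₂ := by
  refine (h₁.frequently_eq_iff_eventually_eq h₂).1 ?_
  have h1 : Tendsto (fun t : ℝ => (t : ℂ)) (𝓝[≠] 0) (𝓝[≠] 0) := by
    refine tendsto_nhdsWithin_iff.2 ⟨?_, ?_⟩
    · have := Complex.continuous_ofReal.tendsto 0
      exact (by simpa using this : Tendsto (fun t : ℝ => (t : ℂ)) (𝓝 0) (𝓝 0)).mono_left nhdsWithin_le_nhds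
    · filter_upwards [self_mem_nhdsWithin] with t ht
      have ht : t ≠ 0 := ht
      simpa using ht
  exact h1.frequently (h.filter_mono nhdsWithin_le_nhds).frequently

theorem hasRealCoefficients_iff_real {r : ℂ → ℂ} (hr : AnalyticAt ℂ r 0) :
    HasRealCoefficients r ↔ ∀ᶠ t : ℝ in 𝓝 0, (r t).im = 0 := by
  rw [hasRealCoefficients_iff hr]
  have hreal : Tendsto (fun t : ℝ => (t : ℂ)) (𝓝 0) (𝓝 0) := by
    simpa using Complex.continuous_ofReal.tendsto 0
  constructor
  · intro h
    filter_upwards [hreal.eventually h] with t ht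
    rwa [conjGerm_apply, Complex.conj_ofReal, Complex.conj_eq_iff_im] at ht
  · intro h
    refine analyticAt_eq_of_real (analyticAt_conjGerm hr) hr ?_
    filter_upwards [h] with t ht
    rwa [conjGerm_apply, Complex.conj_ofReal, Complex.conj_eq_iff_im]

/-- Real analytic germs of curves extend to holomorphic germs. -/
theorem exists_holomorphic_extension {γ : ℝ → ℂ} (hγ : AnalyticAt ℝ γ 0) :
    ∃ Γ : ℂ → ℂ, AnalyticAt ℂ Γ 0 ∧ ∀ᶠ t : ℝ in 𝓝 0, Γ t = γ t := by
  obtain ⟨p, hp⟩ := hγ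
  rw [hasFPowerSeriesAt_iff] at hp
  set q : FormalMultilinearSeries ℂ ℂ ℂ := FormalMultilinearSeries.ofScalars ℂ p.coeff with hq
  obtain ⟨ρ, hρ, hp'⟩ := Metric.eventually_nhds_iff.1 hp
  have hsum := (hp' (y := ρ / 2) (by rw [Real.dist_eq, sub_zero, abs_of_pos] <;> linarith)).summable
  have hrad : 0 < q.radius := by
    have hρ2 : 0 ≤ ρ / 2 := by linarith
    have h1 : (Real.toNNReal (ρ / 2) : ENNReal) ≤ q.radius := by
      refine q.le_radius_of_tendsto (l := 0) ?_
      have h2 := hsum.tendsto_atTop_zero.norm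
      rw [norm_zero] at h2
      refine h2.congr fun n => ?_
      rw [hq, FormalMultilinearSeries.ofScalars_norm, norm_smul, norm_pow, Real.norm_eq_abs,
        abs_of_nonneg hρ2, Real.coe_toNNReal _ hρ2]
      exact mul_comm _ _
    refine lt_of_lt_of_le ?_ h1
    rw [ENNReal.coe_pos, Real.toNNReal_pos]
    linarith
  have hs := q.hasFPowerSeriesOnBall hrad
  refine ⟨q.sum, hs.analyticAt, ?_⟩
  have hs' := hasFPowerSeriesAt_iff.1 hs.hasFPowerSeriesAt
  have hreal : Tendsto (fun t : ℝ => (t : ℂ)) (𝓝 0) (𝓝 0) := by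
    simpa using Complex.continuous_ofReal.tendsto 0
  filter_upwards [hreal.eventually hs', hp] with t h1 h2
  rw [zero_add] at h1 h2
  refine h1.unique ?_
  convert h2 using 2 with n
  rw [hq, FormalMultilinearSeries.coeff_ofScalars, Complex.real_smul]
  simp

theorem IsConjugacy.trans {h₁ h₂ g₁ g₂ g₃ : ℂ → ℂ} (H₁ : IsConjugacy h₁ g₁ g₂)
    (H₂ : IsConjugacy h₂ g₂ g₃) :
    IsConjugacy (h₂ ∘ h₁) g₁ g₃ ∧ deriv (h₂ ∘ h₁) 0 = deriv h₂ 0 * deriv h₁ 0 := by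
  have hd : deriv (h₂ ∘ h₁) 0 = deriv h₂ 0 * deriv h₁ 0 := by
    have h2 : DifferentiableAt ℂ h₂ (h₁ 0) := by
      rw [H₁.map_zero]; exact H₂.analyticAt.differentiableAt
    rw [deriv_comp 0 h2 H₁.analyticAt.differentiableAt, H₁.map_zero]
  refine ⟨⟨?_, ?_, ?_, ?_⟩, hd⟩
  · exact AnalyticAt.comp (by rw [H₁.map_zero]; exact H₂.analyticAt) H₁.analyticAt
  · simp [H₁.map_zero, H₂.map_zero]
  · rw [hd]; exact mul_ne_zero H₂.deriv_ne_zero H₁.deriv_ne_zero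
  · have hc : Tendsto h₁ (𝓝 0) (𝓝 0) := by
      have := H₁.analyticAt.continuousAt.tendsto
      rwa [H₁.map_zero] at this
    filter_upwards [H₁.conj_eq, hc.eventually H₂.conj_eq] with z h1 h2
    simp only [Function.comp] at h1 h2 ⊢
    rw [h1, h2]

theorem IsConjugacy.exists_symm {h g₁ g₂ : ℂ → ℂ} (H : IsConjugacy h g₁ g₂)
    (hg₁ : ContinuousAt g₁ 0) (h0 : g₁ 0 = 0) :
    ∃ f, IsConjugacy f g₂ g₁ ∧ deriv f 0 = (deriv h 0)⁻¹ ∧ (∀ᶠ z in 𝓝 0, h (f z) = z) ∧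
      ∀ᶠ z in 𝓝 0, f (h z) = z := by
  obtain ⟨f, h1, h2, h3, h4, h5⟩ := exists_inverse_germ H.analyticAt H.map_zero H.deriv_ne_zero
  refine ⟨f, ⟨h1, h2, by rw [h3]; exact inv_ne_zero H.deriv_ne_zero, ?_⟩, h3, h4, h5⟩
  have hf : Tendsto f (𝓝 0) (𝓝 0) := by
    have := h1.continuousAt.tendsto
    rwa [h2] at this
  have hg : Tendsto g₁ (𝓝 0) (𝓝 0) := by
    have := hg₁.tendsto
    rwa [h0] at this
  filter_upwards [hf.eventually H.conj_eq, h4, (hg.comp hf).eventually h5] with z a1 a2 a3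
  simp only [Function.comp] at a1 a3 ⊢
  rw [a2] at a1
  rw [← a1, a3]

theorem exists_conj_by {h g f : ℂ → ℂ} (hh : AnalyticAt ℂ h 0) (hg : AnalyticAt ℂ g 0)
    (hf : AnalyticAt ℂ f 0) (hh0 : h 0 = 0) (hg0 : g 0 = 0) (hf0 : f 0 = 0)
    (hd : deriv h 0 ≠ 0) (hfh : ∀ᶠ z in 𝓝 0, f (h z) = z) :
    IsConjugacy h g (h ∘ g ∘ f) ∧ AnalyticAt ℂ (h ∘ g ∘ f) 0 := by
  refine ⟨⟨hh, hh0, hd, ?_⟩, ?_⟩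
  · filter_upwards [hfh] with z hz
    simp only [Function.comp, hz]
  · refine AnalyticAt.comp (by simpa [hg0, hf0] using hh) ?_
    exact AnalyticAt.comp (by simpa [hf0] using hg) hf

/-- An invariant curve gives a conjugacy to a real germ. -/
theorem IsInvariantCurve.exists_isConjugacy {g : ℂ → ℂ} {γ : ℝ → ℂ} (hγ : IsInvariantCurve g γ)
    (hg : AnalyticAt ℂ g 0) (hg0 : g 0 = 0) :
    ∃ h r, IsConjugacy h g r ∧ HasRealCoefficients r ∧ deriv h 0 = (deriv γ 0)⁻¹ := by
  obtain ⟨Γ, h1, h2⟩ := exists_holomorphic_extension hγ.analyticAt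
  have hΓ0 : Γ 0 = 0 := by
    have := h2.self_of_nhds
    rwa [hγ.map_zero, Complex.ofReal_zero] at this
  have hd : deriv γ 0 = deriv Γ 0 := by
    have h3 : HasDerivAt (fun t : ℝ => Γ t) (deriv Γ 0) 0 := by
      have h4 := h1.differentiableAt.hasDerivAt
      have h5 := HasDerivAt.comp_ofReal (z := 0) (e := Γ) (e' := deriv Γ 0) (by simpa using h4)
      exact h5
    exact (h3.congr_of_eventuallyEq (h2.mono fun t ht => ht.symm)).deriv
  have hd0 : deriv Γ 0 ≠ 0 := hd ▸ hγ.deriv_ne_zero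
  obtain ⟨h, a1, a2, a3, a4, a5⟩ := exists_inverse_germ h1 hΓ0 hd0
  obtain ⟨b1, b2⟩ := exists_conj_by a1 hg h1 a2 hg0 hΓ0 (by rw [a3]; exact inv_ne_zero hd0) a4
  refine ⟨h, _, b1, (hasRealCoefficients_iff_real b2).2 ?_, by rw [a3, hd]⟩
  have hreal : Tendsto (fun t : ℝ => (t : ℂ)) (𝓝 0) (𝓝 0) := by
    simpa using Complex.continuous_ofReal.tendsto 0
  have h6 : ∀ᶠ w in map γ (𝓝 0), (h w).im = 0 := by
    rw [eventually_map]
    filter_upwards [h2, hreal.eventually a5] with t c1 c2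
    rw [← c1, c2, Complex.ofReal_im]
  -- Invariance as germs of sets: what holds along the image of γ holds along the image of g ∘ γ, so
  -- h ∘ g ∘ Γ is real on the real axis.
  rw [← hγ.invariant, eventually_map] at h6
  filter_upwards [h6, h2] with t c1 c2
  simp only [Function.comp] at c1 ⊢
  rw [c2, c1]

/-- A conjugacy to a real germ gives an invariant curve. -/
theorem IsConjugacy.exists_isInvariantCurve {g h r : ℂ → ℂ} (H : IsConjugacy h g r)
    (hr : HasRealCoefficients r) (hg : AnalyticAt ℂ g 0) (hg0 : g 0 = 0) (hg1 : deriv g 0 = 1) :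
    ∃ γ, IsInvariantCurve g γ ∧ deriv γ 0 = (deriv h 0)⁻¹ := by
  obtain ⟨f, F, hfd, h1, h2⟩ := H.exists_symm hg.continuousAt hg0
  have hreal : Tendsto (fun t : ℝ => (t : ℂ)) (𝓝 0) (𝓝 0) := by
    simpa using Complex.continuous_ofReal.tendsto 0
  have hr0 : r 0 = 0 := by
    have := H.conj_eq.self_of_nhds
    simpa [hg0, H.map_zero] using this.symm
  have hr1 : deriv r 0 = 1 := by
    have e := H.conj_eq.deriv_eq
    rw [deriv_comp 0 (by rw [hg0]; exact H.analyticAt.differentiableAt) hg.differentiableAt,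
      deriv_comp 0 (by rw [H.map_zero]; exact hr.1.differentiableAt) H.analyticAt.differentiableAt,
      hg0, H.map_zero, hg1, mul_one] at e
    exact (mul_right_cancel₀ H.deriv_ne_zero (by rw [one_mul]; exact e)).symm
  -- On the real axis r is a local diffeomorphism, as its multiplier is 1; hence g ∘ f = f ∘ r is a
  -- reparametrization of the same curve and has the same germ of image.
  have hρ : HasStrictDerivAt (fun t : ℝ => (r t).re) 1 0 := by
    have h3 : HasStrictDerivAt r 1 ((0:ℝ) : ℂ) := by
      have := hr.1.hasStrictDerivAt
      rwa [hr1] at this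
    simpa using h3.real_of_complex
  have hmap := hρ.map_nhds_eq one_ne_zero
  rw [Complex.ofReal_zero, hr0, Complex.zero_re] at hmap
  have hder : HasDerivAt (fun t : ℝ => f t) (deriv h 0)⁻¹ 0 := by
    have h4 := F.analyticAt.differentiableAt.hasDerivAt
    rw [hfd] at h4
    exact HasDerivAt.comp_ofReal (z := 0) (e := f) (by simpa using h4)
  refine ⟨fun t => f t, ⟨?_, by simp [F.map_zero], ?_, ?_⟩, hder.deriv⟩
  · have h5 : AnalyticAt ℝ f ((0:ℝ) : ℂ) := by simpa using F.analyticAt.restrictScalars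
    exact AnalyticAt.comp (g := f) (f := fun t : ℝ => (t:ℂ)) h5 (Complex.ofRealCLM.analyticAt 0)
  · rw [hder.deriv]; exact inv_ne_zero H.deriv_ne_zero
  · have h6 : g ∘ (fun t : ℝ => f t) =ᶠ[𝓝 0] (fun t : ℝ => f t) ∘ fun t : ℝ => (r t).re := by
      filter_upwards [hreal.eventually F.conj_eq, (hasRealCoefficients_iff_real hr.1).1 hr] with t c1 c2
      simp only [Function.comp] at c1 ⊢
      rw [← c1]
      congr 1
      exact Complex.ext (by simp) (by simp [c2])
    rw [map_congr h6, ← map_map, hmap]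

/-! ### Symmetric transition functions and antiholomorphic involutions. -/

section

section

variable {g : ℂ → ℂ} {k : ℕ} {b D : ℂ} {s : ℤ → ℂ → ℂ}

theorem relArg_conj (θ : ℝ) (z : ℂ) : |relArg (-θ) ((starRingEnd ℂ) z)| = |relArg θ z| := by
  have e : (starRingEnd ℂ) z * Complex.exp (-(((-θ : ℝ) : ℂ) * Complex.I)) =
      (starRingEnd ℂ) (z * Complex.exp (-(θ * Complex.I))) := by
    simp [← Complex.exp_conj]
  unfold relArg
  rw [e, Complex.arg_conj]
  split_ifs with h
  · rw [h]
  · rw [abs_neg]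

theorem tendsto_conj_germSector (θ α : ℝ) :
    Tendsto (starRingEnd ℂ) (germSector θ α) (germSector (-θ) α) := by
  refine tendsto_germSector_iff.2 ⟨tendsto_conj_nhds_zero.mono_left germSector_le_nhds, ?_⟩
  filter_upwards [germSector_ne_zero, germSector_relArg] with z h1 h2
  exact ⟨by simpa using h1, by rwa [relArg_conj]⟩

theorem direction_neg (k : ℕ) (j : ℤ) : direction k (-j) = -direction k j := by
  unfold direction; push_cast; ring

/-- Complex conjugation exchanges the petals j and -j and conjugates the expansion; the logarithm
commutes with it because the rotated variable stays away from the negative axis. -/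
theorem IsStandardFamily.conjGerm (hs : IsStandardFamily g k b D s) (hk : 1 ≤ k) :
    IsStandardFamily (conjGerm g) k ((starRingEnd ℂ) b) ((starRingEnd ℂ) D)
      fun j => conjGerm (s (-j)) := by
  have hm : ∀ j α, Tendsto (starRingEnd ℂ) (germSector (direction k j) α)
      (germSector (direction k (-j)) α) := fun j α => by
    rw [direction_neg]; exact tendsto_conj_germSector _ _
  refine ⟨fun j => ⟨fun α hα => ?_, fun α hα => ?_, fun α hα => ?_⟩, fun j n => ?_⟩
  · filter_upwards [(hm j α).eventually ((hs.coord (-j)).differentiable α hα)] with z hz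
    exact differentiableAt_conj_conj_iff.2 hz
  · filter_upwards [(hm j α).eventually ((hs.coord (-j)).abel α hα)] with z hz
    simp only [conjGerm_apply, Complex.conj_conj, hz, map_add, map_one]
  · have h1 := (Complex.continuous_conj.tendsto D).comp
      (((hs.coord (-j)).expansion α hα).comp (hm j α))
    refine h1.congr' ?_
    filter_upwards [germSector_ne_zero, germSector_relArg] with z hz hza
    have e : (starRingEnd ℂ) z * Complex.exp (-((direction k (-j) : ℝ) * Complex.I)) =
        (starRingEnd ℂ) (z * Complex.exp (-((direction k j : ℝ) * Complex.I))) := by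
      rw [direction_neg]
      simp only [map_mul, ← Complex.exp_conj, map_neg, Complex.conj_ofReal, Complex.conj_I]
      push_cast; ring_nf
    have ha : (z * Complex.exp (-((direction k j : ℝ) * Complex.I))).arg ≠ Real.pi := by
      intro h
      unfold relArg at hza
      rw [h, abs_of_pos Real.pi_pos] at hza
      linarith [pi_div_le hk]
    simp only [Function.comp, conjGerm_apply]
    rw [e, Complex.log_conj _ ha]
    simp
  · rw [show -(j + 2 * k * n) = -j + 2 * k * (-n) by ring, hs.periodic]

theorem IsConjugacy.conjGerm {f g₀ g₁ : ℂ → ℂ} (H : IsConjugacy f g₀ g₁) :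
    IsConjugacy (conjGerm f) (conjGerm g₀) (conjGerm g₁) := by
  refine ⟨analyticAt_conjGerm H.analyticAt, by simp [conjGerm_apply, H.map_zero], ?_, ?_⟩
  · rw [deriv_conjGerm]
    exact fun h => H.deriv_ne_zero (by simpa using h)
  · filter_upwards [tendsto_conj_nhds_zero.eventually H.conj_eq] with z hz
    simp only [Function.comp, conjGerm_apply, Complex.conj_conj] at hz ⊢
    rw [hz]

/-- On petals the reflection is i ↦ 2ℓ - i, which preserves parity: it sends repelling petals to
repelling ones, even though positions change parity. -/
theorem source_reflect (l p : ℤ) : source (2 * l + 1 - p) = 2 * l - source p := by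
  unfold source
  have : Odd (2 * l + 1 - p) ↔ ¬ Odd p := by
    rw [Int.not_odd_iff_even]
    exact ⟨fun ⟨a, ha⟩ => ⟨l - a, by omega⟩, fun ⟨a, ha⟩ => ⟨l - a, by omega⟩⟩
  simp only [this]
  split_ifs <;> omega

theorem target_reflect (l p : ℤ) : target (2 * l + 1 - p) = 2 * l - target p := by
  unfold target
  have : Odd (2 * l + 1 - p) ↔ ¬ Odd p := by
    rw [Int.not_odd_iff_even]
    exact ⟨fun ⟨a, ha⟩ => ⟨l - a, by omega⟩, fun ⟨a, ha⟩ => ⟨l - a, by omega⟩⟩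
  simp only [this]
  split_ifs <;> omega

theorem midDirection_reflect (hk : 1 ≤ k) (l p : ℤ) :
    midDirection k (2 * l + 1 - p) = -(midDirection k p + direction k (2 * -l)) := by
  have hkr : (k:ℝ) ≠ 0 := by positivity
  unfold midDirection direction
  push_cast
  field_simp
  ring

theorem direction_reflect (l j : ℤ) :
    direction k (2 * l - j) = -(direction k j + direction k (2 * -l)) := by
  unfold direction
  push_cast
  ring

/-- The reflection associated with a map tangent to a rotation, on sectors. -/
theorem tendsto_conj_comp_germSector {H : ℂ → ℂ} {l : ℤ} {θ θ' α α' : ℝ}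
    (hH : Tendsto (fun z => H z / z) (𝓝[≠] 0)
      (𝓝 (Complex.exp ((direction k (2 * -l) : ℝ) * Complex.I))))
    (hθ : θ' = -(θ + direction k (2 * -l))) (h : α' < α) (hα : α ≤ Real.pi) :
    Tendsto (fun z => (starRingEnd ℂ) (H z)) (germSector θ α') (germSector θ' α) := by
  rw [hθ]
  exact (tendsto_conj_germSector _ α).comp (tendsto_germSector h hα (hH.mono_left germSector_le))

theorem IsTransition.isGluing_ofPosition {Ψ : ℤ → ℂ → ℂ} (hk : 1 ≤ k) {δ : ℝ}
    (hs : IsStandardFamily g k b D s)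
    (hΨ : ∀ j, IsIndex k j → IsGluing k s (Ψ j) (position k j) δ) (p : ℤ) :
    IsGluing k s (Ψ (ofPosition k p)) p δ := by
  obtain ⟨n, hn⟩ := position_ofPosition hk p
  have h1 := (hΨ _ (isIndex_ofPosition hk p)).of_period hk hs (-n)
  rw [hn] at h1
  rwa [show p + 2 * k * n + 2 * k * -n = p by ring] at h1

/-- A conjugacy to a real germ gives a symmetry of the transition functions. -/
theorem IsConjugacy.exists_isTwistedSymmetric {h r : ℂ → ℂ} {Ψ : ℤ → ℂ → ℂ} {l : ℤ}
    (H : IsConjugacy h g r) (hr : HasRealCoefficients r)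
    (hl : (deriv h 0 * Complex.exp (Real.pi * l / k * Complex.I)).im = 0)
    (hg : IsPrenormalized g k b) (hk : 1 ≤ k) (hT : IsTransition g k b Ψ) :
    ∃ y : ℝ, IsTwistedSymmetric k l y Ψ := by
  have hpi := Real.pi_pos
  have hkr : (0:ℝ) < k := by exact_mod_cast hk
  have hq0 : 0 < Real.pi / (2 * k) := by positivity
  have hq1 := pi_div_two_mul_add hk
  obtain ⟨f, F, hfd, hf1, hf2⟩ := H.exists_symm hg.1.continuousAt hg.map_zero
  -- the conjugacy from `g` to its mirror image
  have F' : IsConjugacy (ParabolicGerm.conjGerm f) r (ParabolicGerm.conjGerm g) := by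
    have F₀ := F.conjGerm
    refine ⟨F₀.analyticAt, F₀.map_zero, F₀.deriv_ne_zero, ?_⟩
    filter_upwards [F₀.conj_eq, (hasRealCoefficients_iff hr.1).1 hr] with z h1 h2
    rw [← h1, Function.comp, Function.comp, h2]
  obtain ⟨K, hKd⟩ := H.trans F'
  set κ := ParabolicGerm.conjGerm f ∘ h with hκ
  have hE : (starRingEnd ℂ) (Complex.exp (Real.pi * l / k * Complex.I)) *
      Complex.exp (Real.pi * l / k * Complex.I) = 1 := by
    rw [← Complex.exp_conj, ← Complex.exp_add]
    simp
  -- The multiplier of κ is the quotient of h'(0) by its conjugate; as h'(0) exp(iπℓ/k) is real, it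
  -- equals exp(-2iπℓ/k).
  have hKd' : deriv κ 0 = Complex.exp ((direction k (2 * -l) : ℝ) * Complex.I) := by
    have hE2 : Complex.exp (Real.pi * l / k * Complex.I) ^ 2 *
        Complex.exp ((direction k (2 * -l) : ℝ) * Complex.I) = 1 := by
      rw [← Complex.exp_nat_mul, ← Complex.exp_add]
      rw [show ((2:ℕ):ℂ) * (Real.pi * l / k * Complex.I) +
        (direction k (2 * -l) : ℝ) * Complex.I = 0 by unfold direction; push_cast; ring]
      exact Complex.exp_zero
    rw [hKd, deriv_conjGerm, hfd]
    have h1 := Complex.conj_eq_iff_im.2 hl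
    rw [map_mul] at h1
    set E := Complex.exp (Real.pi * l / k * Complex.I)
    have hE0 : E ≠ 0 := Complex.exp_ne_zero _
    have hc0 : (starRingEnd ℂ) (deriv h 0) ≠ 0 := fun h0 => H.deriv_ne_zero (by simpa using h0)
    rw [map_inv₀, inv_mul_eq_iff_eq_mul₀ hc0]
    have h2 : (starRingEnd ℂ) (deriv h 0) = deriv h 0 * E ^ 2 := by
      linear_combination (-(starRingEnd ℂ) (deriv h 0)) * hE + E * h1
    rw [h2]
    linear_combination (-deriv h 0) * hE2
  obtain ⟨D, s, δ, hs, hδ0, hδ1, hglue⟩ := hT.exists_family hg hk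
  obtain ⟨α, ha1, ha2⟩ := exists_between (show Real.pi / (2 * k) < Real.pi / k by linarith)
  obtain ⟨α', ha3, ha4⟩ := exists_between ha1
  obtain ⟨-, C, hC⟩ := K.exists_eq_add hk hg hs (hs.conjGerm hk) hKd' ha1 ha2
  set σ : ℂ → ℂ := fun z => (starRingEnd ℂ) (κ z) with hσ
  have hKt := tendsto_div_of_deriv K.analyticAt.differentiableAt K.map_zero
  rw [hKd'] at hKt
  -- σ = f ∘ Σ ∘ h, with f = h⁻¹, is the reflection in the invariant curve; in Fatou coordinates it
  -- acts by W ↦ Σ(W + C), with one C for all petals.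
  have hrel : ∀ j, ∀ᶠ z in germSector (direction k j) α,
      s (2 * l - j) (σ z) = (starRingEnd ℂ) (s j z + C) := by
    intro j
    filter_upwards [hC j] with z hz
    rw [← hz, conjGerm_apply, Complex.conj_conj, show -(j + 2 * -l) = 2 * l - j by ring]
  have hσσ : ∀ᶠ z in 𝓝 (0:ℂ), σ (σ z) = z := by
    have hh : Tendsto h (𝓝 0) (𝓝 0) := by
      have := H.analyticAt.continuousAt.tendsto
      rwa [H.map_zero] at this
    filter_upwards [(tendsto_conj_nhds_zero.comp hh).eventually hf1, hf2] with z h1 h2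
    simp only [hσ, hκ, Function.comp, conjGerm_apply, Complex.conj_conj] at h1 ⊢
    rw [h1, Complex.conj_conj, h2]
  -- Applying σ twice translates Fatou coordinates by C + Σ(C), which must vanish: C = iy, and this
  -- is the y of the twisted symmetry.
  have hCre : C + (starRingEnd ℂ) C = 0 := by
    have hm : Tendsto σ (germSector (direction k 0) α') (germSector (direction k (2 * l - 0)) α) :=
      tendsto_conj_comp_germSector hKt (direction_reflect l 0) ha4 (by linarith [pi_div_le hk])
    have := germSector_neBot hk (direction k 0) (show 0 < α' by linarith)
    obtain ⟨z, h1, h2, h3⟩ := ((hm.eventually (hrel (2 * l - 0))).and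
      (((hrel 0).filter_mono (germSector_mono ha4.le)).and
        (hσσ.filter_mono germSector_le_nhds))).exists
    rw [h3, h2, show 2 * l - (2 * l - 0) = 0 by ring, map_add, Complex.conj_conj] at h1
    linear_combination -h1
  refine ⟨C.im, fun j hj => ?_⟩
  have hCim : C = Complex.I * C.im := by
    have : C.re = 0 := by
      have := congrArg Complex.re hCre
      simp at this; exact this
    apply Complex.ext <;> simp [this]
  rw [← hCim]
  set p := position k j with hp
  set Ψ' := Ψ (reflectIndex k l j) with hΨ'
  have hglue' : IsGluing k s Ψ' (2 * l + 1 - p) δ :=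
    IsTransition.isGluing_ofPosition hk hs hglue _
  obtain ⟨_, _, _, _, _, _, _, _, hT'⟩ := hT
  have hper := (hT' j hj).2.1
  have hper' := (hT' _ (isIndex_reflectIndex hk l j)).2.1
  have htend : Tendsto (Sig ∘ T C) (farEnd j) (farEnd (reflectIndex k l j)) := by
    refine tendsto_farEnd_reflectIndex hk l j (c := -C.im) fun W => ?_
    simp only [Function.comp, T, Sig_im, Complex.add_im]; ring
  set ε := min (δ / 2) ((α - Real.pi / (2 * k))) with hε
  have hε0 : 0 < ε := lt_min (by linarith) (by linarith)
  have hεδ : ε < δ := (min_le_left _ _).trans_lt (by linarith)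
  have hεα : ε + Real.pi / (2 * k) ≤ α := by
    linarith [min_le_right (δ / 2) (α - Real.pi / (2 * k))]
  have hmid : ∀ i, i = p ∨ i = p - 1 → ∀ᶠ z in germSector (midDirection k p) ε,
      s (2 * l - i) (σ z) = (starRingEnd ℂ) (s i z + C) := fun i hi =>
    (hrel i).filter_mono (germSector_mid_le hk hi hεα ha2.le)
  have hσm : Tendsto σ (germSector (midDirection k p) ε)
      (germSector (midDirection k (2 * l + 1 - p)) δ) :=
    tendsto_conj_comp_germSector hKt (midDirection_reflect hk l p) hεδ
      (by linarith [pi_div_le hk])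
  have hend : farEnd j = planeEnd p := farEnd_eq_planeEnd k j
  rw [hend] at hper htend ⊢
  rw [← hΨ'] at hper'
  -- The identity is visible only on the image of the middle sector; both sides commute with W ↦ W +
  -- 1, which spreads it to a half-plane.
  refine (hs.coord (source p)).eventually_planeEnd_of_germSector hk (source_eq_or p) hε0 ?_ ?_
  · have h1 := hσm.eventually hglue'
    rw [source_reflect, target_reflect] at h1
    filter_upwards [(hglue j hj).filter_mono (germSector_mono hεδ.le), h1,
      hmid _ (source_eq_or p), hmid _ (target_eq_or p)] with z a1 a2 a3 a4
    simp only [Function.comp, T, Sig]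
    rw [a1, ← a4, ← a2, a3]
  · filter_upwards [hper, htend.eventually hper'] with W a1 a2
    have e : Sig (T C (W + 1)) = Sig (T C W) + 1 := by
      simp only [T, Sig, map_add, map_one]; ring
    have e' : Sig (T C (Ψ j W + 1)) = Sig (T C (Ψ j W)) + 1 := by
      simp only [T, Sig, map_add, map_one]; ring
    simp only [Function.comp] at a2 ⊢
    rw [a1, e, e', a2, add_left_inj]

/-- An antiholomorphic involution that commutes with a germ gives a conjugacy to a real germ. -/
theorem exists_isConjugacy_of_involution {κ : ℂ → ℂ} {l : ℤ} (hk : 1 ≤ k) (hg : AnalyticAt ℂ g 0)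
    (hg0 : g 0 = 0) (K : IsConjugacy κ g (conjGerm g))
    (hd : deriv κ 0 = Complex.exp ((direction k (2 * -l) : ℝ) * Complex.I))
    (hinv : ∀ᶠ z in 𝓝 (0:ℂ), (starRingEnd ℂ) (κ ((starRingEnd ℂ) (κ z))) = z) :
    ∃ h r : ℂ → ℂ, IsConjugacy h g r ∧ HasRealCoefficients r ∧
      (deriv h 0 * Complex.exp (Real.pi * l / k * Complex.I)).im = 0 := by
  have hk0 := natCast_ne_zero_of_pos hk
  set c := Complex.exp (-(Real.pi * l / k * Complex.I)) with hc
  have hc1 : (starRingEnd ℂ) c * Complex.exp ((direction k (2 * -l) : ℝ) * Complex.I) = c := by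
    rw [hc, ← Complex.exp_conj, ← Complex.exp_add]
    congr 1
    simp only [map_neg, map_mul, map_div₀, Complex.conj_ofReal, Complex.conj_I, map_intCast,
      map_natCast]
    unfold direction; push_cast; ring
  -- The average of c z and of the conjugate of c σ(z) satisfies h ∘ σ = Σ ∘ h whenever σ² = id. The
  -- factor c = exp(-iπℓ/k) makes both halves have derivative c/2 at 0, so they do not cancel, and
  -- it puts h'(0) in the required direction.
  set h : ℂ → ℂ := fun z => (c * z + (starRingEnd ℂ) c * κ z) / 2 with hh
  have hha : AnalyticAt ℂ h 0 := by
    have := K.analyticAt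
    fun_prop
  have hh0 : h 0 = 0 := by simp [hh, K.map_zero]
  have hhd : deriv h 0 = c := by
    have h1 := (((hasDerivAt_id (0:ℂ)).const_mul c).add
      (K.analyticAt.differentiableAt.hasDerivAt.const_mul ((starRingEnd ℂ) c))).div_const 2
    have h2 : deriv h 0 = _ := h1.deriv
    rw [h2, hd, hc1]; ring
  obtain ⟨f, f1, f2, f3, f4, f5⟩ := exists_inverse_germ hha hh0 (by rw [hhd]; exact Complex.exp_ne_zero _)
  obtain ⟨H, hr⟩ := exists_conj_by hha hg f1 hh0 hg0 f2 (by rw [hhd]; exact Complex.exp_ne_zero _) f5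
  set σ : ℂ → ℂ := fun z => (starRingEnd ℂ) (κ z) with hσ
  have hhσ : ∀ᶠ z in 𝓝 (0:ℂ), h (σ z) = (starRingEnd ℂ) (h z) := by
    filter_upwards [hinv] with z hz
    have e : κ (σ z) = (starRingEnd ℂ) z := by
      simp only [hσ]; conv_rhs => rw [← hz, Complex.conj_conj]
    simp only [hh]
    rw [e, hσ]
    simp only [map_div₀, map_add, map_mul, Complex.conj_conj, map_ofNat]
    ring
  have hκt : Tendsto κ (𝓝 0) (𝓝 0) := by
    have := K.analyticAt.continuousAt.tendsto
    rwa [K.map_zero] at this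
  have hσt : Tendsto σ (𝓝 0) (𝓝 0) := tendsto_conj_nhds_zero.comp hκt
  have hft : Tendsto f (𝓝 0) (𝓝 0) := by
    have := f1.continuousAt.tendsto
    rwa [f2] at this
  have hgt : Tendsto g (𝓝 0) (𝓝 0) := by
    have := hg.continuousAt.tendsto
    rwa [hg0] at this
  refine ⟨h, _, H, (hasRealCoefficients_iff hr).2 ?_, ?_⟩
  · filter_upwards [f4, hft.eventually hhσ, (hgt.comp hft).eventually hhσ,
      (hσt.comp hft).eventually f5, hft.eventually K.conj_eq] with w a1 a2 a3 a4 a5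
    simp only [Function.comp, conjGerm_apply] at a3 a4 a5 ⊢
    have e1 : f ((starRingEnd ℂ) w) = σ (f w) := by
      rw [a1] at a2
      rw [← a2, a4]
    have e2 : g (σ (f w)) = σ (g (f w)) := by
      simp only [hσ, a5, Complex.conj_conj]
    rw [e1, e2, a3, Complex.conj_conj]
  · rw [hhd, hc, ← Complex.exp_add]
    simp

/-- A symmetry of the transition functions gives a conjugacy to a real germ. -/
theorem IsTransition.exists_isConjugacy {Ψ : ℤ → ℂ → ℂ} {l : ℤ} (hT : IsTransition g k b Ψ)
    (hS : IsSymmetric k l Ψ) (hg : IsPrenormalized g k b) (hk : 1 ≤ k) :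
    ∃ h r : ℂ → ℂ, IsConjugacy h g r ∧ HasRealCoefficients r ∧
      (deriv h 0 * Complex.exp (Real.pi * l / k * Complex.I)).im = 0 := by
  have hpi := Real.pi_pos
  have hkr : (0:ℝ) < k := by exact_mod_cast hk
  have hq0 : 0 < Real.pi / (2 * k) := by positivity
  have hq1 := pi_div_two_mul_add hk
  obtain ⟨D, s, δ, hs, hδ0, hδ1, hglue⟩ := hT.exists_family hg hk
  have hglue' := IsTransition.isGluing_ofPosition hk hs hglue
  -- The symmetry says that g and its mirror image have the same transition functions after a shift
  -- of positions by -2ℓ; the resulting κ respects the coordinates without any translation.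
  obtain ⟨κ, K, hKd, α, ha1, ha2, hrel⟩ := exists_isConjugacy_of_isGluing (m := -l) hk hg hg.conjGerm
    hs (hs.conjGerm hk) hδ0 (by
      intro p
      refine ⟨Ψ (ofPosition k p), hglue' p, ?_⟩
      have hm : Tendsto (starRingEnd ℂ) (germSector (midDirection k (p + 2 * -l)) δ)
          (germSector (midDirection k (2 * l + 1 - p)) δ) := by
        have : midDirection k (2 * l + 1 - p) = -midDirection k (p + 2 * -l) := by
          unfold midDirection; push_cast; ring
        rw [this]; exact tendsto_conj_germSector _ _
      have h1 := hS _ (isIndex_ofPosition hk p)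
      have h2 : reflectIndex k l (ofPosition k p) = ofPosition k (2 * l + 1 - p) := by
        obtain ⟨n, hn⟩ := position_ofPosition hk p
        unfold reflectIndex
        rw [hn, show 2 * l + 1 - (p + 2 * k * n) = 2 * l + 1 - p + 2 * k * -n by ring, ofPosition_add]
      rw [h2, farEnd_ofPosition hk] at h1
      have h3 := ((hs.coord (source (2 * l + 1 - p))).tendsto_planeEnd hk (source_eq_or _) hδ1).eventually h1
      unfold IsGluing
      filter_upwards [hm.eventually h3, hm.eventually (hglue' (2 * l + 1 - p))] with z a1 a2
      rw [source_reflect] at a1 a2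
      rw [target_reflect] at a2
      rw [source_add_even, target_add_even, conjGerm_apply, conjGerm_apply,
        show -(source p + 2 * -l) = 2 * l - source p by ring,
        show -(target p + 2 * -l) = 2 * l - target p by ring, ← a2]
      exact a1)
  have hKt := tendsto_div_of_deriv K.analyticAt.differentiableAt K.map_zero
  rw [hKd] at hKt
  refine exists_isConjugacy_of_involution hk hg.1 hg.map_zero K hKd ?_
  set σ : ℂ → ℂ := fun z => (starRingEnd ℂ) (κ z) with hσ
  have hrel' : ∀ j, ∀ᶠ z in germSector (direction k j) α,
      s (2 * l - j) (σ z) = (starRingEnd ℂ) (s j z) := by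
    intro j
    filter_upwards [hrel j] with z hz
    rw [← hz, conjGerm_apply, Complex.conj_conj, show -(j + 2 * -l) = 2 * l - j by ring]
  obtain ⟨α', ha3, ha4⟩ := exists_between ha1
  obtain ⟨α₁, ha5, ha6⟩ := exists_between ha2
  -- σ acts on Fatou coordinates by Σ, so σ ∘ σ fixes them, and they are injective.
  have hne : ∀ᶠ z in 𝓝[≠] (0:ℂ), σ (σ z) = z := by
    refine eventually_nhdsNE_of_germSector hk ha3 fun j => ?_
    have hm1 : Tendsto σ (germSector (direction k j) α') (germSector (direction k (2 * l - j)) α) :=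
      tendsto_conj_comp_germSector hKt (direction_reflect l j) ha4 (by linarith [pi_div_le hk])
    have hm2 : Tendsto σ (germSector (direction k (2 * l - j)) α) (germSector (direction k j) α₁) :=
      tendsto_conj_comp_germSector hKt
        (by rw [← direction_reflect l (2 * l - j)]; congr 1; ring) ha5 (by linarith [pi_div_le hk])
    obtain ⟨ρ, hρ, hinj⟩ := (hs.coord j).exists_injOn hk ha6
    have hmem : ∀ᶠ w in germSector (direction k j) α₁, w ∈ sector (direction k j) α₁ ρ :=
      eventually_germSector.2 ⟨ρ, hρ, fun _ h => h⟩
    filter_upwards [hm1.eventually (hrel' (2 * l - j)),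
      (hrel' j).filter_mono (germSector_mono ha4.le), (hm2.comp hm1).eventually hmem,
      hmem.filter_mono (germSector_mono (ha4.le.trans ha5.le))] with z a1 a2 a3 a4
    refine hinj a3 a4 ?_
    simp only [Function.comp]
    rw [a2, show 2 * l - (2 * l - j) = j by ring, Complex.conj_conj] at a1
    exact a1
  rw [eventually_nhdsWithin_iff] at hne
  filter_upwards [hne] with z hz
  by_cases hz0 : z = 0
  · simp [hz0, K.map_zero]
  · exact hz hz0

end

end

/-! ### Prenormalization and possible axes of a real conjugacy. -/

theorem exists_eq_add_mul {F : ℂ → ℂ} (hF : AnalyticAt ℂ F 0) :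
    ∃ q : ℂ → ℂ, AnalyticAt ℂ q 0 ∧ ∀ᶠ z in 𝓝 0, F z = F 0 + z * q z := by
  obtain ⟨q, hq, h⟩ := exists_eq_pow_mul_of_isBigO (hF.fun_sub (analyticAt_const (v := F 0))) 1 (by
    simpa using hF.differentiableAt.isBigO_sub)
  refine ⟨q, hq, h.mono fun z hz => ?_⟩
  rw [pow_one] at hz
  rw [← hz]; ring

theorem exists_quadratic_remainder (n : ℕ) : ∃ B : ℂ → ℂ, Continuous B ∧ ∀ u : ℂ,
    (1 + u) ^ n = 1 + n * u + u ^ 2 * B u := by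
  induction n with
  | zero => exact ⟨0, continuous_const, by simp⟩
  | succ n ih =>
    obtain ⟨B, hB, h⟩ := ih
    refine ⟨fun u => n + (1 + u) * B u, by fun_prop, fun u => ?_⟩
    rw [pow_succ, h]; push_cast; ring

/-- Removal of the term of degree `k + p + 1`. -/
theorem exists_isConjugacy_remove_term {k p : ℕ} (hp : 1 ≤ p) (hpk : p < k) {g q : ℂ → ℂ}
    (hg : AnalyticAt ℂ g 0) (hq : AnalyticAt ℂ q 0)
    (h : ∀ᶠ z in 𝓝 0, g z = z + z ^ (k + 1) + z ^ (k + p + 1) * q z) :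
    ∃ η g₁ q₁ : ℂ → ℂ, IsConjugacy η g g₁ ∧ AnalyticAt ℂ g₁ 0 ∧ AnalyticAt ℂ q₁ 0 ∧
      ∀ᶠ z in 𝓝 0, g₁ z = z + z ^ (k + 1) + z ^ (k + (p + 1) + 1) * q₁ z := by
  obtain ⟨n, rfl⟩ : ∃ n, p = n + 1 := ⟨p - 1, by omega⟩
  obtain ⟨m, rfl⟩ : ∃ m, k = n + 2 + m := ⟨k - (n + 2), by omega⟩
  have hg0 : g 0 = 0 := by
    have := h.self_of_nhds
    simpa using this
  obtain ⟨q₂, hq₂, hq₂e⟩ := exists_eq_add_mul hq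
  -- Conjugation by z + d z^(p+1) changes the coefficient of degree k + p + 1 by d(p + 1) - d(k + 1)
  -- = -d(k - p), and m + 1 = k - p. Only the resonant degree 2k + 1, where p = k, resists.
  set d : ℂ := q 0 / (m + 1) with hd
  have hm : (m : ℂ) + 1 ≠ 0 := by exact_mod_cast Nat.succ_ne_zero m
  have hdm : q 0 = d * (m + 1) := by rw [hd]; field_simp
  set η : ℂ → ℂ := fun z => z + d * z ^ (n + 2) with hη
  have hηa : AnalyticAt ℂ η 0 := by fun_prop
  have hη0 : η 0 = 0 := by simp [hη]
  have hηd : deriv η 0 = 1 := by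
    have h1 : HasDerivAt η (1 + d * ((n + 2 : ℕ) * 0 ^ (n + 2 - 1) * 1)) 0 :=
      (hasDerivAt_id (0:ℂ)).add (((hasDerivAt_id (0:ℂ)).pow (n + 2)).const_mul d)
    rw [h1.deriv]; simp
  have hη1 : deriv η 0 ≠ 0 := by rw [hηd]; exact one_ne_zero
  obtain ⟨f, f1, f2, f3, f4, f5⟩ := exists_inverse_germ hηa hη0 hη1
  obtain ⟨H, hr⟩ := exists_conj_by hηa hg f1 hη0 hg0 f2 hη1 f5
  obtain ⟨B, hB, hBe⟩ := exists_quadratic_remainder (n + 2)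
  obtain ⟨B', hB', hBe'⟩ := exists_quadratic_remainder (n + 2 + m + 1)
  set v : ℂ → ℂ := fun z => 1 + z ^ (n + 1) * q z with hv
  set Q : ℂ → ℂ := fun z => q₂ z + d * (n + 2) * z ^ n * q z +
    d * z ^ (m + n + 1) * v z ^ 2 * B (z ^ (n + 2 + m) * v z) - z ^ n * d ^ 2 * B' (d * z ^ (n + 1))
    with hQ
  have hQc : ContinuousAt Q 0 := by
    have h1 := hq.continuousAt
    have h2 := hq₂.continuousAt
    have h3 : ContinuousAt v 0 := by fun_prop
    have h4 : ContinuousAt (fun z => B (z ^ (n + 2 + m) * v z)) 0 :=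
      ContinuousAt.comp (g := B) hB.continuousAt (by fun_prop)
    have h5 : ContinuousAt (fun z => B' (d * z ^ (n + 1))) 0 :=
      ContinuousAt.comp (g := B') hB'.continuousAt (by fun_prop)
    fun_prop
  have hkey : ∀ᶠ z in 𝓝 0, η (g z) - η z - η z ^ (n + 2 + m + 1) =
      z ^ (n + 2 + m + (n + 1 + 1) + 1) * Q z := by
    filter_upwards [h, hq₂e] with z h1 h2
    have e1 : g z = z * (1 + z ^ (n + 2 + m) * v z) := by rw [h1, hv]; ring
    have e2 : g z ^ (n + 2) = z ^ (n + 2) * (1 + ((n + 2 : ℕ) : ℂ) * (z ^ (n + 2 + m) * v z) +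
        (z ^ (n + 2 + m) * v z) ^ 2 * B (z ^ (n + 2 + m) * v z)) := by
      rw [← hBe, e1, mul_pow]
    have e3 : η z ^ (n + 2 + m + 1) = z ^ (n + 2 + m + 1) *
        (1 + ((n + 2 + m + 1 : ℕ) : ℂ) * (d * z ^ (n + 1)) +
          (d * z ^ (n + 1)) ^ 2 * B' (d * z ^ (n + 1))) := by
      rw [← hBe', ← mul_pow, hη]; ring
    rw [e3]
    simp only [hη]
    rw [e2, e1]
    have hqz : q z = d * (m + 1) + z * q₂ z := by rw [h2, hdm]
    have hvz : v z = 1 + z ^ (n + 1) * (d * (m + 1) + z * q₂ z) := by rw [hv, ← hqz]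
    simp only [hQ]
    generalize B (z ^ (n + 2 + m) * v z) = x
    generalize B' (d * z ^ (n + 1)) = x'
    rw [hqz, hvz]
    push_cast
    ring
  set R : ℂ → ℂ := fun w => (η ∘ g ∘ f) w - w - w ^ (n + 2 + m + 1) with hR
  have hRa : AnalyticAt ℂ R 0 := (hr.fun_sub analyticAt_id).fun_sub (by fun_prop)
  have hft : Tendsto f (𝓝 0) (𝓝 0) := by
    have := f1.continuousAt.tendsto
    rwa [f2] at this
  have hRO : R =O[𝓝 0] fun w => w ^ (n + 2 + m + (n + 1 + 1) + 1) := by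
    have h1 : f =O[𝓝 0] fun w => w := by simpa [f2] using f1.differentiableAt.isBigO_sub
    have h2 : (fun w => Q (f w)) =O[𝓝 0] fun _ => (1:ℂ) := by
      have h3 : Tendsto (fun w => Q (f w)) (𝓝 0) (𝓝 (Q 0)) := hQc.tendsto.comp hft
      exact h3.isBigO_one ℂ
    have h3 := (h1.pow (n + 2 + m + (n + 1 + 1) + 1)).mul h2
    refine h3.congr' ?_ (by simp)
    filter_upwards [hft.eventually hkey, f4] with w a1 a2
    simp only [hR, Function.comp]
    rw [← a1, a2]
  obtain ⟨q₁, hq₁, hq₁e⟩ := exists_eq_pow_mul_of_isBigO hRa _ hRO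
  refine ⟨η, _, q₁, H, hr, hq₁, hq₁e.mono fun z hz => ?_⟩
  simp only [hR] at hz
  linear_combination hz

/-- A dilation by a k-th root of the leading coefficient makes that coefficient 1; the degrees k +
2, …, 2k are then removed one by one. The coefficient left in degree 2k + 1 defines b. -/
theorem IsParabolic.exists_isPrenormalized {g : ℂ → ℂ} {k : ℕ} (hg : IsParabolic g k) :
    ∃ (h g₀ : ℂ → ℂ) (b : ℂ), IsConjugacy h g g₀ ∧ IsPrenormalized g₀ k b := by
  have hk := hg.codim_pos
  have hbase : ∃ h g₁ q : ℂ → ℂ, IsConjugacy h g g₁ ∧ AnalyticAt ℂ g₁ 0 ∧ AnalyticAt ℂ q 0 ∧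
      ∀ᶠ z in 𝓝 0, g₁ z = z + z ^ (k + 1) + z ^ (k + 1 + 1) * q z := by
    obtain ⟨u, hu, hu0, hue⟩ := ((hg.analyticAt.fun_sub analyticAt_id).analyticOrderAt_eq_natCast).1 hg.order
    obtain ⟨c, hc⟩ := IsAlgClosed.exists_pow_nat_eq (u 0) (show 0 < k by omega)
    have hc0 : c ≠ 0 := by
      rintro rfl
      rw [zero_pow (by omega)] at hc
      exact hu0 hc.symm
    have hmul : Tendsto (fun z : ℂ => c⁻¹ * z) (𝓝 0) (𝓝 0) := by
      have : Tendsto (fun z : ℂ => c⁻¹ * z) (𝓝 0) (𝓝 (c⁻¹ * 0)) := (continuous_const_mul c⁻¹).tendsto 0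
      rwa [mul_zero] at this
    have hua : AnalyticAt ℂ (fun z => (c ^ k)⁻¹ * u (c⁻¹ * z)) 0 := by
      refine analyticAt_const.mul (AnalyticAt.comp (g := u) (f := fun z => c⁻¹ * z) ?_ (by fun_prop))
      rwa [mul_zero]
    obtain ⟨q, hq, hqe⟩ := exists_eq_add_mul hua
    have hd : deriv (fun z : ℂ => c * z) 0 = c := by simp
    obtain ⟨H, hr⟩ := exists_conj_by (h := fun z => c * z) (f := fun z => c⁻¹ * z) (by fun_prop)
      hg.analyticAt (by fun_prop) (by simp) hg.map_zero (by simp) (by rwa [hd])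
      (Eventually.of_forall fun z => inv_mul_cancel_left₀ hc0 z)
    refine ⟨_, _, q, H, hr, hq, ?_⟩
    filter_upwards [hmul.eventually hue, hqe] with z h1 h2
    rw [sub_zero, smul_eq_mul, sub_eq_iff_eq_add] at h1
    simp only [mul_zero, hc, inv_mul_cancel₀ hu0] at h2
    simp only [Function.comp, h1, id]
    have h3 : u (c⁻¹ * z) = c ^ k * (1 + z * q z) := by
      rw [hc, ← h2, mul_inv_cancel_left₀ hu0]
    rw [h3, mul_pow, inv_pow]
    field_simp
    ring
  have hind : ∀ p, 1 ≤ p → p ≤ k → ∃ h g₁ q : ℂ → ℂ, IsConjugacy h g g₁ ∧ AnalyticAt ℂ g₁ 0 ∧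
      AnalyticAt ℂ q 0 ∧ ∀ᶠ z in 𝓝 0, g₁ z = z + z ^ (k + 1) + z ^ (k + p + 1) * q z := by
    intro p hp
    induction p, hp using Nat.le_induction with
    | base => exact fun _ => hbase
    | succ p hp ih =>
      intro hpk
      obtain ⟨h, g₁, q, h1, h2, h3, h4⟩ := ih (by omega)
      obtain ⟨η, g₂, q₂, a1, a2, a3, a4⟩ := exists_isConjugacy_remove_term hp (by omega) h2 h3 h4
      exact ⟨_, g₂, q₂, (h1.trans a1).1, a2, a3, a4⟩
  obtain ⟨h, g₁, q, h1, h2, h3, h4⟩ := hind k hk le_rfl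
  refine ⟨h, g₁, ((k:ℂ) + 1) / 2 - q 0, h1, h2, ?_⟩
  have h5 : (fun z => q z - q 0) =o[𝓝 0] fun _ => (1:ℂ) := by
    rw [isLittleO_one_iff]
    have := h3.continuousAt.tendsto.sub_const (q 0)
    rwa [sub_self] at this
  have h6 := (isBigO_refl (fun z : ℂ => z ^ (2 * k + 1)) (𝓝 0)).mul_isLittleO h5
  refine h6.congr' ?_ (by simp)
  filter_upwards [h4] with z hz
  rw [hz, ← two_mul]; ring

/-- The multiplier of a conjugacy to a real germ. -/
theorem IsConjugacy.exists_axis {f g r : ℂ → ℂ} {k : ℕ} {b : ℂ} (H : IsConjugacy f g r)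
    (hr : HasRealCoefficients r) (hg : IsPrenormalized g k b) (hk : 1 ≤ k) :
    ∃ l : ℤ, (deriv f 0 * Complex.exp (Real.pi * l / k * Complex.I)).im = 0 := by
  have hk0 := natCast_ne_zero_of_pos hk
  set c := deriv f 0 with hc
  have hc0 : c ≠ 0 := H.deriv_ne_zero
  have hgt : Tendsto (fun z => (g z - z) / z ^ (k + 1)) (𝓝[≠] 0) (𝓝 1) := by
    obtain ⟨q, hq, hqe⟩ := hg.expansion
    have hqc := hq.continuousAt
    have h1 : ContinuousAt (fun z => 1 + (((k : ℂ) + 1) / 2 - b) * z ^ k + z ^ (k + 1) * q z) 0 := by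
      fun_prop
    have h2 := h1.tendsto.mono_left (nhdsWithin_le_nhds (s := {0}ᶜ))
    simp only [zero_pow (show k ≠ 0 by omega), zero_pow (show k + 1 ≠ 0 by omega), mul_zero, zero_mul,
      add_zero] at h2
    refine h2.congr' ?_
    filter_upwards [self_mem_nhdsWithin, nhdsWithin_le_nhds hqe] with z hz hz1
    have hz : z ≠ 0 := hz
    rw [hz1, eq_div_iff (pow_ne_zero _ hz)]; ring
  have hg0t : Tendsto g (𝓝[≠] 0) (𝓝 0) := by
    have := hg.1.continuousAt.tendsto
    rw [hg.map_zero] at this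
    exact this.mono_left nhdsWithin_le_nhds
  have hft : Tendsto (fun z => (f (g z) - f z) / z ^ (k + 1)) (𝓝[≠] 0) (𝓝 c) := by
    have h1 := H.analyticAt.hasStrictDerivAt.hasStrictFDerivAt.isLittleO
    have h2 : Tendsto (fun z => (g z, z)) (𝓝[≠] 0) (𝓝 ((0:ℂ), (0:ℂ))) :=
      hg0t.prodMk_nhds (tendsto_id.mono_left nhdsWithin_le_nhds)
    have h3 := (h1.comp_tendsto h2)
    have h4 : (fun z => g z - z) =O[𝓝[≠] 0] fun z => z ^ (k + 1) := by
      refine isBigO_of_div_tendsto_nhds ?_ 1 hgt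
      filter_upwards [self_mem_nhdsWithin] with z hz h0
      exact absurd h0 (pow_ne_zero _ hz)
    have h5 := (h3.trans_isBigO h4).tendsto_div_nhds_zero
    have h6 := h5.add (hgt.const_mul c)
    rw [zero_add, mul_one] at h6
    refine h6.congr fun z => ?_
    simp only [Function.comp, ContinuousLinearMap.toSpanSingleton_apply, smul_eq_mul, ← hc]
    ring
  obtain ⟨e, E, -, he, -⟩ := H.exists_symm hg.1.continuousAt hg.map_zero
  have het := tendsto_nhdsNE_of_tendsto_div E.deriv_ne_zero
    (tendsto_div_of_deriv E.analyticAt.differentiableAt E.map_zero)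
  have hfz := tendsto_div_of_deriv H.analyticAt.differentiableAt H.map_zero
  -- The leading coefficient of r - id is c^(-k), and it is real because r is. Hence c^k is real,
  -- the argument of c is a multiple nπ/k, and ℓ = -n turns c to the real axis.
  have hlim : Tendsto (fun w => (r w - w) / w ^ (k + 1)) (𝓝[≠] 0) (𝓝 (c / c ^ (k + 1))) := by
    have h1 := (hft.div (hfz.pow (k + 1)) (pow_ne_zero _ hc0)).comp het
    refine h1.congr' ?_
    filter_upwards [nhdsWithin_le_nhds he, het.eventually (nhdsWithin_le_nhds H.conj_eq),
      het.eventually self_mem_nhdsWithin] with w a1 a2 a3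
    have a3 : e w ≠ 0 := a3
    simp only [Function.comp, Pi.div_apply] at a2 ⊢
    rw [a2, a1, div_pow, div_div_div_cancel_right₀ (pow_ne_zero _ a3)]
  have hreal : Tendsto (fun t : ℝ => (t : ℂ)) (𝓝[≠] 0) (𝓝[≠] 0) := by
    refine tendsto_nhdsWithin_iff.2 ⟨?_, ?_⟩
    · have : Tendsto (fun t : ℝ => (t : ℂ)) (𝓝 0) (𝓝 0) := by
        simpa using Complex.continuous_ofReal.tendsto 0
      exact this.mono_left nhdsWithin_le_nhds
    · filter_upwards [self_mem_nhdsWithin] with t ht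
      have ht : t ≠ 0 := ht
      simpa using ht
  have him := (Complex.continuous_im.tendsto _).comp (hlim.comp hreal)
  have him0 : (c / c ^ (k + 1)).im = 0 := by
    refine tendsto_nhds_unique_of_eventuallyEq him tendsto_const_nhds ?_
    filter_upwards [nhdsWithin_le_nhds ((hasRealCoefficients_iff_real hr.1).1 hr)] with t ht
    simp only [Function.comp]
    have : r t = ((r t).re : ℂ) := Complex.ext (by simp) (by simp [ht])
    rw [this, ← Complex.ofReal_sub, ← Complex.ofReal_pow, ← Complex.ofReal_div, Complex.ofReal_im]
  have hck : (c ^ k).im = 0 := by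
    have h1 : c / c ^ (k + 1) = (c ^ k)⁻¹ := by rw [pow_succ]; field_simp
    rw [h1, ← Complex.conj_eq_iff_im, map_inv₀, inv_inj, Complex.conj_eq_iff_im] at him0
    exact him0
  have hpol := Complex.norm_mul_exp_arg_mul_I c
  have hsin : Real.sin (k * c.arg) = 0 := by
    rw [← hpol, mul_pow, ← Complex.exp_nat_mul, ← Complex.ofReal_pow, Complex.im_ofReal_mul,
      show (k:ℂ) * (c.arg * Complex.I) = ((k * c.arg : ℝ) : ℂ) * Complex.I by push_cast; ring,
      Complex.exp_ofReal_mul_I_im] at hck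
    exact (mul_eq_zero.1 hck).resolve_left (pow_ne_zero _ (norm_ne_zero_iff.2 hc0))
  obtain ⟨n, hn⟩ := Real.sin_eq_zero_iff.1 hsin
  refine ⟨-n, ?_⟩
  have hn' : (n : ℂ) * Real.pi = k * c.arg := by exact_mod_cast hn
  rw [← hpol, mul_assoc, ← Complex.exp_add]
  have : c.arg * Complex.I + Real.pi * ((-n : ℤ) : ℂ) / k * Complex.I = 0 := by
    push_cast
    field_simp
    linear_combination (-Complex.I) * hn'
  rw [this, Complex.exp_zero, mul_one, Complex.ofReal_im]

/-! ### Reduction of twisted symmetries to symmetries. -/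

theorem im_mul_inv_eq_zero {x y : ℂ} (h : (x * y⁻¹).im = 0) : (x⁻¹ * y).im = 0 := by
  rw [← Complex.conj_eq_iff_im] at h ⊢
  have e : x⁻¹ * y = (x * y⁻¹)⁻¹ := by rw [mul_inv, inv_inv]
  rw [e, map_inv₀, h]

/-- Translating the Fatou coordinates turns a twisted symmetry into a symmetry. -/
theorem isSymmetric_of_isTwistedSymmetric {k : ℕ} (hk : 1 ≤ k) {l m : ℤ} {y : ℝ} {Ψ : ℤ → ℂ → ℂ}
    (h : IsTwistedSymmetric k (l + 2 * m) y Ψ) :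
    IsSymmetric k l fun j => T (Complex.I * (y / 2 : ℝ)) ∘ Ψ (rotateIndex k m j) ∘
      T (-(Complex.I * (y / 2 : ℝ))) := by
  rw [isSymmetric_iff_isTwistedSymmetric hk,
    isTwistedSymmetric_iff_of_equivalent hk (fun _ _ => EventuallyEq.rfl) l 0]
  -- Translating by C changes the twist by 2 Im C, so C = iy/2 is what reduces it to 0.
  have : (0:ℝ) + 2 * (Complex.I * ((y / 2 : ℝ) : ℂ)).im = y := by
    rw [Complex.I_mul_im, Complex.ofReal_re]; ring
  rwa [this]

theorem IsTransition.exists_isSymmetric {g : ℂ → ℂ} {k : ℕ} {b : ℂ} {Ψ : ℤ → ℂ → ℂ} {l : ℤ} {y : ℝ}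
    (hk : 1 ≤ k) (hT : IsTransition g k b Ψ) (h : IsTwistedSymmetric k l y Ψ) :
    ∃ Ψ', IsTransition g k b Ψ' ∧ IsSymmetric k l Ψ' := by
  refine ⟨_, hT.translate (Complex.I * (y / 2 : ℝ)), ?_⟩
  have h1 := isSymmetric_of_isTwistedSymmetric hk (l := l) (m := 0) (y := y) (Ψ := Ψ) (by simpa using h)
  intro j hj
  have h2 := h1 j hj
  simpa only [rotateIndex_zero hj, rotateIndex_zero (isIndex_reflectIndex hk l j)] using h2

/-- Rotations shift ℓ by even integers, and ℓ + k gives the same axis. For odd k a shift by k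
corrects the parity, so ℓ = 0 suffices; for even k the parity of ℓ is preserved by both, which is
the origin of the second alternative in (A). -/
theorem exists_parity (k : ℕ) (l : ℤ) : ∃ m l' n : ℤ, l = l' + 2 * m + n * k ∧ (n = 0 ∨ n = -1) ∧
    (l' = 0 ∨ l' = 1 ∧ Even k) := by
  rcases Int.even_or_odd' l with ⟨c, hc | hc⟩
  · exact ⟨c, 0, 0, by rw [hc]; ring, Or.inl rfl, Or.inl rfl⟩
  · rcases Nat.even_or_odd k with hk | hk
    · exact ⟨c, 1, 0, by rw [hc]; ring, Or.inl rfl, Or.inr ⟨rfl, hk⟩⟩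
    · obtain ⟨d, hd⟩ := hk
      refine ⟨c + d + 1, 0, -1, ?_, Or.inr rfl, Or.inl rfl⟩
      rw [hc, hd]; push_cast; ring

theorem IsTwistedSymmetric.exists_isSymmetric {k : ℕ} (hk : 1 ≤ k) {l : ℤ} {y : ℝ} {Ψ : ℤ → ℂ → ℂ}
    (h : IsTwistedSymmetric k l y Ψ) :
    ∃ Ψ', Equivalent k Ψ' Ψ ∧ (IsSymmetric k 0 Ψ' ∨ Even k ∧ IsSymmetric k 1 Ψ') := by
  obtain ⟨m, l', n, hl, hn, hl'⟩ := exists_parity k l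
  have h1 : IsTwistedSymmetric k (l' + 2 * m) y Ψ := by
    rcases hn with rfl | rfl
    · rw [Int.zero_mul, add_zero] at hl
      rwa [← hl]
    · rw [show l' + 2 * m = l + k by rw [hl]; ring]
      exact isTwistedSymmetric_add_codim.2 h
  refine ⟨fun j => T (Complex.I * (y / 2 : ℝ)) ∘ Ψ (rotateIndex k m j) ∘
      T (-(Complex.I * (y / 2 : ℝ))), ⟨_, m, fun _ _ => EventuallyEq.rfl⟩, ?_⟩
  have h2 := isSymmetric_of_isTwistedSymmetric hk h1
  rcases hl' with rfl | ⟨rfl, he⟩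
  · exact Or.inl h2
  · exact Or.inr ⟨he, h2⟩

end ParabolicGerm

/-! ### The two chains of equivalences. -/

theorem mainTheorem6 (g : ℂ → ℂ) (k : ℕ) (hg : IsParabolic g k) :
    [ ∃ γ : ℝ → ℂ, IsInvariantCurve g γ,
      ∃ h r : ℂ → ℂ, IsConjugacy h g r ∧ HasRealCoefficients r,
      ∀ (b : ℂ) (Ψ : ℤ → ℂ → ℂ), IsModulusRepresentative g k b Ψ →
        ∃ (l : ℤ) (y : ℝ), IsTwistedSymmetric k l y Ψ,
      ∃ (b : ℂ) (Ψ : ℤ → ℂ → ℂ), IsModulusRepresentative g k b Ψ ∧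
        (IsSymmetric k 0 Ψ ∨ Even k ∧ IsSymmetric k 1 Ψ) ].TFAE ∧
    ∀ b : ℂ, IsPrenormalized g k b → ∀ l : ℤ,
      [ ∃ γ : ℝ → ℂ, IsInvariantCurve g γ ∧
          (deriv γ 0 * Complex.exp (-(Real.pi * l / k * Complex.I))).im = 0,
        ∃ h r : ℂ → ℂ, IsConjugacy h g r ∧ HasRealCoefficients r ∧
          (deriv h 0 * Complex.exp (Real.pi * l / k * Complex.I)).im = 0,
        ∀ Ψ : ℤ → ℂ → ℂ, IsTransition g k b Ψ → ∃ y : ℝ, IsTwistedSymmetric k l y Ψ,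
        ∃ Ψ : ℤ → ℂ → ℂ, IsTransition g k b Ψ ∧ IsSymmetric k l Ψ ].TFAE := by
  have hk := hg.codim_pos
  have ha := hg.analyticAt
  have h0 := hg.map_zero
  refine ⟨?_, fun b hb l => ?_⟩
  · tfae_have 1 → 2 := by
      rintro ⟨γ, hγ⟩
      obtain ⟨h, r, h1, h2, -⟩ := hγ.exists_isConjugacy ha h0
      exact ⟨h, r, h1, h2⟩
    tfae_have 2 → 1 := by
      rintro ⟨h, r, h1, h2⟩
      obtain ⟨γ, hγ, -⟩ := h1.exists_isInvariantCurve h2 ha h0 hg.multiplier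
      exact ⟨γ, hγ⟩
    -- The conjugacy to a real germ is transported to the prenormalized g₀ behind the
    -- representative, where `exists_axis` supplies ℓ; undoing the rotation and the translation
    -- subtracts 2m from ℓ and 2 Im C from y.
    tfae_have 2 → 3 := by
      rintro ⟨h, r, h1, h2⟩ b Ψ ⟨h', g₀, Ψ₀, H, hg₀, hT, C, m, hC⟩
      obtain ⟨f, F, -⟩ := H.exists_symm ha.continuousAt h0
      have K := (F.trans h1).1
      obtain ⟨l, hl⟩ := K.exists_axis h2 hg₀ hk
      obtain ⟨y, hy⟩ := K.exists_isTwistedSymmetric h2 hl hg₀ hk hT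
      refine ⟨l - 2 * m, y - 2 * C.im, (isTwistedSymmetric_iff_of_equivalent hk hC _ _).2 ?_⟩
      simpa using hy
    tfae_have 3 → 4 := by
      intro h3
      obtain ⟨h, g₀, b, H, hg₀⟩ := hg.exists_isPrenormalized
      obtain ⟨Ψ, hΨ⟩ := hg₀.exists_isTransition hk
      obtain ⟨l, y, hy⟩ := h3 b Ψ ⟨h, g₀, Ψ, H, hg₀, hΨ, 0, 0, fun j hj => by
        rw [rotateIndex_zero hj]
        exact Eventually.of_forall fun W => by simp [T]⟩
      obtain ⟨Ψ', h4, h5⟩ := hy.exists_isSymmetric hk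
      exact ⟨b, Ψ', ⟨h, g₀, Ψ, H, hg₀, hΨ, h4⟩, h5⟩
    -- For the normalized tuple Ψ₀ the symmetry is twisted and about a shifted axis; a translation
    -- of the Fatou coordinates removes the twist and keeps the tuple normalized.
    tfae_have 4 → 2 := by
      rintro ⟨b, Ψ, ⟨h', g₀, Ψ₀, H, hg₀, hT, C, m, hC⟩, hS⟩
      obtain ⟨l, hl⟩ : ∃ l, IsSymmetric k l Ψ := by
        rcases hS with hS | ⟨-, hS⟩
        · exact ⟨0, hS⟩
        · exact ⟨1, hS⟩
      rw [isSymmetric_iff_isTwistedSymmetric hk, isTwistedSymmetric_iff_of_equivalent hk hC] at hl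
      obtain ⟨Ψ', hT', hS'⟩ := hT.exists_isSymmetric hk hl
      obtain ⟨h, r, K, hr, -⟩ := hT'.exists_isConjugacy hS' hg₀ hk
      exact ⟨_, r, (H.trans K).1, hr⟩
    tfae_finish
  · tfae_have 1 → 2 := by
      rintro ⟨γ, hγ, hl⟩
      obtain ⟨h, r, h1, h2, h3⟩ := hγ.exists_isConjugacy ha h0
      refine ⟨h, r, h1, h2, ?_⟩
      rw [Complex.exp_neg] at hl
      rw [h3]
      exact im_mul_inv_eq_zero hl
    tfae_have 2 → 1 := by
      rintro ⟨h, r, h1, h2, hl⟩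
      obtain ⟨γ, hγ, h3⟩ := h1.exists_isInvariantCurve h2 ha h0 hg.multiplier
      refine ⟨γ, hγ, ?_⟩
      rw [h3, Complex.exp_neg]
      exact im_mul_inv_eq_zero (by rwa [inv_inv])
    tfae_have 2 → 3 := by
      rintro ⟨h, r, h1, h2, hl⟩ Ψ hΨ
      exact h1.exists_isTwistedSymmetric h2 hl hb hk hΨ
    tfae_have 3 → 4 := by
      intro h3
      obtain ⟨Ψ, hΨ⟩ := hb.exists_isTransition hk
      obtain ⟨y, hy⟩ := h3 Ψ hΨ
      exact hΨ.exists_isSymmetric hk hy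
    tfae_have 4 → 2 := by
      rintro ⟨Ψ, hT, hS⟩
      exact hT.exists_isConjugacy hS hb hk
    tfae_finish
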